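/- Let $d\ge 2$ and $n\ge 0$ be integers, and let $G_d(n)$ be the $d$-dimensional grid of side length $n$: its vertices are the points of $\{0,\dots,n-1\}^d$, and two vertices are adjacent iff they differ in exactly one coordinate, and there by exactly $1$. There is a single algorithm (a program of a random access machine under the logarithmic cost criterion) which, given $d$ and $n$, computes the number of perfect matchings of $G_d(n)$ in time $$O^*\!\left(2^{\frac{2^d-1}{2^{d-1}-1}\,n^{d-1}}\right)$$ and in polynomial space. Here $O^*$ hides factors polynomial in the size of the grid: there is one polynomial $p$, independent of $d$ and $n$, such that for all $d\ge 2$ and $n\ge 0$ the running time is at most $p(d+n^d)\cdot 2^{\frac{2^d-1}{2^{d-1}-1}n^{d-1}}$ and the space used, in bits, is at most $p(d+n^d)$. -/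

import Mathlib

/-- The `d`-dimensional grid of side length `n`: the vertices are the points of `{0, …, n-1}^d`, and
two vertices are adjacent iff they differ in exactly one coordinate, and there by exactly `1`. -/
def gridGraph (d n : ℕ) : SimpleGraph (Fin d → Fin n) where
  Adj x y := ∃ i, ((x i : ℕ) + 1 = y i ∨ (y i : ℕ) + 1 = x i) ∧ ∀ j, j ≠ i → x j = y j
  symm := ⟨fun _ _ ⟨i, h, hj⟩ => ⟨i, h.symm, fun j hji => (hj j hji).symm⟩⟩
  loopless := ⟨fun _ ⟨_, h, _⟩ => by omega⟩

/-- The number of perfect matchings of a graph. -/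
noncomputable def numPerfectMatchings {V : Type*} (G : SimpleGraph V) : ℕ :=
  Set.ncard {M : G.Subgraph | M.IsPerfectMatching}

/-! The machine model: a random access machine (RAM) with unboundedly many registers, each holding
a natural number, with indirect addressing, under the logarithmic cost criterion. The bit length of
`k` is `Nat.size k`. -/

namespace RAM

/-- The contents of the registers; all but finitely many registers hold `0`. -/
abbrev Mem : Type := ℕ →₀ ℕ

/-- The arithmetic operations. `sub` is truncated subtraction, `div` is division with rounding down
(with value `0` if the divisor is `0`). -/
inductive Op where
  | add
  | sub
  | mul
  | div

/-- The value of an arithmetic operation. -/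
def Op.eval : Op → ℕ → ℕ → ℕ
  | .add, x, y => x + y
  | .sub, x, y => x - y
  | .mul, x, y => x * y
  | .div, x, y => x / y

/-- The cost of an arithmetic operation on given operands: linear in the bit lengths for addition
and subtraction, the product of the bit lengths for multiplication and division. -/
def Op.cost : Op → ℕ → ℕ → ℕ
  | .add, x, y => 1 + x.size + y.size
  | .sub, x, y => 1 + x.size + y.size
  | .mul, x, y => (1 + x.size) * (1 + y.size)
  | .div, x, y => (1 + x.size) * (1 + y.size)

/-- The elementary instructions; register indices and constants are part of the program. -/
inductive Instr where
  /-- `R[dst] := c` -/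
  | const (dst c : ℕ)
  /-- `R[dst] := R[a] op R[b]` -/
  | arith (op : Op) (dst a b : ℕ)
  /-- `R[dst] := R[R[ptr]]` -/
  | load (dst ptr : ℕ)
  /-- `R[R[ptr]] := R[src]` -/
  | store (ptr src : ℕ)

/-- The effect of an instruction on the registers. -/
noncomputable def Instr.apply : Instr → Mem → Mem
  | .const dst c, m => m.update dst c
  | .arith op dst a b, m => m.update dst (op.eval (m a) (m b))
  | .load dst ptr, m => m.update dst (m (m ptr))
  | .store ptr src, m => m.update (m ptr) (m src)

/-- The cost of an instruction: it pays for the bits of all register indices and register contents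
that it handles. -/
def Instr.cost : Instr → Mem → ℕ
  | .const dst c, _ => 1 + dst.size + c.size
  | .arith op dst a b, m => dst.size + a.size + b.size + op.cost (m a) (m b)
  | .load dst ptr, m => 1 + dst.size + ptr.size + (m ptr).size + (m (m ptr)).size
  | .store ptr src, m => 1 + ptr.size + (m ptr).size + src.size + (m src).size

/-- The space that the registers occupy: the bits of the indices and of the contents of all
registers that are not `0`. -/
def Mem.space (m : Mem) : ℕ := m.sum fun a x => a.size + x.size

/-- Programs: finite texts made from instructions by sequencing, branching on whether a register is
nonzero, and looping while a register is nonzero. -/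
inductive Prog where
  | skip
  | instr (i : Instr)
  | seq (p q : Prog)
  | ite (r : ℕ) (p q : Prog)
  | loop (r : ℕ) (p : Prog)

/-- The cost of testing whether register `r` is nonzero. -/
def testCost (r : ℕ) (m : Mem) : ℕ := 1 + r.size + (m r).size

/-- `Exec P m t s m'`: started with register contents `m`, the program `P` halts with register
contents `m'`; the total cost of all executed instructions and tests is `t`, and the maximum of the
occupied space over all moments of the execution is `s`. -/
inductive Exec : Prog → Mem → ℕ → ℕ → Mem → Prop
  | skip (m : Mem) : Exec .skip m 1 m.space m
  | instr (i : Instr) (m : Mem) :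
      Exec (.instr i) m (i.cost m) (max m.space (i.apply m).space) (i.apply m)
  | seq {p q : Prog} {m₁ m₂ m₃ : Mem} {t₁ t₂ s₁ s₂ : ℕ} (hp : Exec p m₁ t₁ s₁ m₂)
      (hq : Exec q m₂ t₂ s₂ m₃) : Exec (.seq p q) m₁ (t₁ + t₂) (max s₁ s₂) m₃
  | ite_pos {r : ℕ} {p q : Prog} {m m' : Mem} {t s : ℕ} (hr : m r ≠ 0)
      (hp : Exec p m t s m') : Exec (.ite r p q) m (testCost r m + t) s m'
  | ite_zero {r : ℕ} {p q : Prog} {m m' : Mem} {t s : ℕ} (hr : m r = 0)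
      (hq : Exec q m t s m') : Exec (.ite r p q) m (testCost r m + t) s m'
  | loop_done {r : ℕ} {p : Prog} {m : Mem} (hr : m r = 0) :
      Exec (.loop r p) m (testCost r m) m.space m
  | loop_step {r : ℕ} {p : Prog} {m₁ m₂ m₃ : Mem} {t₁ t₂ s₁ s₂ : ℕ} (hr : m₁ r ≠ 0)
      (hp : Exec p m₁ t₁ s₁ m₂) (hl : Exec (.loop r p) m₂ t₂ s₂ m₃) :
      Exec (.loop r p) m₁ (testCost r m₁ + t₁ + t₂) (max s₁ s₂) m₃

/-- On the input `(x, y)`, given in registers `0` and `1` with all other registers `0`, the program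
`P` halts in time `t`, using space `s`, with output `z` in register `0`. -/
def Prog.Computes (P : Prog) (x y z t s : ℕ) : Prop :=
  ∃ m : Mem, Exec P (Finsupp.single 0 x + Finsupp.single 1 y) t s m ∧ m 0 = z

end RAM

/-!
A perfect matching of a graph with `N` vertices is an edge cover with `N / 2` edges, and no edge
cover has fewer edges. Hence, for even `N`, the number of perfect matchings is the coefficient of
`B ^ (N / 2)` in the edge cover polynomial `∑ B ^ |F|`, where `F` runs through the edge covers, and
no smaller power of `B` occurs. By inclusion and exclusion this polynomial is
`∑ (-1) ^ |V \ Y| * (1 + B) ^ e(Y)`, where `Y` runs through the sets of vertices and `e(Y)` is the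
number of edges inside `Y` (`sum_neg_one_pow_mul_pow_edges`). For a number `B` that exceeds the
number of all sets of edges, the coefficient is a digit of the value in base `B`
(`sum_edgeCovers_digit`). Computing modulo a number `M` that exceeds the value, with the weight
`M - 1` in place of `-1`, avoids negative numbers (`partitionSum_mod`). The numbers that occur have
polynomially many bits.

The sum over `Y` is evaluated by deciding one vertex after the other whether it belongs to `Y`. Each
decision doubles the work (`partitionSum_insert`), but once all vertices on a separator have been
decided, the parts that it separates contribute independently (`partitionSum_union`). The grid is
bisected by hyperplanes, which run through the `d` directions in turn. A bisection in the `i`-th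
direction of round `J` removes from a box at most
`(n / 2 ^ (J + 1)) ^ i * (n / 2 ^ J) ^ (d - 1 - i)` vertices (`card_cut_le`). Along a path of the
recursion these numbers add up to at most the exponent in the theorem, by two geometric series
(`sum_cutSize_le`). Each level of the recursion doubles the number of boxes as well, but there are
so few levels that this costs a polynomial factor only (`evaluated_box`).

The recursion is carried out by one loop (`stepCom`) whose state is the number of the current box
in heap order, the number of the current vertex, and a flag for the direction. Intermediate values
are kept in arrays indexed by vertices and boxes, where an entry is overwritten only when it is no
longer needed, so that polynomial space suffices.

The program is written in a small language with variables, arrays and expressions, which is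
compiled to RAM programs. One RAM instruction multiplies the bit lengths by at most a constant, so
the cost of a loop-free program is bounded in terms of the bit lengths at its start
(`Prog.exec_run`). Only the stores at the starts of the loop-free parts have to be bounded, and the
cost of loops can be counted in loop-free parts (`Runs`).
-/

namespace RAM

/-! ### Loop-free RAM programs -/

/-- Programs without loops. -/
def Prog.LoopFree : Prog → Prop
  | .skip => True
  | .instr _ => True
  | .seq p q => p.LoopFree ∧ q.LoopFree
  | .ite _ p q => p.LoopFree ∧ q.LoopFree
  | .loop _ _ => False

/-- The effect of a loop-free program on the registers (a loop is ignored). -/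
noncomputable def Prog.run : Prog → Mem → Mem
  | .skip, m => m
  | .instr i, m => i.apply m
  | .seq p q, m => q.run (p.run m)
  | .ite r p q, m => if m r ≠ 0 then p.run m else q.run m
  | .loop _ _, m => m

/-- At most `A` registers are nonzero, and their indices and contents have at most `σ` bits. -/
def Mem.Fits (m : Mem) (A σ : ℕ) : Prop :=
  m.support.card ≤ A ∧ ∀ a, m a ≠ 0 → a.size ≤ σ ∧ (m a).size ≤ σ

theorem Mem.Fits.mono {m : Mem} {A A' σ σ' : ℕ} (h : m.Fits A σ) (hA : A ≤ A') (hσ : σ ≤ σ') :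
    m.Fits A' σ' :=
  ⟨h.1.trans hA, fun a ha => ⟨(h.2 a ha).1.trans hσ, (h.2 a ha).2.trans hσ⟩⟩

theorem Mem.Fits.size_le {m : Mem} {A σ : ℕ} (h : m.Fits A σ) (a : ℕ) : (m a).size ≤ σ := by
  by_cases ha : m a = 0
  · simp [ha]
  · exact (h.2 a ha).2

theorem Mem.Fits.space_le {m : Mem} {A σ : ℕ} (h : m.Fits A σ) : m.space ≤ A * (2 * σ) := by
  unfold Mem.space Finsupp.sum
  calc ∑ a ∈ m.support, (a.size + (m a).size) ≤ ∑ _a ∈ m.support, 2 * σ := by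
        refine Finset.sum_le_sum fun a ha => ?_
        have := h.2 a (Finsupp.mem_support_iff.mp ha)
        omega
    _ = m.support.card * (2 * σ) := by simp
    _ ≤ A * (2 * σ) := Nat.mul_le_mul_right _ h.1

theorem Mem.Fits.update {m : Mem} {A σ σ' : ℕ} (h : m.Fits A σ) {a x : ℕ} (hσ : σ ≤ σ')
    (ha : x ≠ 0 → a.size ≤ σ') (hx : x.size ≤ σ') : Mem.Fits (Finsupp.update m a x) (A + 1) σ' := by
  classical
  constructor
  · have : (Finsupp.update m a x).support ⊆ insert a m.support := by
      intro y hy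
      rw [Finsupp.mem_support_iff, Finsupp.update_apply] at hy
      by_cases hya : y = a
      · simp [hya]
      · simp [hya] at hy ⊢
        exact hy
    exact (Finset.card_le_card this).trans
      ((Finset.card_insert_le _ _).trans (by have := h.1; omega))
  · intro y hy
    rw [Finsupp.update_apply] at hy ⊢
    by_cases hya : y = a
    · simp only [hya, if_true] at hy ⊢
      exact ⟨ha hy, hx⟩
    · simp only [hya, if_false] at hy ⊢
      exact ⟨(h.2 y hy).1.trans hσ, (h.2 y hy).2.trans hσ⟩

theorem size_mul_le (x y : ℕ) : (x * y).size ≤ x.size + y.size := by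
  rw [Nat.size_le, pow_add]
  exact Nat.mul_lt_mul'' (Nat.lt_size_self x) (Nat.lt_size_self y)

theorem size_add_le (x y : ℕ) : (x + y).size ≤ x.size + y.size + 1 := by
  rw [Nat.size_le, pow_succ]
  have h1 : x < 2 ^ (x.size + y.size) :=
    (Nat.lt_size_self x).trans_le (Nat.pow_le_pow_right (by norm_num) (by omega))
  have h2 : y < 2 ^ (x.size + y.size) :=
    (Nat.lt_size_self y).trans_le (Nat.pow_le_pow_right (by norm_num) (by omega))
  omega

theorem Op.size_eval_le (o : Op) (x y : ℕ) : (o.eval x y).size ≤ x.size + y.size + 1 := by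
  cases o with
  | add => exact size_add_le x y
  | sub => exact (Nat.size_le_size (Nat.sub_le x y)).trans (by omega)
  | mul => exact (size_mul_le x y).trans (by omega)
  | div => exact (Nat.size_le_size (Nat.div_le_self x y)).trans (by omega)

theorem Op.cost_le (o : Op) (x y : ℕ) : o.cost x y ≤ (1 + x.size) * (1 + y.size) := by
  cases o <;> simp only [Op.cost] <;> nlinarith [Nat.zero_le (x.size * y.size)]

/-- A constant for an instruction that bounds its cost and its effect on bit lengths. -/
def Instr.cst : Instr → ℕ
  | .const dst c => 4 + dst.size + c.size
  | .arith _ dst a b => 4 + dst.size + a.size + b.size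
  | .load dst ptr => 4 + dst.size + ptr.size
  | .store ptr src => 4 + ptr.size + src.size

theorem Instr.cost_le (i : Instr) {m : Mem} {A σ : ℕ} (h : m.Fits A σ) (hσ : 1 ≤ σ) :
    i.cost m ≤ i.cst * σ ^ 2 := by
  have h2 : σ ≤ σ ^ 2 := by nlinarith
  cases i with
  | const dst c => simp only [Instr.cost, Instr.cst]; nlinarith
  | arith o dst a b =>
    simp only [Instr.cost, Instr.cst]
    have ha := h.size_le a
    have hb := h.size_le b
    have hc := o.cost_le (m a) (m b)
    have : (1 + (m a).size) * (1 + (m b).size) ≤ (σ + σ) * (σ + σ) :=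
      Nat.mul_le_mul (by omega) (by omega)
    nlinarith [Nat.zero_le dst.size, Nat.zero_le a.size, Nat.zero_le b.size]
  | load dst ptr =>
    simp only [Instr.cost, Instr.cst]
    have ha := h.size_le ptr
    have hb := h.size_le (m ptr)
    nlinarith [Nat.zero_le dst.size, Nat.zero_le ptr.size]
  | store ptr src =>
    simp only [Instr.cost, Instr.cst]
    have ha := h.size_le ptr
    have hb := h.size_le src
    nlinarith [Nat.zero_le src.size, Nat.zero_le ptr.size]

theorem Instr.fits_apply (i : Instr) {m : Mem} {A σ : ℕ} (h : m.Fits A σ) (hσ : 1 ≤ σ) :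
    (i.apply m).Fits (A + 1) (i.cst * σ) := by
  cases i with
  | const dst c =>
    simp only [Instr.apply, Instr.cst]
    exact h.update (by nlinarith) (fun _ => by nlinarith) (by nlinarith)
  | arith o dst a b =>
    simp only [Instr.apply, Instr.cst]
    have ha := h.size_le a
    have hb := h.size_le b
    have hc := o.size_eval_le (m a) (m b)
    exact h.update (by nlinarith) (fun _ => by nlinarith) (by nlinarith)
  | load dst ptr =>
    simp only [Instr.apply, Instr.cst]
    have hb := h.size_le (m ptr)
    exact h.update (by nlinarith) (fun _ => by nlinarith) (by nlinarith)
  | store ptr src =>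
    simp only [Instr.apply, Instr.cst]
    have ha := h.size_le ptr
    have hb := h.size_le src
    exact h.update (by nlinarith) (fun _ => by nlinarith) (by nlinarith)

/-- A constant for a program that bounds the time, the space and the growth of bit lengths of its
loop-free parts, up to the factors determined by the bit lengths at the start. -/
def Prog.cst : Prog → ℕ
  | .skip => 2
  | .instr i => 2 * i.cst
  | .seq p q => (p.cst + 1) * (p.cst + 1) * (q.cst + 1)
  | .ite r p q => p.cst + q.cst + r.size + 2
  | .loop r p => p.cst + r.size + 2

theorem Instr.four_le_cst (i : Instr) : 4 ≤ i.cst := by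
  cases i <;> simp only [Instr.cst] <;> omega

theorem Prog.two_le_cst (p : Prog) : 2 ≤ p.cst := by
  induction p with
  | skip => simp [Prog.cst]
  | instr i => have := i.four_le_cst; simp only [Prog.cst]; omega
  | seq p q hp hq =>
    simp only [Prog.cst]
    nlinarith [Nat.zero_le ((p.cst + 1) * (p.cst + 1) * q.cst)]
  | ite r p q hp hq => simp only [Prog.cst]; omega
  | loop r p hp => simp only [Prog.cst]; omega

theorem testCost_le {r : ℕ} {m : Mem} {A σ : ℕ} (h : m.Fits A σ) (hσ : 1 ≤ σ) :
    testCost r m ≤ (r.size + 2) * σ ^ 2 := by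
  have h2 : σ ≤ σ ^ 2 := by nlinarith
  have := h.size_le r
  unfold testCost
  nlinarith [Nat.zero_le r.size]

theorem Prog.cst_left_le_seq (p q : Prog) : p.cst ≤ (Prog.seq p q).cst := by
  simp only [Prog.cst]
  have h : 1 * 1 ≤ (p.cst + 1) * (q.cst + 1) := Nat.mul_le_mul (by omega) (by omega)
  calc p.cst ≤ (p.cst + 1) * 1 := by omega
    _ ≤ (p.cst + 1) * ((p.cst + 1) * (q.cst + 1)) := Nat.mul_le_mul_left _ (by omega)
    _ = _ := by ring

theorem Prog.cst_right_le_seq (p q : Prog) : q.cst ≤ (Prog.seq p q).cst := by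
  simp only [Prog.cst]
  have h : 1 * 1 ≤ (p.cst + 1) * (p.cst + 1) := Nat.mul_le_mul (by omega) (by omega)
  calc q.cst ≤ 1 * (q.cst + 1) := by omega
    _ ≤ _ := Nat.mul_le_mul_right _ (by omega)

/-- A loop-free program, started with few and short registers, is cheap; no intermediate value has
to be inspected, since one instruction multiplies the
bit lengths by at most a constant. -/
theorem Prog.exec_run (p : Prog) (hp : p.LoopFree) {m : Mem} {A σ : ℕ} (h : m.Fits A σ)
    (hσ : 1 ≤ σ) :
    ∃ t s, Exec p m t s (p.run m) ∧ t ≤ p.cst * σ ^ 2 ∧ s ≤ p.cst * ((A + 1) * σ) ∧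
      (p.run m).Fits (A + p.cst) (p.cst * σ) := by
  induction p generalizing m A σ with
  | skip =>
    refine ⟨_, _, Exec.skip m, ?_, ?_, h.mono (by omega) ?_⟩
    · simp only [Prog.cst]; nlinarith
    · have := h.space_le
      simp only [Prog.cst]; nlinarith
    · simp only [Prog.cst]; omega
  | instr i =>
    have h4 := i.four_le_cst
    have hf := i.fits_apply h hσ
    refine ⟨_, _, Exec.instr i m, ?_, ?_, hf.mono ?_ ?_⟩
    · have := i.cost_le h hσ
      simp only [Prog.cst]; nlinarith
    · have h1 := h.space_le
      have h2 := hf.space_le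
      simp only [Prog.cst]
      refine max_le ?_ (h2.trans (le_of_eq (by ring)))
      refine h1.trans ?_
      calc A * (2 * σ) ≤ (A + 1) * (2 * σ * i.cst) := Nat.mul_le_mul (by omega) (by nlinarith)
        _ = _ := by ring
    · simp only [Prog.cst]; omega
    · simp only [Prog.cst]; nlinarith
  | seq p q ihp ihq =>
    obtain ⟨t₁, s₁, e₁, ht₁, hs₁, hf₁⟩ := ihp hp.1 h hσ
    have hc := p.two_le_cst
    have hc' := q.two_le_cst
    obtain ⟨t₂, s₂, e₂, ht₂, hs₂, hf₂⟩ := ihq hp.2 hf₁ (by nlinarith)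
    refine ⟨_, _, Exec.seq e₁ e₂, ?_, max_le ?_ ?_, hf₂.mono ?_ ?_⟩
    · calc t₁ + t₂ ≤ p.cst * σ ^ 2 + q.cst * (p.cst * σ) ^ 2 := by omega
        _ = (p.cst + q.cst * p.cst ^ 2) * σ ^ 2 := by ring
        _ ≤ _ := by
          refine Nat.mul_le_mul_right _ ?_
          simp only [Prog.cst]; ring_nf; nlinarith
    · exact hs₁.trans (Nat.mul_le_mul_right _ (Prog.cst_left_le_seq p q))
    · refine hs₂.trans ?_
      calc q.cst * ((A + p.cst + 1) * (p.cst * σ))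
          ≤ q.cst * (((p.cst + 1) * (A + 1)) * (p.cst * σ)) := by
            refine Nat.mul_le_mul_left _ (Nat.mul_le_mul_right _ ?_)
            nlinarith
        _ = q.cst * (p.cst + 1) * p.cst * ((A + 1) * σ) := by ring
        _ ≤ _ := by
          refine Nat.mul_le_mul_right _ ?_
          simp only [Prog.cst]
          calc q.cst * (p.cst + 1) * p.cst
              ≤ (q.cst + 1) * (p.cst + 1) * (p.cst + 1) := by gcongr <;> omega
            _ = _ := by ring
    · have h1 : p.cst + q.cst ≤ (p.cst + 1) * (q.cst + 1) := by nlinarith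
      have h2 : (p.cst + 1) * (q.cst + 1) ≤ (p.cst + 1) * (p.cst + 1) * (q.cst + 1) := by
        refine Nat.mul_le_mul_right _ ?_; nlinarith
      simp only [Prog.cst]; omega
    · rw [← mul_assoc]
      refine Nat.mul_le_mul_right _ ?_
      simp only [Prog.cst]
      calc q.cst * p.cst ≤ (q.cst + 1) * ((p.cst + 1) * (p.cst + 1)) := by
            refine Nat.mul_le_mul (by omega) ?_; nlinarith
        _ = _ := by ring
  | ite r p q ihp ihq =>
    have ht := testCost_le (r := r) h hσ
    have hc := p.two_le_cst
    have hc' := q.two_le_cst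
    by_cases hr : m r = 0
    · obtain ⟨t, s, e, ht', hs, hf⟩ := ihq hp.2 h hσ
      have hrun : (Prog.ite r p q).run m = q.run m := by simp [Prog.run, hr]
      rw [hrun]
      refine ⟨_, _, Exec.ite_zero hr e, ?_, hs.trans ?_, hf.mono ?_ ?_⟩
      · simp only [Prog.cst]; nlinarith
      · refine Nat.mul_le_mul_right _ ?_; simp only [Prog.cst]; omega
      · simp only [Prog.cst]; omega
      · refine Nat.mul_le_mul_right _ ?_; simp only [Prog.cst]; omega
    · obtain ⟨t, s, e, ht', hs, hf⟩ := ihp hp.1 h hσ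
      have hrun : (Prog.ite r p q).run m = p.run m := by simp [Prog.run, hr]
      rw [hrun]
      refine ⟨_, _, Exec.ite_pos hr e, ?_, hs.trans ?_, hf.mono ?_ ?_⟩
      · simp only [Prog.cst]; nlinarith
      · refine Nat.mul_le_mul_right _ ?_; simp only [Prog.cst]; omega
      · simp only [Prog.cst]; omega
      · refine Nat.mul_le_mul_right _ ?_; simp only [Prog.cst]; omega
  | loop r p _ => exact hp.elim

end RAM

namespace RAM

/-! ### A small language with variables, arrays and expressions, compiled to RAM programs -/

/-- Expressions over variables and four arrays. -/
inductive Ex where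
  | lit (c : ℕ)
  | var (x : ℕ)
  | bin (o : Op) (a b : Ex)
  | get (k : Fin 4) (i : Ex)

/-- The values of all variables and of all array entries. -/
@[ext]
structure Store where
  v : ℕ → ℕ
  a : Fin 4 → ℕ → ℕ

/-- Assignment to a variable. -/
def Store.set (s : Store) (x e : ℕ) : Store := ⟨Function.update s.v x e, s.a⟩

/-- Assignment to an array entry. -/
def Store.put (s : Store) (k : Fin 4) (i e : ℕ) : Store :=
  ⟨s.v, Function.update s.a k (Function.update (s.a k) i e)⟩

@[simp] theorem Store.set_v (s : Store) (x e y : ℕ) :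
    (s.set x e).v y = if y = x then e else s.v y := by
  simp [Store.set, Function.update_apply]

@[simp] theorem Store.set_a (s : Store) (x e : ℕ) : (s.set x e).a = s.a := rfl

@[simp] theorem Store.put_v (s : Store) (k : Fin 4) (i e : ℕ) : (s.put k i e).v = s.v := rfl

theorem Store.put_a (s : Store) (k : Fin 4) (i e : ℕ) (k' : Fin 4) (j : ℕ) :
    (s.put k i e).a k' j = if k' = k ∧ j = i then e else s.a k' j := by
  by_cases hk : k' = k
  · subst hk
    by_cases hj : j = i <;> simp [Store.put, hj]
  · simp [Store.put, hk]

/-- The value of an expression, with truncated subtraction and rounded division. -/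
def Ex.val : Ex → Store → ℕ
  | .lit c, _ => c
  | .var x, s => s.v x
  | .bin o a b, s => o.eval (a.val s) (b.val s)
  | .get k i, s => s.a k (i.val s)

/-- Code that evaluates an expression into register `8 * t + 1`. The registers `8 * x` hold the
variables, the registers `8 * i + 2 + k` hold the entries of array `k`, and the registers
`8 * t + 1` are scratch registers; register `6` always holds `0`. Scratch registers above the result
are cleared after use. -/
def Ex.code : Ex → ℕ → Prog
  | .lit c, t => .instr (.const (8 * t + 1) c)
  | .var x, t => .instr (.arith .add (8 * t + 1) (8 * x) 6)
  | .bin o a b, t => .seq (a.code t) (.seq (b.code (t + 1))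
      (.seq (.instr (.arith o (8 * t + 1) (8 * t + 1) (8 * (t + 1) + 1)))
        (.instr (.const (8 * (t + 1) + 1) 0))))
  | .get k i, t => .seq (i.code t) (.seq (.instr (.const (8 * (t + 1) + 1) 8))
      (.seq (.instr (.arith .mul (8 * t + 1) (8 * t + 1) (8 * (t + 1) + 1)))
        (.seq (.instr (.const (8 * (t + 1) + 1) (2 + k)))
          (.seq (.instr (.arith .add (8 * t + 1) (8 * t + 1) (8 * (t + 1) + 1)))
            (.seq (.instr (.load (8 * t + 1) (8 * t + 1)))
              (.instr (.const (8 * (t + 1) + 1) 0)))))))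

/-- The registers represent the store as far as variables and arrays are concerned, and the scratch
registers from index `t` on are clear. -/
structure Agree (s : Store) (t : ℕ) (m : Mem) : Prop where
  var : ∀ x, m (8 * x) = s.v x
  arr : ∀ (k : Fin 4) i, m (8 * i + 2 + k) = s.a k i
  zero : m 6 = 0
  scratch : ∀ u, t ≤ u → m (8 * u + 1) = 0

theorem Agree.update {s : Store} {t u : ℕ} {m : Mem} (h : Agree s t m) (hu : t ≤ u) (x : ℕ) :
    Agree s (u + 1) (Finsupp.update m (8 * u + 1) x) where
  var y := by
    rw [Finsupp.update_apply, if_neg (by omega)]; exact h.var y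
  arr k i := by
    have := k.2
    rw [Finsupp.update_apply, if_neg (by omega)]; exact h.arr k i
  zero := by
    rw [Finsupp.update_apply, if_neg (by omega)]; exact h.zero
  scratch w hw := by
    rw [Finsupp.update_apply, if_neg (by omega)]; exact h.scratch w (by omega)

theorem Ex.loopFree_code (e : Ex) (t : ℕ) : (e.code t).LoopFree := by
  induction e generalizing t with
  | lit c => trivial
  | var x => trivial
  | bin o a b iha ihb => exact ⟨iha t, ihb (t + 1), trivial, trivial⟩
  | get k i ih => exact ⟨ih t, trivial, trivial, trivial, trivial, trivial, trivial⟩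

theorem Ex.run_code (e : Ex) {s : Store} {t : ℕ} {m : Mem} (h : Agree s t m) :
    (e.code t).run m = Finsupp.update m (8 * t + 1) (e.val s) := by
  induction e generalizing t m with
  | lit c => rfl
  | var x => simp [Ex.code, Prog.run, Instr.apply, Op.eval, Ex.val, h.var, h.zero]
  | bin o a b iha ihb =>
    have h1 : Agree s (t + 1) (Finsupp.update m (8 * t + 1) (a.val s)) := h.update le_rfl _
    simp only [Ex.code, Prog.run, Instr.apply, iha h, ihb h1, Ex.val]
    ext y
    have hz := h.scratch (t + 1) (by omega)
    simp only [Finsupp.update_apply]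
    by_cases hy : y = 8 * (t + 1) + 1
    · subst hy; rw [if_pos rfl, if_neg (by omega)]; exact hz.symm
    · rw [if_neg hy]
      by_cases hy' : y = 8 * t + 1
      · rw [if_pos hy', if_pos hy']; simp
      · simp [hy, hy']
  | get k i ih =>
    have hz := h.scratch (t + 1) (by omega)
    have hk := k.2
    have harr := h.arr k (i.val s)
    simp only [Ex.code, Prog.run, Instr.apply, ih h, Ex.val, Op.eval]
    ext y
    simp only [Finsupp.update_apply]
    have e1 : (8 * t + 1 = 8 * (t + 1) + 1) ↔ False := iff_false_intro (by omega)
    have e2 : (8 * (t + 1) + 1 = 8 * t + 1) ↔ False := iff_false_intro (by omega)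
    have e3 : i.val s * 8 + (2 + (k : ℕ)) = 8 * i.val s + 2 + k := by ring
    have e4 : (8 * i.val s + 2 + (k : ℕ) = 8 * (t + 1) + 1) ↔ False := by
      exact iff_false_intro (by omega)
    have e5 : (8 * i.val s + 2 + (k : ℕ) = 8 * t + 1) ↔ False := by
      exact iff_false_intro (by omega)
    simp only [e1, e2, e3, e4, e5, if_true, if_false, harr]
    by_cases hy : y = 8 * (t + 1) + 1
    · subst hy; rw [if_pos rfl, if_neg (by omega)]; exact hz.symm
    · by_cases hy' : y = 8 * t + 1 <;> simp [hy, hy']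

/-- Commands; branching and looping test whether a variable is nonzero. -/
inductive Com where
  | skip
  | set (x : ℕ) (e : Ex)
  | put (k : Fin 4) (i e : Ex)
  | seq (p q : Com)
  | ite (x : ℕ) (p q : Com)
  | loop (x : ℕ) (p : Com)

/-- The RAM program of a command. -/
def Com.compile : Com → Prog
  | .skip => .skip
  | .set x e => .seq (e.code 0) (.seq (.instr (.arith .add (8 * x) 1 6)) (.instr (.const 1 0)))
  | .put k i e => .seq (i.code 0) (.seq (e.code 1) (.seq (.instr (.const 17 8))
      (.seq (.instr (.arith .mul 1 1 17)) (.seq (.instr (.const 17 (2 + k)))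
        (.seq (.instr (.arith .add 1 1 17)) (.seq (.instr (.store 1 9))
          (.seq (.instr (.const 17 0)) (.seq (.instr (.const 9 0)) (.instr (.const 1 0))))))))))
  | .seq p q => .seq p.compile q.compile
  | .ite x p q => .ite (8 * x) p.compile q.compile
  | .loop x p => .loop (8 * x) p.compile

/-- Commands without loops. -/
def Com.LoopFree : Com → Prop
  | .skip => True
  | .set _ _ => True
  | .put _ _ _ => True
  | .seq p q => p.LoopFree ∧ q.LoopFree
  | .ite _ p q => p.LoopFree ∧ q.LoopFree
  | .loop _ _ => False

/-- The effect of a loop-free command on the store (a loop is ignored). -/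
def Com.run : Com → Store → Store
  | .skip, s => s
  | .set x e, s => s.set x (e.val s)
  | .put k i e, s => s.put k (i.val s) (e.val s)
  | .seq p q, s => q.run (p.run s)
  | .ite x p q, s => if s.v x ≠ 0 then p.run s else q.run s
  | .loop _ _, s => s

/-- The registers represent the store, and all other registers are clear. -/
structure Rep (s : Store) (m : Mem) : Prop where
  var : ∀ x, m (8 * x) = s.v x
  scratch : ∀ u, m (8 * u + 1) = 0
  arr : ∀ (k : Fin 4) i, m (8 * i + 2 + k) = s.a k i
  six : ∀ u, m (8 * u + 6) = 0
  seven : ∀ u, m (8 * u + 7) = 0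

theorem Rep.agree {s : Store} {m : Mem} (h : Rep s m) : Agree s 0 m :=
  ⟨h.var, h.arr, h.six 0, fun u _ => h.scratch u⟩

theorem Com.loopFree_compile (p : Com) (hp : p.LoopFree) : p.compile.LoopFree := by
  induction p with
  | skip => trivial
  | set x e => exact ⟨e.loopFree_code 0, trivial, trivial⟩
  | put k i e => exact ⟨i.loopFree_code 0, e.loopFree_code 1, trivial, trivial, trivial, trivial,
      trivial, trivial, trivial, trivial⟩
  | seq p q ihp ihq => exact ⟨ihp hp.1, ihq hp.2⟩
  | ite x p q ihp ihq => exact ⟨ihp hp.1, ihq hp.2⟩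
  | loop x p _ => exact hp.elim

theorem Rep.run_compile (p : Com) (hp : p.LoopFree) {s : Store} {m : Mem} (h : Rep s m) :
    Rep (p.run s) (p.compile.run m) := by
  induction p generalizing s m with
  | skip => exact h
  | set x e =>
    have hm : (Com.set x e).compile.run m = Finsupp.update m (8 * x) (e.val s) := by
      have h6 := h.six 0
      have h1 := h.scratch 0
      simp only [Nat.mul_zero, Nat.zero_add] at h6 h1
      simp only [Com.compile, Prog.run, Instr.apply, e.run_code h.agree, Op.eval]
      ext y
      simp only [Finsupp.update_apply]
      by_cases hy : y = 1
      · subst hy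
        rw [if_pos rfl, if_neg (by omega), h1]
      · by_cases hy' : y = 8 * x <;> simp [hy, hy', h6]
    rw [hm]
    refine ⟨fun y => ?_, fun u => ?_, fun k i => ?_, fun u => ?_, fun u => ?_⟩
    · rw [Finsupp.update_apply]
      by_cases hy : y = x
      · simp [Com.run, hy]
      · rw [if_neg (by omega)]; simp [Com.run, hy, h.var]
    · rw [Finsupp.update_apply, if_neg (by omega)]; exact h.scratch u
    · have := k.2
      rw [Finsupp.update_apply, if_neg (by omega)]; exact h.arr k i
    · rw [Finsupp.update_apply, if_neg (by omega)]; exact h.six u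
    · rw [Finsupp.update_apply, if_neg (by omega)]; exact h.seven u
  | put k i e =>
    have hk := k.2
    have hm : (Com.put k i e).compile.run m =
        Finsupp.update m (8 * i.val s + 2 + k) (e.val s) := by
      have h1 := h.scratch 0
      have h9 := h.scratch 1
      have h17 := h.scratch 2
      simp only [Nat.mul_zero, Nat.zero_add, Nat.mul_one] at h1 h9 h17
      have ha : Agree s 1 (Finsupp.update m (8 * 0 + 1) (i.val s)) := h.agree.update le_rfl _
      simp only [Com.compile, Prog.run, Instr.apply, i.run_code h.agree, e.run_code ha, Op.eval]
      ext y
      have e3 : i.val s * 8 + (2 + (k : ℕ)) = 8 * i.val s + 2 + k := by ring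
      simp only [Finsupp.update_apply]
      norm_num [e3]
      by_cases hy1 : y = 1
      · subst hy1
        rw [if_pos rfl, if_neg (by omega), h1]
      · by_cases hy9 : y = 9
        · subst hy9
          rw [if_neg (by omega), if_pos rfl, if_neg (by omega), h9]
        · by_cases hy17 : y = 17
          · subst hy17
            simp only [if_neg hy1, if_neg hy9, if_pos]
            rw [if_neg (by omega)]
            simpa using h17.symm
          · simp [hy1, hy9, hy17]
    rw [hm]
    refine ⟨fun y => ?_, fun u => ?_, fun k' j => ?_, fun u => ?_, fun u => ?_⟩
    · rw [Finsupp.update_apply, if_neg (by omega)]; exact h.var y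
    · rw [Finsupp.update_apply, if_neg (by omega)]; exact h.scratch u
    · have hk' := k'.2
      rw [Finsupp.update_apply]
      simp only [Com.run, Store.put_a]
      by_cases hy : k' = k ∧ j = i.val s
      · rw [if_pos hy, if_pos (by rw [hy.1, hy.2])]
      · rw [if_neg hy, if_neg, h.arr k' j]
        intro hh
        exact hy ⟨Fin.ext (by omega), by omega⟩
    · rw [Finsupp.update_apply, if_neg (by omega)]; exact h.six u
    · rw [Finsupp.update_apply, if_neg (by omega)]; exact h.seven u
  | seq p q ihp ihq => exact ihq hp.2 (ihp hp.1 h)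
  | ite x p q ihp ihq =>
    simp only [Com.compile, Prog.run, Com.run, h.var]
    split
    · exact ihp hp.1 h
    · exact ihq hp.2 h
  | loop x p _ => exact hp.elim

/-- Only variables and array entries with index below `X` are nonzero, and no value exceeds `V`. -/
structure Store.Within (s : Store) (X V : ℕ) : Prop where
  var : ∀ x, s.v x ≠ 0 → x < X
  var_le : ∀ x, s.v x ≤ V
  arr : ∀ k i, s.a k i ≠ 0 → i < X
  arr_le : ∀ k i, s.a k i ≤ V

theorem Store.Within.set {s : Store} {X V x e : ℕ} (h : s.Within X V) (hx : x < X) (he : e ≤ V) :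
    (s.set x e).Within X V where
  var y := by
    rw [Store.set_v]; split
    · intro _; omega
    · exact h.var y
  var_le y := by
    rw [Store.set_v]; split
    · exact he
    · exact h.var_le y
  arr := h.arr
  arr_le := h.arr_le

theorem Store.Within.put {s : Store} {X V i e : ℕ} {k : Fin 4} (h : s.Within X V) (hi : i < X)
    (he : e ≤ V) : (s.put k i e).Within X V where
  var := h.var
  var_le := h.var_le
  arr k' j := by
    rw [Store.put_a]; split
    · intro _; omega
    · exact h.arr k' j
  arr_le k' j := by
    rw [Store.put_a]; split
    · exact he
    · exact h.arr_le k' j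

/-- A bound for the bit lengths of the indices and contents of the nonzero registers that represent
a store within `X` and `V`. -/
def bits (X V : ℕ) : ℕ := (8 * X).size + V.size + 1

theorem Rep.fits {s : Store} {m : Mem} {X V : ℕ} (h : Rep s m) (hs : s.Within X V) :
    m.Fits (8 * X) (bits X V) := by
  have key : ∀ a, m a ≠ 0 → a < 8 * X ∧ m a ≤ V := by
    intro a ha
    have hdiv := Nat.div_add_mod a 8
    have hlt := Nat.mod_lt a (show 0 < 8 by norm_num)
    have hcases : a % 8 = 0 ∨ a % 8 = 1 ∨ (2 ≤ a % 8 ∧ a % 8 < 6) ∨ a % 8 = 6 ∨ a % 8 = 7 := by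
      omega
    rcases hcases with h0 | h0 | ⟨h0, h0'⟩ | h0 | h0
    · have e : a = 8 * (a / 8) := by omega
      rw [e, h.var] at ha ⊢
      have := hs.var _ ha
      exact ⟨by omega, hs.var_le _⟩
    · have e : a = 8 * (a / 8) + 1 := by omega
      rw [e, h.scratch] at ha
      exact absurd rfl ha
    · have e : a = 8 * (a / 8) + 2 + ((⟨a % 8 - 2, by omega⟩ : Fin 4) : ℕ) := by
        simp only; omega
      rw [e, h.arr] at ha
      have h1 := hs.arr _ _ ha
      refine ⟨by omega, ?_⟩
      rw [e, h.arr]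
      exact hs.arr_le _ _
    · have e : a = 8 * (a / 8) + 6 := by omega
      rw [e, h.six] at ha
      exact absurd rfl ha
    · have e : a = 8 * (a / 8) + 7 := by omega
      rw [e, h.seven] at ha
      exact absurd rfl ha
  constructor
  · have : m.support ⊆ Finset.range (8 * X) := fun a ha =>
      Finset.mem_range.mpr (key a (Finsupp.mem_support_iff.mp ha)).1
    simpa using Finset.card_le_card this
  · intro a ha
    obtain ⟨h1, h2⟩ := key a ha
    have h3 := Nat.size_le_size h1.le
    have h4 := Nat.size_le_size h2
    unfold bits
    omega

/-- The command leads from store `s` to store `s'` with cost at most `k` units; the unit and the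
bound for the space depend only on the command and on the bounds `X` and `V` for the stores at the
starts of its loop-free parts. -/
def Runs (X V : ℕ) (p : Com) (s s' : Store) (k : ℕ) : Prop :=
  ∀ m, Rep s m → ∃ t sp m', Exec p.compile m t sp m' ∧ Rep s' m' ∧
    t ≤ k * (p.compile.cst * bits X V ^ 2) ∧ sp ≤ p.compile.cst * ((8 * X + 1) * bits X V)

theorem one_le_bits (X V : ℕ) : 1 ≤ bits X V := by unfold bits; omega

variable {X V : ℕ}

theorem Runs.mono {p : Com} {s s' : Store} {k k' : ℕ} (h : Runs X V p s s' k) (hk : k ≤ k') :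
    Runs X V p s s' k' := by
  intro m hm
  obtain ⟨t, sp, m', h1, h2, h3, h4⟩ := h m hm
  exact ⟨t, sp, m', h1, h2, h3.trans (Nat.mul_le_mul_right _ hk), h4⟩

theorem Runs.base {p : Com} (hp : p.LoopFree) {s : Store} (hs : s.Within X V) :
    Runs X V p s (p.run s) 1 := by
  intro m hm
  obtain ⟨t, sp, h1, h2, h3, -⟩ :=
    p.compile.exec_run (p.loopFree_compile hp) (hm.fits hs) (one_le_bits X V)
  exact ⟨t, sp, _, h1, hm.run_compile p hp, by omega, h3⟩

theorem Runs.seq {p q : Com} {s s' s'' : Store} {k k' : ℕ} (hp : Runs X V p s s' k)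
    (hq : Runs X V q s' s'' k') : Runs X V (.seq p q) s s'' (k + k') := by
  intro m hm
  obtain ⟨t, sp, m', h1, h2, h3, h4⟩ := hp m hm
  obtain ⟨t', sp', m'', h1', h2', h3', h4'⟩ := hq m' h2
  have hl : p.compile.cst ≤ (Com.seq p q).compile.cst := Prog.cst_left_le_seq _ _
  have hr : q.compile.cst ≤ (Com.seq p q).compile.cst := Prog.cst_right_le_seq _ _
  refine ⟨_, _, m'', Exec.seq h1 h1', h2', ?_, max_le ?_ ?_⟩
  · rw [add_mul]
    exact Nat.add_le_add
      (h3.trans (Nat.mul_le_mul_left _ (Nat.mul_le_mul_right _ hl)))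
      (h3'.trans (Nat.mul_le_mul_left _ (Nat.mul_le_mul_right _ hr)))
  · exact h4.trans (Nat.mul_le_mul_right _ hl)
  · exact h4'.trans (Nat.mul_le_mul_right _ hr)

theorem testCost_le_cst_ite {x : ℕ} {p q : Com} {s : Store} (hs : s.Within X V) {m : Mem}
    (hm : Rep s m) : testCost (8 * x) m ≤ (Com.ite x p q).compile.cst * bits X V ^ 2 := by
  refine (testCost_le (hm.fits hs) (one_le_bits X V)).trans (Nat.mul_le_mul_right _ ?_)
  simp only [Com.compile, Prog.cst]
  omega

theorem Runs.ite_pos {p q : Com} {x : ℕ} {s s' : Store} {k : ℕ} (hs : s.Within X V)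
    (hx : s.v x ≠ 0) (hp : Runs X V p s s' k) : Runs X V (.ite x p q) s s' (k + 1) := by
  intro m hm
  obtain ⟨t, sp, m', h1, h2, h3, h4⟩ := hp m hm
  have hl : p.compile.cst ≤ (Com.ite x p q).compile.cst := by
    simp only [Com.compile, Prog.cst]; omega
  have ht := testCost_le_cst_ite (x := x) (p := p) (q := q) hs hm
  have h3' := h3.trans (Nat.mul_le_mul_left k (Nat.mul_le_mul_right (bits X V ^ 2) hl))
  refine ⟨_, _, m', Exec.ite_pos (by rwa [hm.var]) h1, h2, ?_,
    h4.trans (Nat.mul_le_mul_right _ hl)⟩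
  rw [add_mul]
  omega

theorem Runs.ite_zero {p q : Com} {x : ℕ} {s s' : Store} {k : ℕ} (hs : s.Within X V)
    (hx : s.v x = 0) (hq : Runs X V q s s' k) : Runs X V (.ite x p q) s s' (k + 1) := by
  intro m hm
  obtain ⟨t, sp, m', h1, h2, h3, h4⟩ := hq m hm
  have hl : q.compile.cst ≤ (Com.ite x p q).compile.cst := by
    simp only [Com.compile, Prog.cst]; omega
  have ht := testCost_le_cst_ite (x := x) (p := p) (q := q) hs hm
  have h3' := h3.trans (Nat.mul_le_mul_left k (Nat.mul_le_mul_right (bits X V ^ 2) hl))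
  refine ⟨_, _, m', Exec.ite_zero (by rwa [hm.var]) h1, h2, ?_,
    h4.trans (Nat.mul_le_mul_right _ hl)⟩
  rw [add_mul]
  omega

theorem testCost_le_cst_loop {x : ℕ} {p : Com} {s : Store} (hs : s.Within X V) {m : Mem}
    (hm : Rep s m) : testCost (8 * x) m ≤ (Com.loop x p).compile.cst * bits X V ^ 2 := by
  refine (testCost_le (hm.fits hs) (one_le_bits X V)).trans (Nat.mul_le_mul_right _ ?_)
  simp only [Com.compile, Prog.cst]
  omega

theorem Runs.loop_done {p : Com} {x : ℕ} {s : Store} (hs : s.Within X V) (hx : s.v x = 0) :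
    Runs X V (.loop x p) s s 1 := by
  intro m hm
  have ht := testCost_le_cst_loop (x := x) (p := p) hs hm
  refine ⟨_, _, m, Exec.loop_done (by rwa [hm.var]), hm, by omega, ?_⟩
  refine (hm.fits hs).space_le.trans ?_
  have h2 := (Com.loop x p).compile.two_le_cst
  calc 8 * X * (2 * bits X V) = 2 * (8 * X * bits X V) := by ring
    _ ≤ _ := Nat.mul_le_mul h2 (Nat.mul_le_mul_right _ (by omega))

theorem Runs.loop_step {p : Com} {x : ℕ} {s s' s'' : Store} {k k' : ℕ} (hs : s.Within X V)
    (hx : s.v x ≠ 0) (hp : Runs X V p s s' k) (hl : Runs X V (.loop x p) s' s'' k') :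
    Runs X V (.loop x p) s s'' (k + 1 + k') := by
  intro m hm
  obtain ⟨t, sp, m', h1, h2, h3, h4⟩ := hp m hm
  obtain ⟨t', sp', m'', h1', h2', h3', h4'⟩ := hl m' h2
  have hc : p.compile.cst ≤ (Com.loop x p).compile.cst := by
    simp only [Com.compile, Prog.cst]; omega
  have ht := testCost_le_cst_loop (x := x) (p := p) hs hm
  have h3'' := h3.trans (Nat.mul_le_mul_left k (Nat.mul_le_mul_right (bits X V ^ 2) hc))
  refine ⟨_, _, m'', Exec.loop_step (by rwa [hm.var]) h1 h1', h2', ?_,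
    max_le (h4.trans (Nat.mul_le_mul_right _ hc)) h4'⟩
  rw [add_mul, add_mul]
  omega

/-- A loop with a counted number of iterations. -/
theorem Runs.loop_count {p : Com} {x k : ℕ} (N : ℕ) (Inv : ℕ → Store → Prop)
    (hin : ∀ i s, Inv i s → s.Within X V) (hne : ∀ i s, i < N → Inv i s → s.v x ≠ 0)
    (hzero : ∀ s, Inv N s → s.v x = 0)
    (hstep : ∀ i s, i < N → Inv i s → ∃ s', Runs X V p s s' k ∧ Inv (i + 1) s')
    {s : Store} (hs : Inv 0 s) :
    ∃ s', Runs X V (.loop x p) s s' (N * (k + 1) + 1) ∧ Inv N s' := by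
  have key : ∀ r i s, i + r = N → Inv i s →
      ∃ s', Runs X V (.loop x p) s s' (r * (k + 1) + 1) ∧ Inv N s' := by
    intro r
    induction r with
    | zero =>
      intro i s hi h
      have : i = N := by omega
      subst this
      exact ⟨s, (Runs.loop_done (hin _ s h) (hzero s h)).mono (by omega), h⟩
    | succ r ih =>
      intro i s hi h
      obtain ⟨s', h1, h2⟩ := hstep i s (by omega) h
      obtain ⟨s'', h3, h4⟩ := ih (i + 1) s' (by omega) h2
      exact ⟨s'', (Runs.loop_step (hin i s h) (hne i s (by omega) h) h1 h3).mono
        (by rw [add_mul]; omega), h4⟩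
  exact key N 0 s (by omega) hs

end RAM

/-! ### Perfect matchings as a coefficient of the edge cover polynomial -/

section Matchings

open Finset

variable {V : Type*} [Fintype V] [DecidableEq V] (G : SimpleGraph V) [DecidableRel G.Adj]

/-- The edges inside a set of vertices. -/
def edgesWithin (S : Finset V) : Finset (Sym2 V) := G.edgeFinset.filter fun e => ∀ v ∈ e, v ∈ S

/-- The number of neighbours of `v` in a set of vertices. -/
def nbrsIn (v : V) (S : Finset V) : ℕ := (S.filter (G.Adj v)).card

/-- The edges that a new vertex adds are those to its neighbours. -/
theorem card_edgesWithin_insert {v : V} {S : Finset V} (hv : v ∉ S) :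
    (edgesWithin G (insert v S)).card = (edgesWithin G S).card + nbrsIn G v S := by
  have h : edgesWithin G (insert v S) =
      edgesWithin G S ∪ (S.filter (G.Adj v)).image (fun u => s(v, u)) := by
    ext e
    induction e using Sym2.ind with
    | _ a b =>
      simp only [edgesWithin, mem_filter, SimpleGraph.mem_edgeFinset, SimpleGraph.mem_edgeSet,
        Sym2.mem_iff, forall_eq_or_imp, forall_eq, mem_insert, mem_union, mem_image, Sym2.eq_iff]
      constructor
      · rintro ⟨hab, ha, hb⟩
        rcases ha with rfl | ha
        · rcases hb with rfl | hb
          · exact absurd hab (G.loopless.irrefl _)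
          · exact Or.inr ⟨b, ⟨hb, hab⟩, Or.inl ⟨rfl, rfl⟩⟩
        · rcases hb with rfl | hb
          · exact Or.inr ⟨a, ⟨ha, hab.symm⟩, Or.inr ⟨rfl, rfl⟩⟩
          · exact Or.inl ⟨hab, ha, hb⟩
      · rintro (⟨hab, ha, hb⟩ | ⟨u, ⟨hu, huv⟩, ⟨rfl, rfl⟩ | ⟨rfl, rfl⟩⟩)
        · exact ⟨hab, Or.inr ha, Or.inr hb⟩
        · exact ⟨huv, Or.inl rfl, Or.inr hu⟩
        · exact ⟨huv.symm, Or.inr hu, Or.inl rfl⟩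
  rw [h, card_union_of_disjoint, card_image_of_injOn]
  · rfl
  · intro a _ b _ hab
    simp only [Sym2.eq_iff] at hab
    rcases hab with ⟨_, h⟩ | ⟨h1, h2⟩
    · exact h
    · exact h2.trans h1
  · rw [disjoint_left]
    intro e he he'
    obtain ⟨u, _, rfl⟩ := mem_image.mp he'
    exact hv ((mem_filter.mp he).2 v (Sym2.mem_mk_left v u))

theorem edgesWithin_mono {S T : Finset V} (h : S ⊆ T) : edgesWithin G S ⊆ edgesWithin G T := by
  intro e he
  simp only [edgesWithin, mem_filter] at he ⊢
  exact ⟨he.1, fun v hv => h (he.2 v hv)⟩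

/-- The partition function of the vertices in `U`, each of which is chosen or not, when the chosen
vertices outside `U` are those in `A`: a vertex that is not chosen has weight `W`, and an edge
between two chosen vertices, not both in `A`, has weight `C`. -/
def partitionSum (W C : ℕ) (U A : Finset V) : ℕ :=
  ∑ Y ∈ U.powerset, W ^ (U \ Y).card * C ^ ((edgesWithin G (Y ∪ A)).card - (edgesWithin G A).card)

variable (W C : ℕ)

@[simp] theorem partitionSum_empty (A : Finset V) : partitionSum G W C ∅ A = 1 := by
  simp [partitionSum]

/-- The decision whether `v` is chosen. -/
theorem partitionSum_insert {v : V} {U A : Finset V} (hU : v ∉ U) (hA : v ∉ A) :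
    partitionSum G W C (insert v U) A = W * partitionSum G W C U A +
      C ^ nbrsIn G v A * partitionSum G W C U (insert v A) := by
  unfold partitionSum
  rw [sum_powerset_insert hU, mul_sum, mul_sum]
  congr 1
  · refine sum_congr rfl fun Y hY => ?_
    have hvY : v ∉ Y := fun h => hU (mem_powerset.mp hY h)
    rw [insert_sdiff_of_notMem _ hvY, card_insert_of_notMem (by simp [hU]), pow_succ]
    ring
  · refine sum_congr rfl fun Y hY => ?_
    have hvY : v ∉ Y := fun h => hU (mem_powerset.mp hY h)
    have e1 : insert v U \ insert v Y = U \ Y := by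
      ext x
      simp only [mem_sdiff, mem_insert]
      constructor
      · rintro ⟨rfl | h, h'⟩
        · simp at h'
        · exact ⟨h, fun hx => h' (Or.inr hx)⟩
      · rintro ⟨h, h'⟩
        refine ⟨Or.inr h, ?_⟩
        rintro (rfl | hx)
        · exact hU h
        · exact h' hx
    have e2 : insert v Y ∪ A = Y ∪ insert v A := by
      rw [insert_union, union_insert]
    have h1 := card_edgesWithin_insert G hA
    have h2 := card_le_card (edgesWithin_mono G (subset_union_right : insert v A ⊆ Y ∪ insert v A))
    rw [e1, e2, mul_left_comm, ← pow_add]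
    congr 2
    omega

/-- A chosen vertex without neighbours in `U` does not matter for `U`. -/
theorem partitionSum_insert_of_not_adj {v : V} {U A : Finset V} (hvU : v ∉ U) (hvA : v ∉ A)
    (hUA : Disjoint U A) (h : ∀ u ∈ U, ¬ G.Adj u v) :
    partitionSum G W C U (insert v A) = partitionSum G W C U A := by
  induction U using Finset.induction_on generalizing A with
  | empty => simp
  | insert u U hu ih =>
    have huA : u ∉ A := disjoint_left.mp hUA (mem_insert_self _ _)
    have huv : u ≠ v := fun e => hvU (e ▸ mem_insert_self _ _)
    have hvU' : v ∉ U := fun e => hvU (mem_insert_of_mem e)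
    have hUA' : Disjoint U A := disjoint_of_subset_left (subset_insert _ _) hUA
    rw [partitionSum_insert G W C hu (by simp [huA, huv]), partitionSum_insert G W C hu huA,
      ih hvU' hvA hUA' fun w hw => h w (mem_insert_of_mem hw), insert_comm u v A,
      ih hvU' (by simp [huv.symm, hvA]) (by simp [hu, hUA'])
        fun w hw => h w (mem_insert_of_mem hw)]
    congr 3
    unfold nbrsIn
    rw [filter_insert, if_neg (h u (mem_insert_self _ _))]

/-- Sets of vertices without edges between them contribute independently. -/
theorem partitionSum_union {U₁ U₂ A : Finset V} (h12 : Disjoint U₁ U₂) (h1 : Disjoint U₁ A)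
    (h2 : Disjoint U₂ A) (h : ∀ u ∈ U₁, ∀ w ∈ U₂, ¬ G.Adj u w) :
    partitionSum G W C (U₁ ∪ U₂) A = partitionSum G W C U₁ A * partitionSum G W C U₂ A := by
  induction U₁ using Finset.induction_on generalizing A with
  | empty => simp
  | insert v U hv ih =>
    have hvA : v ∉ A := disjoint_left.mp h1 (mem_insert_self _ _)
    have hv2 : v ∉ U₂ := disjoint_left.mp h12 (mem_insert_self _ _)
    have d12 : Disjoint U U₂ := disjoint_of_subset_left (subset_insert _ _) h12
    have d1 : Disjoint U A := disjoint_of_subset_left (subset_insert _ _) h1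
    have h' : ∀ u ∈ U, ∀ w ∈ U₂, ¬ G.Adj u w := fun u hu => h u (mem_insert_of_mem hu)
    rw [insert_union, partitionSum_insert G W C (by simp [hv, hv2]) hvA,
      partitionSum_insert G W C hv hvA, ih d12 d1 h2 h',
      ih d12 (by simp [hv, d1]) (by simp [hv2, h2]) h',
      partitionSum_insert_of_not_adj G W C (U := U₂) hv2 hvA h2
        fun u hu hadj => h v (mem_insert_self _ _) u hu hadj.symm]
    ring

/-- A crude bound: there are at most `M ^ |V|` choices, and each has weight at most
`M ^ |V| * M`. -/
theorem partitionSum_le {M : ℕ} (hW : W ≤ M) (hC : 1 ≤ C) (hM : 2 ≤ M)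
    (hE : C ^ G.edgeFinset.card ≤ M) (U A : Finset V) :
    partitionSum G W C U A ≤ M ^ (2 * Fintype.card V + 1) := by
  unfold partitionSum
  have hb : ∀ Y ∈ U.powerset,
      W ^ (U \ Y).card * C ^ ((edgesWithin G (Y ∪ A)).card - (edgesWithin G A).card) ≤
        M ^ Fintype.card V * M := by
    intro Y _
    refine Nat.mul_le_mul ?_ ?_
    · exact (Nat.pow_le_pow_left hW _).trans
        (Nat.pow_le_pow_right (by omega) (card_le_univ _))
    · refine (Nat.pow_le_pow_right hC ?_).trans hE
      exact (Nat.sub_le _ _).trans (card_le_card (filter_subset _ _))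
  refine (sum_le_card_nsmul _ _ _ hb).trans ?_
  rw [card_powerset, smul_eq_mul]
  calc 2 ^ U.card * (M ^ Fintype.card V * M)
      ≤ M ^ Fintype.card V * (M ^ Fintype.card V * M) := by
        refine Nat.mul_le_mul_right _ ?_
        exact (Nat.pow_le_pow_right (by norm_num) (card_le_univ U)).trans
          (Nat.pow_le_pow_left hM _)
    _ = _ := by ring

/-- The sets of edges that cover all vertices. -/
def edgeCovers : Finset (Finset (Sym2 V)) :=
  G.edgeFinset.powerset.filter fun F => ∀ v, ∃ e ∈ F, v ∈ e

/-- The edge cover polynomial by inclusion and exclusion over the set of vertices that are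
allowed to be covered. -/
theorem sum_neg_one_pow_mul_pow_edges (B : ℤ) :
    ∑ Y : Finset V, (-1) ^ (univ \ Y).card * (1 + B) ^ (edgesWithin G Y).card =
      ∑ F ∈ edgeCovers G, B ^ F.card := by
  have h1 : ∀ Y : Finset V, (-1 : ℤ) ^ (univ \ Y).card * (1 + B) ^ (edgesWithin G Y).card =
      ∑ F ∈ G.edgeFinset.powerset,
        if (∀ e ∈ F, ∀ v ∈ e, v ∈ Y) then (-1 : ℤ) ^ (univ \ Y).card * B ^ F.card else 0 := by
    intro Y
    have h2 : (1 + B) ^ (edgesWithin G Y).card =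
        ∑ F ∈ (edgesWithin G Y).powerset, B ^ F.card := by
      rw [add_comm, ← sum_pow_mul_eq_add_pow]
      simp
    rw [h2, mul_sum, ← sum_filter]
    refine sum_congr ?_ fun _ _ => rfl
    ext F
    simp only [mem_powerset, mem_filter, edgesWithin, subset_iff]
    exact ⟨fun h => ⟨fun e he => (h he).1, fun e he => (h he).2⟩,
      fun h e he => ⟨h.1 he, h.2 e he⟩⟩
  rw [sum_congr rfl fun Y _ => h1 Y, sum_comm, edgeCovers, sum_filter]
  refine sum_congr rfl fun F _ => ?_
  set S : Finset V := univ.filter fun v => ∃ e ∈ F, v ∈ e with hS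
  have h3 : ∀ Y : Finset V, (∀ e ∈ F, ∀ v ∈ e, v ∈ Y) ↔ (univ \ Y) ⊆ univ \ S := by
    intro Y
    simp only [subset_iff, mem_sdiff, mem_univ, true_and, hS, mem_filter, not_exists, not_and]
    constructor
    · intro h v hv e he hve
      exact hv (h e he v hve)
    · intro h e he v hv
      by_contra hvY
      exact h hvY e he hv
  have h4 : (∑ Y : Finset V, if (∀ e ∈ F, ∀ v ∈ e, v ∈ Y) then
      (-1 : ℤ) ^ (univ \ Y).card * B ^ F.card else 0) =
      (∑ X ∈ (univ \ S).powerset, (-1 : ℤ) ^ X.card) * B ^ F.card := by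
    rw [← sum_filter, sum_mul]
    refine sum_bij' (fun Y _ => univ \ Y) (fun X _ => univ \ X) ?_ ?_ ?_ ?_ ?_
    · intro Y hY
      rw [mem_filter, h3] at hY
      exact mem_powerset.mpr hY.2
    · intro X hX
      rw [mem_filter, h3]
      refine ⟨mem_univ _, ?_⟩
      rw [sdiff_sdiff_right_self]
      simpa using mem_powerset.mp hX
    · intro Y _; simp
    · intro X _; simp
    · intro Y _; rfl
  rw [h4, sum_powerset_neg_one_pow_card]
  by_cases hc : ∀ v, ∃ e ∈ F, v ∈ e
  · have : univ \ S = ∅ := by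
      rw [sdiff_eq_empty_iff_subset]
      intro v _
      simpa [hS] using hc v
    simp [this, hc]
  · have : univ \ S ≠ ∅ := by
      intro h
      rw [sdiff_eq_empty_iff_subset] at h
      apply hc
      intro v
      simpa [hS] using h (mem_univ v)
    rw [if_neg this, if_neg hc, zero_mul]

/-- With the weight `M - 1` in place of `-1`, and natural numbers in place of integers. -/
theorem partitionSum_mod {M B : ℕ} (hM : 1 ≤ M) (hlt : ∑ F ∈ edgeCovers G, B ^ F.card < M) :
    partitionSum G (M - 1) (1 + B) univ ∅ % M = ∑ F ∈ edgeCovers G, B ^ F.card := by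
  have h : (partitionSum G (M - 1) (1 + B) univ ∅) ≡ ∑ F ∈ edgeCovers G, B ^ F.card [MOD M] := by
    rw [← Int.natCast_modEq_iff]
    have h1 := sum_neg_one_pow_mul_pow_edges G (B : ℤ)
    push_cast
    rw [← h1, partitionSum, powerset_univ]
    push_cast
    refine Int.ModEq.sum fun Y _ => ?_
    have h0 : edgesWithin G (∅ : Finset V) = ∅ := by
      refine filter_eq_empty_iff.mpr fun e _ h => ?_
      induction e using Sym2.ind with
      | _ a b => exact notMem_empty a (h a (Sym2.mem_mk_left a b))
    rw [union_empty, h0, card_empty, Nat.sub_zero]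
    refine Int.ModEq.mul (Int.ModEq.pow _ ?_) Int.ModEq.rfl
    rw [Nat.cast_sub hM]
    simp [Int.ModEq]
  exact (Nat.mod_eq_of_modEq h hlt)

/-- A set of edges is the edge set of the graph that it spans. -/
theorem edgeFinset_fromEdgeSet {V : Type*} [Fintype V] {G : SimpleGraph V} [DecidableRel G.Adj]
    {F : Finset (Sym2 V)} (hF : F ⊆ G.edgeFinset)
    [Fintype (SimpleGraph.fromEdgeSet (F : Set (Sym2 V))).edgeSet] :
    (SimpleGraph.fromEdgeSet (F : Set (Sym2 V))).edgeFinset = F := by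
  ext e
  rw [SimpleGraph.mem_edgeFinset, SimpleGraph.edgeSet_fromEdgeSet]
  simp only [Set.mem_sdiff, mem_coe]
  constructor
  · exact fun h => h.1
  · intro h
    exact ⟨h, G.not_isDiag_of_mem_edgeSet (SimpleGraph.mem_edgeFinset.mp (hF h))⟩

variable {G} in
theorem sum_degree_fromEdgeSet {F : Finset (Sym2 V)} (hF : F ⊆ G.edgeFinset)
    [DecidableRel (SimpleGraph.fromEdgeSet (F : Set (Sym2 V))).Adj] :
    ∑ v, (SimpleGraph.fromEdgeSet (F : Set (Sym2 V))).degree v = 2 * F.card := by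
  rw [SimpleGraph.sum_degrees_eq_twice_card_edges]
  congr 2
  convert edgeFinset_fromEdgeSet hF

variable {G} in
theorem one_le_degree_fromEdgeSet {F : Finset (Sym2 V)} (hF : F ∈ edgeCovers G)
    [DecidableRel (SimpleGraph.fromEdgeSet (F : Set (Sym2 V))).Adj] (v : V) :
    1 ≤ (SimpleGraph.fromEdgeSet (F : Set (Sym2 V))).degree v := by
  simp only [edgeCovers, mem_filter, mem_powerset] at hF
  obtain ⟨e, he, hv⟩ := hF.2 v
  obtain ⟨w, rfl⟩ := hv
  rw [Nat.one_le_iff_ne_zero, ← Nat.pos_iff_ne_zero, SimpleGraph.degree_pos_iff_exists_adj]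
  refine ⟨w, ?_⟩
  rw [SimpleGraph.fromEdgeSet_adj]
  exact ⟨he, (SimpleGraph.mem_edgeFinset.mp (hF.1 he) : G.Adj v w).ne⟩

variable {G} in
theorem card_le_of_mem_edgeCovers {F : Finset (Sym2 V)} (hF : F ∈ edgeCovers G) :
    Fintype.card V ≤ 2 * F.card := by
  classical
  have hsub : F ⊆ G.edgeFinset := mem_powerset.mp (mem_filter.mp hF).1
  rw [← sum_degree_fromEdgeSet hsub, ← card_univ, card_eq_sum_ones]
  exact sum_le_sum fun v _ => one_le_degree_fromEdgeSet hF v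

/-- Perfect matchings are the edge covers with half as many edges as there are vertices. -/
theorem numPerfectMatchings_eq_card :
    numPerfectMatchings G =
      ((edgeCovers G).filter fun F => 2 * F.card = Fintype.card V).card := by
  classical
  rw [numPerfectMatchings, ← Set.ncard_coe_finset]
  have hinj : Set.InjOn (fun M : G.Subgraph => (univ.filter (· ∈ M.edgeSet) : Finset (Sym2 V)))
      {M : G.Subgraph | M.IsPerfectMatching} := by
    intro M hM M' hM' h
    simp only [Finset.ext_iff, mem_filter, mem_univ, true_and] at h
    refine SimpleGraph.Subgraph.ext ?_ ?_
    · rw [SimpleGraph.Subgraph.isSpanning_iff.mp hM.2, SimpleGraph.Subgraph.isSpanning_iff.mp hM'.2]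
    · ext a b
      exact h s(a, b)
  rw [← hinj.ncard_image]
  congr 1
  ext F
  simp only [Set.mem_image, Set.mem_ofPred_eq, coe_filter]
  constructor
  · rintro ⟨M, hM, rfl⟩
    rw [SimpleGraph.Subgraph.isPerfectMatching_iff] at hM
    have hsub : (univ.filter (· ∈ M.edgeSet) : Finset (Sym2 V)) ⊆ G.edgeFinset := by
      intro e he
      rw [mem_filter] at he
      exact SimpleGraph.mem_edgeFinset.mpr (M.edgeSet_subset he.2)
    refine ⟨?_, ?_⟩
    · simp only [edgeCovers, mem_filter, mem_powerset]
      refine ⟨hsub, fun v => ?_⟩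
      obtain ⟨w, hw, -⟩ := hM v
      exact ⟨s(v, w), ⟨mem_univ _, hw⟩, Sym2.mem_mk_left v w⟩
    · rw [← sum_degree_fromEdgeSet hsub, ← card_univ, card_eq_sum_ones]
      refine sum_congr rfl fun v _ => ?_
      obtain ⟨w, hw, huniq⟩ := hM v
      rw [SimpleGraph.degree, card_eq_one]
      refine ⟨w, ?_⟩
      ext u
      simp only [SimpleGraph.mem_neighborFinset, SimpleGraph.fromEdgeSet_adj, coe_filter,
        Set.mem_ofPred_eq, mem_univ, true_and, mem_singleton]
      constructor
      · exact fun h => huniq u h.1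
      · rintro rfl
        exact ⟨hw, hw.ne⟩
  · rintro ⟨hF, hcard⟩
    have hsub : F ⊆ G.edgeFinset := mem_powerset.mp (mem_filter.mp hF).1
    set H := SimpleGraph.fromEdgeSet (F : Set (Sym2 V)) with hH
    have hle : H ≤ G := by
      intro a b hab
      rw [hH, SimpleGraph.fromEdgeSet_adj] at hab
      exact SimpleGraph.mem_edgeFinset.mp (hsub hab.1)
    refine ⟨SimpleGraph.toSubgraph H hle, ?_, ?_⟩
    · rw [SimpleGraph.Subgraph.isPerfectMatching_iff]
      have hdeg : ∀ v, H.degree v = 1 := by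
        have h1 : ∀ v ∈ univ, (1 : ℕ) ≤ H.degree v := fun v _ => one_le_degree_fromEdgeSet hF v
        have h2 : ∑ _v : V, 1 = ∑ v, H.degree v := by
          rw [sum_degree_fromEdgeSet hsub, hcard]; simp
        intro v
        exact ((sum_eq_sum_iff_of_le h1).mp h2 v (mem_univ v)).symm
      intro v
      obtain ⟨w, hw⟩ := card_eq_one.mp (hdeg v)
      refine ⟨w, ?_, fun u hu => ?_⟩
      · have : w ∈ H.neighborFinset v := by rw [hw]; exact mem_singleton_self w
        exact (SimpleGraph.mem_neighborFinset _ _ _).mp this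
      · have : u ∈ H.neighborFinset v := (SimpleGraph.mem_neighborFinset _ _ _).mpr hu
        rw [hw] at this
        exact mem_singleton.mp this
    · ext e
      induction e using Sym2.ind with
      | _ a b =>
        simp only [mem_filter, mem_univ, true_and, SimpleGraph.Subgraph.mem_edgeSet]
        change H.Adj a b ↔ _
        rw [hH, SimpleGraph.fromEdgeSet_adj]
        refine ⟨fun h => h.1, fun h => ⟨h, ?_⟩⟩
        exact (SimpleGraph.mem_edgeFinset.mp (hsub h) : G.Adj a b).ne

theorem card_edgeCovers_le : (edgeCovers G).card ≤ 2 ^ G.edgeFinset.card := by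
  rw [← card_powerset]
  exact card_le_card (filter_subset _ _)

/-- The sum over the edge covers is divisible by `B` to half the number of vertices, and the next
digit in base `B` counts the perfect matchings. -/
theorem sum_edgeCovers_digit {B : ℕ} (hB : 2 ^ G.edgeFinset.card < B) :
    (∑ F ∈ edgeCovers G, B ^ F.card) / B ^ (Fintype.card V / 2) % B = numPerfectMatchings G := by
  have hB0 : 0 < B := (Nat.zero_le _).trans_lt hB
  set N := Fintype.card V with hN
  have h : ∃ R, ∑ F ∈ edgeCovers G, B ^ F.card =
      B ^ (N / 2) * (numPerfectMatchings G + B * R) := by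
    rw [numPerfectMatchings_eq_card, ← sum_filter_add_sum_filter_not (edgeCovers G)
      (fun F => 2 * F.card = Fintype.card V)]
    refine ⟨∑ F ∈ (edgeCovers G).filter (fun F => ¬ 2 * F.card = Fintype.card V),
      B ^ (F.card - (N / 2 + 1)), ?_⟩
    rw [mul_add, mul_sum, mul_sum]
    congr 1
    · rw [card_eq_sum_ones, mul_sum]
      refine sum_congr rfl fun F hF => ?_
      have := (mem_filter.mp hF).2
      rw [mul_one]
      congr 1
      omega
    · refine sum_congr rfl fun F hF => ?_
      have h1 := (mem_filter.mp hF).2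
      have h2 := card_le_of_mem_edgeCovers (mem_filter.mp hF).1
      rw [← mul_assoc, ← pow_succ, ← pow_add]
      congr 1
      omega
  obtain ⟨R, hR⟩ := h
  rw [hR, Nat.mul_div_cancel_left _ (pow_pos hB0 _), Nat.add_mul_mod_self_left, Nat.mod_eq_of_lt]
  rw [numPerfectMatchings_eq_card]
  exact ((card_le_card (filter_subset _ _)).trans (card_edgeCovers_le G)).trans_lt hB

theorem sum_edgeCovers_le (B : ℕ) :
    ∑ F ∈ edgeCovers G, B ^ F.card ≤ (1 + B) ^ G.edgeFinset.card := by
  rw [add_comm, ← sum_pow_mul_eq_add_pow]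
  simp only [one_pow, mul_one]
  exact sum_le_sum_of_subset (filter_subset _ _)

end Matchings

/-! ### Recursive bisection of the grid -/

section Bisection

/-- The position `x * g / (n + 1)`, rounded up. With `g` a power of two, the segment `0 < x < n + 1`
is cut into `g` pieces, and this is the number of the piece that holds `x` (unless `x` is one of the
points at which the segment is cut). -/
def piece (n g x : ℕ) : ℕ := (x * g + n) / (n + 1)

theorem le_mul_piece (n g x : ℕ) : x * g ≤ (n + 1) * piece n g x := by
  have := Nat.lt_mul_div_succ (x * g + n) (show 0 < n + 1 by omega)
  rw [Nat.mul_succ] at this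
  unfold piece
  omega

theorem mul_piece_le (n g x : ℕ) : (n + 1) * piece n g x ≤ x * g + n :=
  Nat.mul_div_le _ _

theorem piece_le_iff {n g x c : ℕ} : piece n g x ≤ c ↔ x * g ≤ (n + 1) * c := by
  constructor
  · exact fun h => (le_mul_piece n g x).trans (Nat.mul_le_mul_left _ h)
  · intro h
    by_contra hc
    have h1 : (n + 1) * (c + 1) ≤ (n + 1) * piece n g x := Nat.mul_le_mul_left _ (by omega)
    have h2 := mul_piece_le n g x
    rw [Nat.mul_succ] at h1
    omega

theorem piece_two_mul_le (n g x : ℕ) : piece n (2 * g) x ≤ 2 * piece n g x := by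
  rw [piece_le_iff]
  have := le_mul_piece n g x
  nlinarith

theorem le_piece_two_mul (n g x : ℕ) : 2 * piece n g x ≤ piece n (2 * g) x + 1 := by
  by_contra h
  have h1 := le_mul_piece n (2 * g) x
  have h2 := mul_piece_le n g x
  have h3 : (n + 1) * (piece n (2 * g) x + 2) ≤ (n + 1) * (2 * piece n g x) :=
    Nat.mul_le_mul_left _ (by omega)
  nlinarith

theorem piece_one {n x : ℕ} (h1 : 1 ≤ x) (h2 : x ≤ n) : piece n 1 x = 1 := by
  unfold piece
  rw [Nat.div_eq_of_lt_le] <;> omega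

/-- The point with coordinates `x` is on the hyperplane that is removed from its box in step `t`.
The steps run through the `d` directions in turn. -/
def OnCut (d n : ℕ) (x : ℕ → ℕ) (t : ℕ) : Prop :=
  (n + 1) * piece n (2 ^ (t / d + 1)) (x (t % d)) < (x (t % d) + 1) * 2 ^ (t / d + 1)

/-- The number, in a binary heap, of the box that holds the point with coordinates `x` after `t`
steps of bisection. -/
def boxAt (d n : ℕ) (x : ℕ → ℕ) : ℕ → ℕ
  | 0 => 1
  | t + 1 => 2 * boxAt d n x t + (piece n (2 ^ (t / d + 1)) (x (t % d)) + 1) % 2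

/-- The step in which the point with coordinates `x` is removed. -/
noncomputable def cutTime (d n : ℕ) (x : ℕ → ℕ) : ℕ := sInf {t | OnCut d n x t}

/-- The number of the box whose bisection removes the point with coordinates `x`. -/
noncomputable def cutBox (d n : ℕ) (x : ℕ → ℕ) : ℕ := boxAt d n x (cutTime d n x)

variable {d n : ℕ}

/-- After so many bisections, every piece is too short to have a point in its interior. -/
theorem onCut_of_lt (x : ℕ → ℕ) {t : ℕ} (h : n < 2 ^ (t / d + 1)) : OnCut d n x t := by
  have := mul_piece_le n (2 ^ (t / d + 1)) (x (t % d))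
  have h2 := Nat.succ_mul (x (t % d)) (2 ^ (t / d + 1))
  unfold OnCut
  rw [Nat.succ_eq_add_one] at h2
  omega

/-- Every point is removed after `Nat.log 2 n` full rounds at the latest. -/
theorem onCut_mul_log (hd : 0 < d) (x : ℕ → ℕ) : OnCut d n x (d * Nat.log 2 n) := by
  apply onCut_of_lt
  rw [Nat.mul_div_cancel_left _ hd]
  exact Nat.lt_pow_succ_log_self (by norm_num) n

theorem onCut_cutTime (hd : 0 < d) (x : ℕ → ℕ) : OnCut d n x (cutTime d n x) :=
  Nat.sInf_mem (s := {t | OnCut d n x t}) ⟨_, onCut_mul_log hd x⟩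

theorem cutTime_le (hd : 0 < d) (x : ℕ → ℕ) : cutTime d n x ≤ d * Nat.log 2 n :=
  Nat.sInf_le (s := {t | OnCut d n x t}) (onCut_mul_log hd x)

theorem not_onCut_of_lt {x : ℕ → ℕ} {t : ℕ} (h : t < cutTime d n x) : ¬ OnCut d n x t :=
  Nat.notMem_of_lt_sInf (s := {t | OnCut d n x t}) h

theorem two_pow_le_boxAt (x : ℕ → ℕ) (t : ℕ) : 2 ^ t ≤ boxAt d n x t := by
  induction t with
  | zero => simp [boxAt]
  | succ t ih => rw [boxAt, pow_succ]; omega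

theorem boxAt_lt (x : ℕ → ℕ) (t : ℕ) : boxAt d n x t < 2 ^ (t + 1) := by
  induction t with
  | zero => simp [boxAt]
  | succ t ih => rw [boxAt, pow_succ]; omega

theorem boxAt_mono (x : ℕ → ℕ) : Monotone (boxAt d n x) :=
  monotone_nat_of_le_succ fun t => by rw [boxAt]; omega

/-- The boxes at which points are removed are numbered below `(2 * n) ^ d`, since there are at most
`d * Nat.log 2 n` steps. -/
theorem cutBox_lt (hd : 0 < d) (hn : 0 < n) (x : ℕ → ℕ) : cutBox d n x < (2 * n) ^ d := by
  have h1 := boxAt_lt (d := d) (n := n) x (cutTime d n x)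
  have h2 : 2 ^ (cutTime d n x + 1) ≤ 2 ^ (d * Nat.log 2 n + 1) :=
    Nat.pow_le_pow_right (by norm_num) (by have := cutTime_le (n := n) hd x; omega)
  have h3 : 2 ^ (d * Nat.log 2 n) ≤ n ^ d := by
    rw [mul_comm, pow_mul]
    exact Nat.pow_le_pow_left (Nat.pow_log_le_self 2 (by omega)) d
  have h4 : 2 * n ^ d ≤ (2 * n) ^ d := by
    rw [mul_pow]
    refine Nat.mul_le_mul_right _ ?_
    calc 2 = 2 ^ 1 := rfl
      _ ≤ 2 ^ d := Nat.pow_le_pow_right (by norm_num) hd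
  unfold cutBox
  rw [pow_succ] at h2
  omega

/-- Neighbouring points stay in the same box until one of them is removed. -/
theorem boxAt_eq_of_succ {x y : ℕ → ℕ} {i : ℕ} (hi : y i = x i + 1) (hne : ∀ j, j ≠ i → y j = x j)
    {t : ℕ} (ht : ∀ s < t, ¬ OnCut d n x s) : boxAt d n x t = boxAt d n y t := by
  induction t with
  | zero => rfl
  | succ t ih =>
    rw [boxAt, boxAt, ih fun s hs => ht s (by omega)]
    congr 3
    by_cases h : t % d = i
    · have h1 := ht t (by omega)
      unfold OnCut at h1
      rw [h] at h1 ⊢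
      rw [hi]
      refine le_antisymm ?_ ?_
      · rw [piece_le_iff]
        have := le_mul_piece n (2 ^ (t / d + 1)) (x i + 1)
        exact (Nat.mul_le_mul_right _ (by omega)).trans this
      · rw [piece_le_iff]
        omega
    · rw [hne _ h]

/-- The number of times that direction `i` has been bisected in the first `t` steps. -/
def rounds (d t i : ℕ) : ℕ := t / d + if i < t % d then 1 else 0

theorem rounds_succ (hd : 0 < d) {t i : ℕ} (hi : i < d) :
    rounds d (t + 1) i = rounds d t i + if i = t % d then 1 else 0 := by
  unfold rounds
  have hlt := Nat.mod_lt t hd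
  have hdm := Nat.div_add_mod t d
  by_cases h : t % d + 1 = d
  · have h1 : t + 1 = d * (t / d + 1) := by rw [Nat.mul_succ]; omega
    have e1 : (t + 1) / d = t / d + 1 := by rw [h1, Nat.mul_div_cancel_left _ hd]
    have e2 : (t + 1) % d = 0 := by rw [h1, Nat.mul_mod_right]
    rw [e1, e2]
    split_ifs <;> omega
  · have h1 : t + 1 = (t % d + 1) + d * (t / d) := by omega
    have e1 : (t + 1) / d = t / d := by
      conv_lhs => rw [h1, Nat.add_mul_div_left _ _ hd, Nat.div_eq_of_lt (by omega)]
      omega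
    have e2 : (t + 1) % d = t % d + 1 := by
      conv_lhs => rw [h1, Nat.add_mul_mod_self_left, Nat.mod_eq_of_lt (by omega)]
    rw [e1, e2]
    split_ifs <;> omega

theorem rounds_mod (t : ℕ) : rounds d t (t % d) = t / d := by simp [rounds]

/-- A point that has not been removed is inside its piece in every direction. -/
theorem succ_mul_le_of_not_onCut (hd : 0 < d) {x : ℕ → ℕ} (hx : ∀ i < d, 1 ≤ x i ∧ x i ≤ n) {t : ℕ}
    (ht : ∀ s < t, ¬ OnCut d n x s) {i : ℕ} (hi : i < d) :
    (x i + 1) * 2 ^ rounds d t i ≤ (n + 1) * piece n (2 ^ rounds d t i) (x i) := by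
  induction t with
  | zero =>
    have : rounds d 0 i = 0 := by simp [rounds]
    obtain ⟨h1, h2⟩ := hx i hi
    rw [this, pow_zero, piece_one h1 h2]
    omega
  | succ t ih =>
    rw [rounds_succ hd hi]
    split_ifs with h
    · have h1 := ht t (by omega)
      unfold OnCut at h1
      rw [h, rounds_mod]
      omega
    · exact ih fun s hs => ht s (by omega)

/-- The number of the box determines the piece in every direction. -/
theorem piece_eq_of_boxAt_eq (hd : 0 < d) {x y : ℕ → ℕ} (hx : ∀ i < d, 1 ≤ x i ∧ x i ≤ n)
    (hy : ∀ i < d, 1 ≤ y i ∧ y i ≤ n) {t : ℕ} (h : boxAt d n x t = boxAt d n y t) {i : ℕ}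
    (hi : i < d) : piece n (2 ^ rounds d t i) (x i) = piece n (2 ^ rounds d t i) (y i) := by
  induction t with
  | zero =>
    have : rounds d 0 i = 0 := by simp [rounds]
    rw [this, pow_zero, piece_one (hx i hi).1 (hx i hi).2, piece_one (hy i hi).1 (hy i hi).2]
  | succ t ih =>
    rw [boxAt, boxAt] at h
    have ih := ih (by omega)
    rw [rounds_succ hd hi]
    split_ifs with hit
    · subst hit
      rw [rounds_mod] at ih ⊢
      rw [pow_succ, mul_comm (2 ^ (t / d))] at h ⊢
      have h1 := piece_two_mul_le n (2 ^ (t / d)) (x (t % d))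
      have h2 := piece_two_mul_le n (2 ^ (t / d)) (y (t % d))
      have h3 := le_piece_two_mul n (2 ^ (t / d)) (x (t % d))
      have h4 := le_piece_two_mul n (2 ^ (t / d)) (y (t % d))
      omega
    · exact ih

/-- All points that are removed from a box in step `t` have the same coordinate in the direction of
this step. -/
theorem eq_of_onCut (hd : 0 < d) {x y : ℕ → ℕ} (hx : ∀ i < d, 1 ≤ x i ∧ x i ≤ n)
    (hy : ∀ i < d, 1 ≤ y i ∧ y i ≤ n) {t : ℕ} (h : boxAt d n x t = boxAt d n y t)
    (hxt : OnCut d n x t) (hyt : OnCut d n y t) (hxs : ∀ s < t, ¬ OnCut d n x s)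
    (hys : ∀ s < t, ¬ OnCut d n y s) : x (t % d) = y (t % d) := by
  have hi : t % d < d := Nat.mod_lt t hd
  have h1 := succ_mul_le_of_not_onCut hd hx hxs hi
  have h2 := succ_mul_le_of_not_onCut hd hy hys hi
  have h3 := piece_eq_of_boxAt_eq hd hx hy h hi
  unfold OnCut at hxt hyt
  rw [rounds_mod] at h1 h2 h3
  rw [pow_succ, mul_comm (2 ^ (t / d))] at hxt hyt
  have key : ∀ z : ℕ, (z + 1) * 2 ^ (t / d) ≤ (n + 1) * piece n (2 ^ (t / d)) z →
      (n + 1) * piece n (2 * 2 ^ (t / d)) z < (z + 1) * (2 * 2 ^ (t / d)) →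
      piece n (2 * 2 ^ (t / d)) z + 1 = 2 * piece n (2 ^ (t / d)) z := by
    intro z hz hz'
    have h4 := piece_two_mul_le n (2 ^ (t / d)) z
    have h5 := le_piece_two_mul n (2 ^ (t / d)) z
    by_contra hne
    have h6 : piece n (2 * 2 ^ (t / d)) z = 2 * piece n (2 ^ (t / d)) z := by omega
    rw [h6] at hz'
    nlinarith
  have hcx := key _ h1 hxt
  have hcy := key _ h2 hyt
  have hc : piece n (2 * 2 ^ (t / d)) (x (t % d)) = piece n (2 * 2 ^ (t / d)) (y (t % d)) := by
    omega
  have l1 := le_mul_piece n (2 * 2 ^ (t / d)) (x (t % d))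
  have l2 := le_mul_piece n (2 * 2 ^ (t / d)) (y (t % d))
  rw [← hc] at l2 hyt
  have m1 := lt_of_mul_lt_mul_right (l1.trans_lt hyt) (Nat.zero_le _)
  have m2 := lt_of_mul_lt_mul_right (l2.trans_lt hxt) (Nat.zero_le _)
  omega

/-- A piece of the segment holds at most `n / g` points. -/
theorem card_piece_le {g c : ℕ} (hg : 0 < g) (S : Finset ℕ)
    (hS : ∀ x ∈ S, piece n g x = c ∧ (x + 1) * g ≤ (n + 1) * piece n g x) : S.card ≤ n / g := by
  rcases S.eq_empty_or_nonempty with rfl | hne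
  · simp
  obtain ⟨x, hx, hmin⟩ := S.exists_min_image id hne
  have hsub : S ⊆ Finset.Ico x (x + n / g) := by
    intro y hy
    have h0 : x ≤ y := hmin y hy
    rw [Finset.mem_Ico]
    refine ⟨h0, ?_⟩
    have h1 := mul_piece_le n g x
    have h2 := (hS y hy).2
    rw [(hS y hy).1] at h2
    rw [(hS x hx).1] at h1
    have h3 : (y + 1 - x) * g ≤ n := by
      rw [Nat.sub_mul]; omega
    have h4 := (Nat.le_div_iff_mul_le hg).mpr h3
    omega
  simpa using Finset.card_le_card hsub

/-- A bound for the number of points that are removed from one box in step `t`. -/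
def cutSize (d n t : ℕ) : ℕ := (n / 2 ^ (t / d + 1)) ^ (t % d) * (n / 2 ^ (t / d)) ^ (d - 1 - t % d)

/-- The coordinates of a vertex of the grid, shifted to the range from `1` to `n`. -/
def coords (u : Fin d → Fin n) (i : ℕ) : ℕ := if h : i < d then (u ⟨i, h⟩ : ℕ) + 1 else 0

theorem coords_bounds (u : Fin d → Fin n) : ∀ i < d, 1 ≤ coords u i ∧ coords u i ≤ n := by
  intro i hi
  have := (u ⟨i, hi⟩).2
  simp only [coords, hi, dif_pos]
  omega

theorem coords_injective : Function.Injective (coords : (Fin d → Fin n) → ℕ → ℕ) := by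
  intro u w h
  funext i
  have := congrFun h i
  simp only [coords, i.2, dif_pos] at this
  exact Fin.ext (by simpa using this)

/-- The product of the bounds for the numbers of points of a box in all directions, except for the
direction of the bisection. -/
theorem prod_cutSize (hd : 0 < d) (t : ℕ) :
    ∏ i : Fin d, (if (i : ℕ) = t % d then 1 else n / 2 ^ rounds d t i) = cutSize d n t := by
  have hlt := Nat.mod_lt t hd
  rw [Fin.prod_univ_eq_prod_range (fun i => if i = t % d then 1 else n / 2 ^ rounds d t i) d,
    ← Finset.prod_range_mul_prod_Ico _ hlt.le, Finset.prod_eq_prod_Ico_succ_bot hlt, cutSize]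
  congr 1
  · rw [Finset.prod_congr rfl (g := fun _ => n / 2 ^ (t / d + 1))]
    · simp
    · intro i hi
      rw [Finset.mem_range] at hi
      rw [if_neg (by omega), rounds, if_pos hi]
  · rw [if_pos rfl, one_mul, Finset.prod_congr rfl (g := fun _ => n / 2 ^ (t / d))]
    · rw [Finset.prod_const, Nat.card_Ico]
      congr 1
      omega
    · intro i hi
      rw [Finset.mem_Ico] at hi
      rw [if_neg (by omega), rounds, if_neg (by omega), add_zero]

/-- The points that are removed from one box lie on a hyperplane and inside their piece in every
other direction. -/
theorem card_cut_le (hd : 0 < d) (t q : ℕ) (S : Finset (Fin d → Fin n))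
    (hS : ∀ u ∈ S, cutTime d n (coords u) = t ∧ boxAt d n (coords u) t = q) :
    S.card ≤ cutSize d n t := by
  classical
  rcases S.eq_empty_or_nonempty with rfl | ⟨u₀, hu₀⟩
  · simp
  have hns : ∀ u ∈ S, ∀ s < t, ¬ OnCut d n (coords u) s := fun u hu s hs =>
    not_onCut_of_lt (by rw [(hS u hu).1]; exact hs)
  have hon : ∀ u ∈ S, OnCut d n (coords u) t := fun u hu => by
    have := onCut_cutTime (n := n) hd (coords u)
    rwa [(hS u hu).1] at this
  let D : Fin d → Finset ℕ := fun i => S.image fun u => coords u i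
  have hsub : S.image (fun u (i : Fin d) => coords u i) ⊆ Fintype.piFinset D := by
    intro f hf
    obtain ⟨u, hu, rfl⟩ := Finset.mem_image.mp hf
    exact Fintype.mem_piFinset.mpr fun i => Finset.mem_image_of_mem _ hu
  have hinj : Function.Injective fun (u : Fin d → Fin n) (i : Fin d) => coords u i := by
    intro u w h
    funext i
    have := congrFun h i
    simp only [coords, i.2, dif_pos] at this
    exact Fin.ext (by simpa using this)
  have hcard := Finset.card_le_card hsub
  rw [Finset.card_image_of_injective _ hinj, Fintype.card_piFinset] at hcard
  rw [← prod_cutSize hd t]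
  refine hcard.trans (Finset.prod_le_prod' fun i _ => ?_)
  split_ifs with hi
  · refine Finset.card_le_one.mpr ?_
    intro a ha b hb
    obtain ⟨u, hu, rfl⟩ := Finset.mem_image.mp ha
    obtain ⟨w, hw, rfl⟩ := Finset.mem_image.mp hb
    have := eq_of_onCut hd (coords_bounds u) (coords_bounds w)
      ((hS u hu).2.trans (hS w hw).2.symm) (hon u hu) (hon w hw) (hns u hu) (hns w hw)
    rwa [← hi] at this
  · refine card_piece_le (c := piece n (2 ^ rounds d t i) (coords u₀ i)) (by positivity) _ ?_
    intro a ha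
    obtain ⟨u, hu, rfl⟩ := Finset.mem_image.mp ha
    exact ⟨piece_eq_of_boxAt_eq hd (coords_bounds u) (coords_bounds u₀)
      ((hS u hu).2.trans (hS u₀ hu₀).2.symm) i.2,
      succ_mul_le_of_not_onCut hd (coords_bounds u) (hns u hu) i.2⟩

/-- Step `i` of round `J`. -/
theorem cutSize_le (hd : 0 < d) (J : ℕ) {i : ℕ} (hi : i < d) :
    (cutSize d n (d * J + i) : ℝ) ≤ (n : ℝ) ^ (d - 1) * ((1 / 2) ^ (d - 1)) ^ J * (1 / 2) ^ i := by
  have e1 : (d * J + i) / d = J := by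
    rw [Nat.mul_add_div hd, Nat.div_eq_of_lt hi, add_zero]
  have e2 : (d * J + i) % d = i := by rw [Nat.mul_add_mod, Nat.mod_eq_of_lt hi]
  have hdiv : ∀ k : ℕ, ((n / 2 ^ k : ℕ) : ℝ) ≤ n * (1 / 2) ^ k := by
    intro k
    refine (Nat.cast_div_le).trans (le_of_eq ?_)
    push_cast
    rw [one_div, inv_pow, div_eq_mul_inv]
  rw [cutSize, e1, e2]
  push_cast
  calc ((n / 2 ^ (J + 1) : ℕ) : ℝ) ^ i * ((n / 2 ^ J : ℕ) : ℝ) ^ (d - 1 - i)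
      ≤ (n * (1 / 2) ^ (J + 1)) ^ i * (n * (1 / 2) ^ J) ^ (d - 1 - i) := by
        gcongr <;> exact hdiv _
    _ = _ := by
      obtain ⟨m, hm⟩ : ∃ m, d - 1 = i + m := ⟨d - 1 - i, by omega⟩
      have hm' : i + m - i = m := by omega
      rw [hm, hm', mul_pow, mul_pow, ← pow_mul, ← pow_mul, ← pow_mul, pow_add (n : ℝ)]
      have h1 : (1 / 2 : ℝ) ^ ((J + 1) * i) * (1 / 2) ^ (J * m) =
          (1 / 2) ^ ((i + m) * J) * (1 / 2) ^ i := by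
        rw [← pow_add, ← pow_add]
        congr 1
        ring
      linear_combination ((n : ℝ) ^ i * (n : ℝ) ^ m) * h1

/-- A bound for the number of vertices that are decided on a path of the recursion. With
`r = (1 / 2) ^ (d - 1)`, round `J` contributes at most `n ^ (d - 1) * r ^ J * (2 - r)`, and
`(2 - r) / (1 - r)` is the constant in the bound. -/
theorem sum_cutSize_le (hd : 2 ≤ d) (τ : ℕ) :
    (∑ t ∈ Finset.range τ, cutSize d n t : ℕ) ≤
      ((2 : ℝ) ^ d - 1) / ((2 : ℝ) ^ (d - 1) - 1) * (n : ℝ) ^ (d - 1) := by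
  have hd0 : 0 < d := by omega
  set r : ℝ := (1 / 2) ^ (d - 1) with hr
  have h2r : (2 : ℝ) ^ (d - 1) * r = 1 := by rw [hr, ← mul_pow]; norm_num
  have h2d : (2 : ℝ) ^ d = 2 * 2 ^ (d - 1) := by
    rw [← pow_succ', Nat.sub_add_cancel (by omega)]
  have hgt : (1 : ℝ) < 2 ^ (d - 1) := one_lt_pow₀ (by norm_num) (by omega)
  have hr0 : 0 < r := by rw [hr]; positivity
  set e : ℝ := ((2 : ℝ) ^ d - 1) / ((2 : ℝ) ^ (d - 1) - 1) with he
  have he0 : 0 ≤ e := div_nonneg (by rw [h2d]; linarith) (by linarith)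
  have her : e * (1 - r) = 2 - r := by
    rw [he, div_mul_eq_mul_div, div_eq_iff (by linarith), h2d]
    linear_combination -h2r
  have hgeom : ∑ i ∈ Finset.range d, (1 / 2 : ℝ) ^ i = 2 - r := by
    rw [geom_sum_eq (by norm_num)]
    have : (1 / 2 : ℝ) ^ d = r / 2 := by
      rw [hr]
      conv_lhs => rw [← Nat.sub_add_cancel (show 1 ≤ d by omega)]
      rw [pow_succ]; ring
    rw [this]; ring
  -- the sum over the first `J` rounds; the factor `1 - r ^ J` makes the induction work
  have hJ : ∀ J : ℕ, ((∑ t ∈ Finset.range (d * J), cutSize d n t : ℕ) : ℝ) ≤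
      (n : ℝ) ^ (d - 1) * (e * (1 - r ^ J)) := by
    intro J
    induction J with
    | zero => simp
    | succ J ih =>
      rw [Nat.mul_succ, Finset.sum_range_add]
      push_cast at ih ⊢
      have hb : ∑ i ∈ Finset.range d, (cutSize d n (d * J + i) : ℝ) ≤
          (n : ℝ) ^ (d - 1) * r ^ J * (2 - r) := by
        rw [← hgeom, Finset.mul_sum]
        exact Finset.sum_le_sum fun i hi => cutSize_le hd0 J (Finset.mem_range.mp hi)
      calc _ ≤ (n : ℝ) ^ (d - 1) * (e * (1 - r ^ J)) + (n : ℝ) ^ (d - 1) * r ^ J * (2 - r) :=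
            add_le_add ih hb
        _ = _ := by rw [← her]; ring
  have hmono : (∑ t ∈ Finset.range τ, cutSize d n t) ≤ ∑ t ∈ Finset.range (d * τ), cutSize d n t :=
    Finset.sum_le_sum_of_subset (Finset.range_mono (by nlinarith))
  calc ((∑ t ∈ Finset.range τ, cutSize d n t : ℕ) : ℝ)
      ≤ ((∑ t ∈ Finset.range (d * τ), cutSize d n t : ℕ) : ℝ) := by exact_mod_cast hmono
    _ ≤ _ := hJ τ
    _ ≤ (n : ℝ) ^ (d - 1) * (e * 1) := by
      gcongr
      have : 0 ≤ r ^ τ := by positivity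
      linarith
    _ = _ := by ring

end Bisection

/-! ### Encoding grid points as numbers -/

section Encoding

open Finset

/-- The number with digits `x i` in base `b`. -/
def encode (b d : ℕ) (x : ℕ → ℕ) : ℕ := ∑ i ∈ range d, x i * b ^ i

/-- The digits of a number in base `b`. -/
def digit (b c i : ℕ) : ℕ := c / b ^ i % b

theorem encode_lt {b d : ℕ} {x : ℕ → ℕ} (hx : ∀ i < d, x i < b) : encode b d x < b ^ d := by
  induction d with
  | zero => simp [encode]
  | succ d ih =>
    have h1 := ih fun i hi => hx i (by omega)
    have h2 : (x d + 1) * b ^ d ≤ b * b ^ d := Nat.mul_le_mul_right _ (hx d (by omega))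
    rw [encode, sum_range_succ, ← encode, pow_succ, mul_comm (b ^ d)]
    rw [add_mul] at h2
    omega

theorem digit_encode {b d : ℕ} {x : ℕ → ℕ} (hx : ∀ i < d, x i < b) {i : ℕ} (hi : i < d) :
    digit b (encode b d x) i = x i := by
  have key : ∀ m, ∃ R, encode b (i + 1 + m) x = encode b i x + b ^ i * (x i + b * R) := by
    intro m
    induction m with
    | zero => exact ⟨0, by simp [encode, sum_range_succ, mul_comm]⟩
    | succ m ih =>
      obtain ⟨R, hR⟩ := ih
      refine ⟨R + x (i + 1 + m) * b ^ m, ?_⟩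
      rw [← add_assoc, encode, sum_range_succ, ← encode, hR]
      ring
  obtain ⟨R, hR⟩ := key (d - (i + 1))
  rw [show i + 1 + (d - (i + 1)) = d by omega] at hR
  have hlt : encode b i x < b ^ i := encode_lt fun j hj => hx j (by omega)
  have hb : x i < b := hx i hi
  rw [digit, hR, Nat.add_mul_div_left _ _ (by omega), Nat.div_eq_of_lt hlt, zero_add,
    Nat.add_mul_mod_self_left, Nat.mod_eq_of_lt hb]

theorem digit_eq_zero {b c d i : ℕ} (hc : c < b ^ d) (hb : 0 < b) (hi : d ≤ i) :
    digit b c i = 0 := by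
  rw [digit, Nat.div_eq_of_lt (hc.trans_le (Nat.pow_le_pow_right hb hi)), Nat.zero_mod]

theorem encode_digit {b c d : ℕ} (hc : c < b ^ d) : encode b d (digit b c) = c := by
  have h : ∀ m, encode b m (digit b c) = c % b ^ m := by
    intro m
    induction m with
    | zero => simp [encode, Nat.mod_one]
    | succ m ih =>
      rw [encode, sum_range_succ, ← encode, ih, Nat.mod_pow_succ, digit, mul_comm]
  rw [h, Nat.mod_eq_of_lt hc]

/-- The number of a vertex of the grid. The base `2 * n` leaves room for a border of numbers that
do not belong to vertices. -/
def vertexCode {d n : ℕ} (u : Fin d → Fin n) : ℕ := encode (2 * n) d (coords u)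

variable {d n : ℕ}

theorem coords_lt (hn : 1 ≤ n) (u : Fin d → Fin n) : ∀ i < d, coords u i < 2 * n := by
  intro i hi
  have := (coords_bounds u i hi).2
  omega

theorem vertexCode_lt (hn : 1 ≤ n) (u : Fin d → Fin n) : vertexCode u < (2 * n) ^ d :=
  encode_lt (coords_lt hn u)

theorem digit_vertexCode (hn : 1 ≤ n) (u : Fin d → Fin n) :
    digit (2 * n) (vertexCode u) = coords u := by
  funext i
  by_cases hi : i < d
  · exact digit_encode (coords_lt hn u) hi
  · rw [digit_eq_zero (vertexCode_lt hn u) (by omega) (by omega)]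
    simp [coords, hi]

theorem vertexCode_injective (hn : 1 ≤ n) :
    Function.Injective (vertexCode : (Fin d → Fin n) → ℕ) := by
  intro u w h
  apply coords_injective
  rw [← digit_vertexCode hn u, ← digit_vertexCode hn w, h]

theorem exists_vertexCode_eq {c : ℕ} (hc : c < (2 * n) ^ d)
    (h : ∀ i < d, 1 ≤ digit (2 * n) c i ∧ digit (2 * n) c i ≤ n) :
    ∃ u : Fin d → Fin n, vertexCode u = c := by
  refine ⟨fun i => ⟨digit (2 * n) c i - 1, by have := h i i.2; omega⟩, ?_⟩
  refine Eq.trans ?_ (encode_digit hc)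
  unfold vertexCode encode
  refine sum_congr rfl fun i hi => ?_
  have hi' : i < d := mem_range.mp hi
  have := (h i hi').1
  simp only [coords, hi', dif_pos]
  rw [Nat.sub_add_cancel this]

theorem encode_update_succ (b : ℕ) {x : ℕ → ℕ} {i : ℕ} (hi : i < d) :
    encode b d (Function.update x i (x i + 1)) = encode b d x + b ^ i := by
  unfold encode
  rw [← add_sum_erase _ _ (mem_range.mpr hi), ← add_sum_erase (range d) _ (mem_range.mpr hi),
    Function.update_self]
  have : ∑ j ∈ (range d).erase i, Function.update x i (x i + 1) j * b ^ j =
      ∑ j ∈ (range d).erase i, x j * b ^ j :=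
    sum_congr rfl fun j hj => by rw [Function.update_of_ne (ne_of_mem_erase hj)]
  rw [this]
  ring

/-- Adding `(2 * n) ^ i` to the number of a vertex means one step in direction `i`: the digits of a
vertex are at most `n`, so that there is no carry. -/
theorem vertexCode_eq_add_iff (hn : 2 ≤ n) (u w : Fin d → Fin n) {i : ℕ} (hi : i < d) :
    vertexCode w = vertexCode u + (2 * n) ^ i ↔
      coords w = Function.update (coords u) i (coords u i + 1) := by
  constructor
  · intro h
    rw [vertexCode, vertexCode, ← encode_update_succ _ hi] at h
    have hlt : ∀ j < d, Function.update (coords u) i (coords u i + 1) j < 2 * n := by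
      intro j hj
      have := (coords_bounds u j hj).2
      by_cases hji : j = i
      · subst hji; rw [Function.update_self]; omega
      · rw [Function.update_of_ne hji]; omega
    funext j
    by_cases hj : j < d
    · rw [← digit_encode hlt hj, ← h, digit_encode (coords_lt (by omega) w) hj]
    · rw [Function.update_of_ne (by omega)]
      simp [coords, hj]
  · intro h
    rw [vertexCode, h, encode_update_succ _ hi, vertexCode]

theorem gridGraph_adj_iff (hn : 2 ≤ n) (u w : Fin d → Fin n) :
    (gridGraph d n).Adj u w ↔ ∃ i < d, vertexCode w = vertexCode u + (2 * n) ^ i ∨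
      vertexCode u = vertexCode w + (2 * n) ^ i := by
  have key : ∀ (u w : Fin d → Fin n) (i : Fin d), (u i : ℕ) + 1 = w i → (∀ j, j ≠ i → u j = w j) →
      coords w = Function.update (coords u) i (coords u i + 1) := by
    intro u w i h hj
    funext j
    by_cases hjd : j < d
    · by_cases hji : j = i
      · subst hji
        simp [coords, h]
      · rw [Function.update_of_ne hji]
        have := hj ⟨j, hjd⟩ (fun e => hji (congrArg Fin.val e))
        simp only [coords, hjd, dif_pos, this]
    · rw [Function.update_of_ne (by omega)]
      simp [coords, hjd]
  have key' : ∀ (u w : Fin d → Fin n) (i : Fin d),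
      coords w = Function.update (coords u) i (coords u i + 1) →
      (u i : ℕ) + 1 = w i ∧ (∀ j, j ≠ i → u j = w j) := by
    intro u w i h
    constructor
    · have := congrFun h i
      rw [Function.update_self] at this
      simp only [coords, i.2, dif_pos, Fin.eta] at this
      omega
    · intro j hj
      have := congrFun h j
      rw [Function.update_of_ne (fun e => hj (Fin.ext e))] at this
      simp only [coords, j.2, dif_pos, Fin.eta] at this
      exact Fin.ext (by omega)
  constructor
  · rintro ⟨i, h | h, hj⟩
    · exact ⟨i, i.2, Or.inl ((vertexCode_eq_add_iff hn u w i.2).mpr (key u w i h hj))⟩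
    · exact ⟨i, i.2, Or.inr ((vertexCode_eq_add_iff hn w u i.2).mpr
        (key w u i h fun j hji => (hj j hji).symm))⟩
  · rintro ⟨i, hi, h | h⟩
    · obtain ⟨h1, h2⟩ := key' u w ⟨i, hi⟩ ((vertexCode_eq_add_iff hn u w hi).mp h)
      exact ⟨⟨i, hi⟩, Or.inl h1, h2⟩
    · obtain ⟨h1, h2⟩ := key' w u ⟨i, hi⟩ ((vertexCode_eq_add_iff hn w u hi).mp h)
      exact ⟨⟨i, hi⟩, Or.inr h1, fun j hji => (h2 j hji).symm⟩

open Classical in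
/-- The array that marks the numbers of the chosen vertices by the value `B`. -/
noncomputable def marks (B : ℕ) (A : Finset (Fin d → Fin n)) (c : ℕ) : ℕ :=
  if ∃ u ∈ A, vertexCode u = c then B else 0

/-- The subtraction of `(2 * n) ^ i` from the number of a vertex is not truncated. -/
theorem pow_le_vertexCode (u : Fin d → Fin n) {i : ℕ} (hi : i < d) :
    (2 * n) ^ i ≤ vertexCode u := by
  have h1 := (coords_bounds u i hi).1
  unfold vertexCode encode
  calc (2 * n) ^ i ≤ coords u i * (2 * n) ^ i := Nat.le_mul_of_pos_left _ h1
    _ ≤ _ := single_le_sum (f := fun i => coords u i * (2 * n) ^ i) (fun _ _ => Nat.zero_le _)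
      (mem_range.mpr hi)

open Classical in
/-- The marks at the neighbouring numbers give the number of chosen neighbours. -/
theorem prod_marks (hn : 2 ≤ n) (B : ℕ) (A : Finset (Fin d → Fin n)) (u : Fin d → Fin n) :
    ∏ i ∈ range d, ((1 + marks B A (vertexCode u + (2 * n) ^ i)) *
      (1 + marks B A (vertexCode u - (2 * n) ^ i))) =
      (1 + B) ^ nbrsIn (gridGraph d n) u A := by
  have hcard : ∀ c : ℕ, 1 + marks B A c = (1 + B) ^ (A.filter fun w => vertexCode w = c).card := by
    intro c
    unfold marks
    split_ifs with h
    · obtain ⟨w, hw, hc⟩ := h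
      have : (A.filter fun w => vertexCode w = c) = {w} := by
        ext z
        simp only [mem_filter, mem_singleton]
        constructor
        · rintro ⟨_, hz⟩
          exact vertexCode_injective (by omega) (hz.trans hc.symm)
        · rintro rfl
          exact ⟨hw, hc⟩
      rw [this, card_singleton, pow_one]
    · have : (A.filter fun w => vertexCode w = c) = ∅ :=
        filter_eq_empty_iff.mpr fun w hw hc => h ⟨w, hw, hc⟩
      rw [this, card_empty, pow_zero, add_zero]
  have hpowinj : ∀ i j : ℕ, (2 * n) ^ i = (2 * n) ^ j → i = j := fun i j h =>
    Nat.pow_right_injective (by omega : 2 ≤ 2 * n) h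
  have hpos : ∀ i, 0 < (2 * n) ^ i := fun i => pow_pos (by omega) i
  have hunion : A.filter ((gridGraph d n).Adj u) = (range d).biUnion fun i =>
      (A.filter fun w => vertexCode w = vertexCode u + (2 * n) ^ i) ∪
      (A.filter fun w => vertexCode w = vertexCode u - (2 * n) ^ i) := by
    ext w
    simp only [mem_filter, mem_biUnion, mem_range, mem_union, gridGraph_adj_iff hn]
    constructor
    · rintro ⟨hw, i, hi, h | h⟩
      · exact ⟨i, hi, Or.inl ⟨hw, h⟩⟩
      · exact ⟨i, hi, Or.inr ⟨hw, by omega⟩⟩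
    · rintro ⟨i, hi, ⟨hw, h⟩ | ⟨hw, h⟩⟩
      · exact ⟨hw, i, hi, Or.inl h⟩
      · have := pow_le_vertexCode u hi
        exact ⟨hw, i, hi, Or.inr (by omega)⟩
  rw [nbrsIn, hunion, card_biUnion, ← prod_pow_eq_pow_sum]
  · refine prod_congr rfl fun i hi => ?_
    rw [card_union_of_disjoint, pow_add, hcard, hcard]
    rw [disjoint_left]
    intro w hw hw'
    have h1 := (mem_filter.mp hw).2
    have h2 := (mem_filter.mp hw').2
    have := hpos i
    omega
  · intro i hi j hj hij
    rw [Function.onFun, disjoint_left]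
    intro w hw hw'
    simp only [mem_union, mem_filter] at hw hw'
    have hi' := pow_le_vertexCode u (mem_range.mp hi)
    have hj' := pow_le_vertexCode u (mem_range.mp hj)
    have h1 := hpos i
    have h2 := hpos j
    apply hij
    apply hpowinj
    omega

open Classical in
/-- The array that holds, for each vertex, the number of the box whose bisection removes it, and
`0` for all other numbers. -/
noncomputable def cutArray (d n c : ℕ) : ℕ :=
  if c < (2 * n) ^ d ∧ ∀ i < d, 1 ≤ digit (2 * n) c i ∧ digit (2 * n) c i ≤ n then
    cutBox d n (digit (2 * n) c) else 0

theorem cutArray_vertexCode (hn : 1 ≤ n) (u : Fin d → Fin n) :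
    cutArray d n (vertexCode u) = cutBox d n (coords u) := by
  rw [cutArray, digit_vertexCode hn, if_pos ⟨vertexCode_lt hn u, coords_bounds u⟩]

theorem exists_of_cutArray_ne_zero {c : ℕ} (h : cutArray d n c ≠ 0) :
    ∃ u : Fin d → Fin n, vertexCode u = c := by
  unfold cutArray at h
  split_ifs at h with h1
  · exact exists_vertexCode_eq h1.1 h1.2
  · exact absurd rfl h

theorem cutArray_lt (hd : 0 < d) (hn : 0 < n) (c : ℕ) : cutArray d n c < (2 * n) ^ d := by
  unfold cutArray
  split_ifs
  · exact cutBox_lt hd hn _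
  · exact pow_pos (by omega) _

open Classical in
/-- The vertices that are still to be removed from box `q`, which is reached in `t` steps: the
vertices inside its two halves, and those on the cut with number at least `v`. -/
noncomputable def boxRest (d n t q v : ℕ) : Finset (Fin d → Fin n) :=
  univ.filter fun u => boxAt d n (coords u) t = q ∧
    (t < cutTime d n (coords u) ∨ cutTime d n (coords u) = t ∧ v ≤ vertexCode u)

open Classical in
/-- The vertices on the cut of box `q`, which is reached in `t` steps, with number at least `v`. -/
noncomputable def cutRest (d n t q v : ℕ) : Finset (Fin d → Fin n) :=
  univ.filter fun u => boxAt d n (coords u) t = q ∧ cutTime d n (coords u) = t ∧ v ≤ vertexCode u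

theorem mem_boxRest {t q v : ℕ} {u : Fin d → Fin n} : u ∈ boxRest d n t q v ↔
    boxAt d n (coords u) t = q ∧
      (t < cutTime d n (coords u) ∨ cutTime d n (coords u) = t ∧ v ≤ vertexCode u) := by
  simp [boxRest]

theorem mem_cutRest {t q v : ℕ} {u : Fin d → Fin n} : u ∈ cutRest d n t q v ↔
    boxAt d n (coords u) t = q ∧ cutTime d n (coords u) = t ∧ v ≤ vertexCode u := by
  simp [cutRest]

theorem boxRest_root : boxRest d n 0 1 0 = univ := by
  ext u
  simp only [mem_boxRest, mem_univ, iff_true, boxAt, true_and]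
  omega

/-- The number of a box determines its level. -/
theorem cutTime_eq_of_cutBox {x : ℕ → ℕ} {t q : ℕ} (h : cutBox d n x = q) (h1 : 2 ^ t ≤ q)
    (h2 : q < 2 ^ (t + 1)) : cutTime d n x = t := by
  have h3 := two_pow_le_boxAt (d := d) (n := n) x (cutTime d n x)
  have h4 := boxAt_lt (d := d) (n := n) x (cutTime d n x)
  rw [← cutBox, h] at h3 h4
  have h5 := (Nat.pow_lt_pow_iff_right (by norm_num : 1 < 2)).mp (h3.trans_lt h2)
  have h6 := (Nat.pow_lt_pow_iff_right (by norm_num : 1 < 2)).mp (h1.trans_lt h4)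
  omega

/-- After the vertices on the cut, the two halves remain. -/
theorem boxRest_end (hn : 1 ≤ n) (t q : ℕ) :
    boxRest d n t q ((2 * n) ^ d) =
      boxRest d n (t + 1) (2 * q) 0 ∪ boxRest d n (t + 1) (2 * q + 1) 0 := by
  ext u
  have hlt := vertexCode_lt hn u
  simp only [mem_union, mem_boxRest, boxAt]
  omega

/-- No vertex is removed from a box with number at least `(2 * n) ^ d` or from its descendants. -/
theorem boxRest_end_of_le (hd : 0 < d) (hn : 1 ≤ n) {t q : ℕ} (hq : (2 * n) ^ d ≤ q) :
    boxRest d n t q ((2 * n) ^ d) = ∅ := by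
  ext u
  have hlt := vertexCode_lt hn u
  simp only [mem_boxRest, notMem_empty, iff_false]
  rintro ⟨h1, h2⟩
  have h3 := cutBox_lt hd hn (coords u)
  have h4 : boxAt d n (coords u) t ≤ cutBox d n (coords u) := boxAt_mono _ (by omega)
  omega

theorem boxRest_succ_of_ne (hn : 1 ≤ n) {t q v : ℕ} (h : cutArray d n v ≠ q) :
    boxRest d n t q v = boxRest d n t q (v + 1) := by
  ext u
  simp only [mem_boxRest]
  by_cases hu : vertexCode u = v
  · have h1 := cutArray_vertexCode hn u
    rw [hu] at h1
    constructor
    · rintro ⟨h2, h3 | ⟨h3, h4⟩⟩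
      · exact ⟨h2, Or.inl h3⟩
      · exfalso
        apply h
        rw [h1, cutBox, h3, h2]
    · rintro ⟨h2, h3 | ⟨h3, h4⟩⟩
      · exact ⟨h2, Or.inl h3⟩
      · omega
  · have : v ≤ vertexCode u ↔ v + 1 ≤ vertexCode u := by omega
    rw [this]

open Classical in
theorem boxRest_succ_of_eq (hn : 1 ≤ n) {t q : ℕ} {u : Fin d → Fin n}
    (h : cutBox d n (coords u) = q) (h1 : 2 ^ t ≤ q) (h2 : q < 2 ^ (t + 1)) :
    boxRest d n t q (vertexCode u) = insert u (boxRest d n t q (vertexCode u + 1)) := by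
  have ht := cutTime_eq_of_cutBox h h1 h2
  ext w
  simp only [mem_boxRest, mem_insert]
  by_cases hw : w = u
  · subst hw
    rw [cutBox, ht] at h
    simp [h, ht]
  · have : vertexCode w ≠ vertexCode u := fun e => hw (vertexCode_injective hn e)
    have h3 : vertexCode u ≤ vertexCode w ↔ vertexCode u + 1 ≤ vertexCode w := by omega
    simp only [hw, false_or, h3]

open Classical in
theorem cutRest_succ_of_eq (hn : 1 ≤ n) {t q : ℕ} {u : Fin d → Fin n}
    (h : cutBox d n (coords u) = q) (h1 : 2 ^ t ≤ q) (h2 : q < 2 ^ (t + 1)) :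
    (cutRest d n t q (vertexCode u)).card = (cutRest d n t q (vertexCode u + 1)).card + 1 := by
  have ht := cutTime_eq_of_cutBox h h1 h2
  have : cutRest d n t q (vertexCode u) = insert u (cutRest d n t q (vertexCode u + 1)) := by
    ext w
    simp only [mem_cutRest, mem_insert]
    by_cases hw : w = u
    · subst hw
      rw [cutBox, ht] at h
      simp [h, ht]
    · have : vertexCode w ≠ vertexCode u := fun e => hw (vertexCode_injective hn e)
      have h3 : vertexCode u ≤ vertexCode w ↔ vertexCode u + 1 ≤ vertexCode w := by omega
      simp only [hw, false_or, h3]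
  rw [this, card_insert_of_notMem]
  simp [mem_cutRest]

theorem card_cutRest_mono {t q v v' : ℕ} (h : v ≤ v') :
    (cutRest d n t q v').card ≤ (cutRest d n t q v).card := by
  refine card_le_card fun u hu => ?_
  rw [mem_cutRest] at hu ⊢
  exact ⟨hu.1, hu.2.1, h.trans hu.2.2⟩

theorem card_cutRest_le (hd : 0 < d) (t q v : ℕ) : (cutRest d n t q v).card ≤ cutSize d n t :=
  card_cut_le hd t q _ fun _ hu => ⟨(mem_cutRest.mp hu).2.1, (mem_cutRest.mp hu).1⟩

theorem disjoint_boxRest {t q q' v v' : ℕ} (h : q ≠ q') :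
    Disjoint (boxRest d n t q v) (boxRest d n t q' v') := by
  rw [disjoint_left]
  intro u hu hu'
  rw [mem_boxRest] at hu hu'
  exact h (hu.1.symm.trans hu'.1)

/-- There are no edges between different boxes. -/
theorem not_adj_boxRest {t q q' v v' : ℕ} (h : q ≠ q') {u w : Fin d → Fin n}
    (hu : u ∈ boxRest d n t q v) (hw : w ∈ boxRest d n t q' v') : ¬ (gridGraph d n).Adj u w := by
  rw [mem_boxRest] at hu hw
  have key : ∀ u w : Fin d → Fin n, t ≤ cutTime d n (coords u) →
      (∃ i : Fin d, (u i : ℕ) + 1 = w i ∧ ∀ j, j ≠ i → u j = w j) →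
      boxAt d n (coords u) t = boxAt d n (coords w) t := by
    rintro u w ht ⟨i, hi, hj⟩
    refine boxAt_eq_of_succ (i := i) ?_ ?_ fun s hs => not_onCut_of_lt (by omega)
    · simp [coords, hi]
    · intro j hji
      by_cases hjd : j < d
      · have := hj ⟨j, hjd⟩ (fun e => hji (congrArg Fin.val e))
        simp only [coords, hjd, dif_pos, this]
      · simp [coords, hjd]
  rintro ⟨i, hi | hi, hj⟩
  · have := key u w (by omega) ⟨i, hi, hj⟩
    exact h (by rw [← hu.1, ← hw.1, this])
  · have := key w u (by omega) ⟨i, hi, fun j hji => (hj j hji).symm⟩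
    exact h (by rw [← hu.1, ← hw.1, this])

end Encoding

/-! ### The program for the recursion -/

namespace RAM

instance : Add Ex := ⟨Ex.bin .add⟩
instance : Sub Ex := ⟨Ex.bin .sub⟩
instance : Mul Ex := ⟨Ex.bin .mul⟩
instance : Div Ex := ⟨Ex.bin .div⟩

/-- The remainder of a division. -/
def Ex.mod (a b : Ex) : Ex := a - a / b * b

@[simp] theorem Ex.val_lit (c : ℕ) (s : Store) : (Ex.lit c).val s = c := rfl
@[simp] theorem Ex.val_var (x : ℕ) (s : Store) : (Ex.var x).val s = s.v x := rfl
@[simp] theorem Ex.val_get (k : Fin 4) (i : Ex) (s : Store) :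
    (Ex.get k i).val s = s.a k (i.val s) := rfl
@[simp] theorem Ex.val_add (a b : Ex) (s : Store) : (a + b).val s = a.val s + b.val s := rfl
@[simp] theorem Ex.val_sub (a b : Ex) (s : Store) : (a - b).val s = a.val s - b.val s := rfl
@[simp] theorem Ex.val_mul (a b : Ex) (s : Store) : (a * b).val s = a.val s * b.val s := rfl
@[simp] theorem Ex.val_div (a b : Ex) (s : Store) : (a / b).val s = a.val s / b.val s := rfl
@[simp] theorem Ex.val_mod (a b : Ex) (s : Store) : (a.mod b).val s = a.val s % b.val s :=
  (Nat.mod_eq_sub_div_mul ..).symm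

local infixr:30 " ;; " => Com.seq

/-! The variables:
* `xd`, `xn`: the dimension and the side length; at the end `xd` holds the result;
* `xb`, `xK`, `xN`: the base `2 * n` for the numbers of vertices, the number `(2 * n) ^ d` of all
  numbers with `d` digits, the number `n ^ d` of vertices;
* `xB`, `xM`: the argument of the edge cover polynomial, the modulus;
* `xq`, `xv`, `xup`: the current box, the current number of a vertex, the direction of the
  recursion;
* `xr`: the value that the recursion has computed last;
* `xgo`: the control variable of loops without a counter; `xi`: the counter of the others;
* `xc`: the condition of a branching;
* `xw`, `xp`, `xh`, `xg`, `xx`, `xok`: auxiliary variables.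

The arrays:
* `aCut`: for each vertex the box whose bisection removes it, see `cutArray`;
* `aMark`: the value `B` for chosen vertices, see `marks`;
* `aFst`: for each decided vertex, the weighted value without this vertex;
* `aLeft`: for each left half of a box on the current path, its value. -/

local notation "xd" => (0 : ℕ)
local notation "xn" => (1 : ℕ)
local notation "xb" => (2 : ℕ)
local notation "xK" => (3 : ℕ)
local notation "xN" => (4 : ℕ)
local notation "xB" => (5 : ℕ)
local notation "xM" => (6 : ℕ)
local notation "xq" => (7 : ℕ)
local notation "xv" => (8 : ℕ)
local notation "xup" => (9 : ℕ)
local notation "xr" => (10 : ℕ)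
local notation "xgo" => (11 : ℕ)
local notation "xc" => (12 : ℕ)
local notation "xw" => (13 : ℕ)
local notation "xp" => (14 : ℕ)
local notation "xi" => (15 : ℕ)
local notation "xh" => (16 : ℕ)
local notation "xg" => (17 : ℕ)
local notation "xx" => (18 : ℕ)
local notation "xok" => (19 : ℕ)
local notation "aCut" => (0 : Fin 4)
local notation "aMark" => (1 : Fin 4)
local notation "aFst" => (2 : Fin 4)
local notation "aLeft" => (3 : Fin 4)

open Ex Com

/-- Going down in the recursion: to the next number of a vertex, then to the left half of the
box. -/
def downCom : Com :=
  set xc (var xK - var xv) ;;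
  ite xc (set xv (var xv + lit 1))
    (set xc (var xK - var xq) ;;
     ite xc (set xq (lit 2 * var xq) ;; set xv (lit 0)) (set xr (lit 1) ;; set xup (lit 1)))

/-- Multiplication by the weights of the edges in one direction. -/
def edgeCom : Com :=
  set xw (var xw * ((lit 1 + get aMark (var xv + var xp)) *
    (lit 1 + get aMark (var xv - var xp)))) ;;
  set xp (var xp * var xb) ;;
  set xi (var xi - lit 1)

/-- The product of the weights of the edges from the current vertex to chosen vertices. -/
def weightCom : Com :=
  (set xw (lit 1) ;; set xp (lit 1) ;; set xi (var xd)) ;; loop xi edgeCom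

/-- The sum of the values without and with the current vertex, which is unmarked again. -/
def sumCom : Com := set xr (get aFst (var xv) + var xw * var xr) ;; put aMark (var xv) (lit 0)

/-- Both values for the rest of the recursion, without and with the current vertex, are known. -/
def secondCom : Com :=
  weightCom ;; sumCom

/-- The value for the rest of the recursion without the current vertex is known; the rest is to be
evaluated again, with this vertex. -/
def firstCom : Com :=
  put aFst (var xv) ((var xM - lit 1) * var xr) ;;
  put aMark (var xv) (var xB) ;;
  set xv (var xv + lit 1) ;;
  set xup (lit 0)

/-- Return from a box to the box of which it is one half. -/
def returnCom : Com :=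
  set xc (var xq - lit 1) ;;
  ite xc
    (set xc (Ex.mod (var xq) (lit 2)) ;;
     ite xc
      (set xr (get aLeft (var xq - lit 1) * var xr) ;;
       set xq (var xq / lit 2) ;;
       set xv (var xK))
      (put aLeft (var xq) (var xr) ;;
       set xq (var xq + lit 1) ;;
       set xup (lit 0)))
    (set xgo (lit 0))

/-- Back to the number before, with a test whether it belongs to a vertex on the cut. -/
def testCom : Com :=
  set xv (var xv - lit 1) ;;
  set xc ((get aCut (var xv) - var xq) + (var xq - get aCut (var xv)))

/-- The mark of the current vertex. -/
def readCom : Com := set xc (get aMark (var xv))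

/-- Going up in the recursion. -/
def upCom : Com :=
  ite xv (testCom ;; ite xc skip (readCom ;; ite xc secondCom firstCom)) returnCom

/-- One step of the recursion. -/
def stepCom : Com := ite xup upCom downCom

/-- The argument at which the edge cover polynomial is evaluated. It exceeds the number of all sets
of edges, since there are at most `d * n ^ d` edges. -/
def gridB (d n : ℕ) : ℕ := 2 ^ (d * n ^ d + 1)

/-- The modulus for the evaluation of the edge cover polynomial. It exceeds
`(1 + gridB d n) ^ |E|`, which bounds the value. -/
def gridM (d n : ℕ) : ℕ := (1 + gridB d n) ^ (d * n ^ d + 1)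

/-- Bounds `X` for indices and `V` for values that leave enough room for the computation on a grid
of side length at least `2`. There are `20` variables, the boxes are numbered below
`2 * (2 * n) ^ d`, and the power of the modulus bounds the values of the recursion. -/
structure Room (d n X V : ℕ) : Prop where
  two_le_d : 2 ≤ d
  two_le_n : 2 ≤ n
  index : 2 * (2 * n) ^ d + 20 ≤ X
  power : gridM d n ^ (2 * n ^ d + 2) ≤ V
  small : 4 * (2 * n) ^ d * (2 * n) ^ d + d * n ^ d + 10 ≤ V

section

variable {d n X V : ℕ}

theorem two_le_gridB : 2 ≤ gridB d n := by
  unfold gridB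
  calc 2 = 2 ^ 1 := rfl
    _ ≤ _ := Nat.pow_le_pow_right (by norm_num) (by omega)

theorem gridB_lt_gridM : gridB d n < gridM d n := by
  unfold gridM
  calc gridB d n < (1 + gridB d n) ^ 1 := by rw [pow_one]; omega
    _ ≤ _ := Nat.pow_le_pow_right (by omega) (by omega)

theorem Room.gridM_le (h : Room d n X V) : gridM d n ≤ V := by
  refine le_trans ?_ h.power
  have := two_le_gridB (d := d) (n := n)
  have := gridB_lt_gridM (d := d) (n := n)
  calc gridM d n = gridM d n ^ 1 := (pow_one _).symm
    _ ≤ _ := Nat.pow_le_pow_right (by omega) (by omega)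

theorem Room.base_le (h : Room d n X V) : 2 * n ≤ (2 * n) ^ d := by
  have := h.two_le_d
  have := h.two_le_n
  calc 2 * n = (2 * n) ^ 1 := (pow_one _).symm
    _ ≤ _ := Nat.pow_le_pow_right (by omega) (by omega)

theorem pow_le_two_mul_pow : n ^ d ≤ (2 * n) ^ d :=
  Nat.pow_le_pow_left (by omega) d

theorem Room.eight_mul_le (h : Room d n X V) : 8 * (2 * n) ^ d + d * n ^ d + 10 ≤ V := by
  have h1 := h.small
  have h2 := h.base_le
  have h3 := h.two_le_n
  have h4 : 4 * (2 * n) ^ d * 2 ≤ 4 * (2 * n) ^ d * (2 * n) ^ d :=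
    Nat.mul_le_mul_left _ (by omega)
  omega

theorem Room.d_le (h : Room d n X V) : 2 * d ≤ d * n ^ d := by
  have h1 : 2 ≤ n ^ d := by
    have := h.two_le_d
    have := h.two_le_n
    calc 2 ≤ n ^ 1 := by rw [pow_one]; omega
      _ ≤ _ := Nat.pow_le_pow_right (by omega) (by omega)
  calc 2 * d = d * 2 := mul_comm _ _
    _ ≤ _ := Nat.mul_le_mul_left _ h1

/-- The variables that stay constant during the recursion have their proper values. -/
structure Consts (d n X V : ℕ) (s : Store) : Prop where
  vd : s.v xd = d
  vn : s.v xn = n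
  vb : s.v xb = 2 * n
  vK : s.v xK = (2 * n) ^ d
  vN : s.v xN = n ^ d
  vB : s.v xB = gridB d n
  vM : s.v xM = gridM d n
  within : s.Within X V

theorem Consts.set {s : Store} (h : Consts d n X V s) (hr : Room d n X V) {x e : ℕ} (hx : 7 ≤ x)
    (hx' : x < 20) (he : e ≤ V) : Consts d n X V (s.set x e) where
  vd := by rw [Store.set_v, if_neg (by omega)]; exact h.vd
  vn := by rw [Store.set_v, if_neg (by omega)]; exact h.vn
  vb := by rw [Store.set_v, if_neg (by omega)]; exact h.vb
  vK := by rw [Store.set_v, if_neg (by omega)]; exact h.vK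
  vN := by rw [Store.set_v, if_neg (by omega)]; exact h.vN
  vB := by rw [Store.set_v, if_neg (by omega)]; exact h.vB
  vM := by rw [Store.set_v, if_neg (by omega)]; exact h.vM
  within := h.within.set (by have := hr.index; omega) he

theorem Consts.put {s : Store} (h : Consts d n X V s) {k : Fin 4} {i e : ℕ} (hi : i < X)
    (he : e ≤ V) : Consts d n X V (s.put k i e) where
  vd := h.vd
  vn := h.vn
  vb := h.vb
  vK := h.vK
  vN := h.vN
  vB := h.vB
  vM := h.vM
  within := h.within.put hi he

/-- The variables from `7` to `11`, which hold the state of the recursion, are preserved. -/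
theorem runs_weightCom (hr : Room d n X V) {s : Store} (h : Consts d n X V s)
    (hm : ∀ c, s.a aMark c ≤ gridB d n) :
    ∃ s', Runs X V weightCom s s' (2 * d + 2) ∧ Consts d n X V s' ∧
      s'.v xw = ∏ i ∈ Finset.range d, ((1 + s.a aMark (s.v xv + (2 * n) ^ i)) *
        (1 + s.a aMark (s.v xv - (2 * n) ^ i))) ∧ s'.a = s.a ∧
      (∀ x, 7 ≤ x → x ≤ 11 → s'.v x = s.v x) := by
  have h8 := hr.eight_mul_le
  have hd := hr.d_le
  have hM := hr.gridM_le
  set W : ℕ → ℕ := fun j => ∏ i ∈ Finset.range j, ((1 + s.a aMark (s.v xv + (2 * n) ^ i)) *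
        (1 + s.a aMark (s.v xv - (2 * n) ^ i))) with hW
  have hWle : ∀ j ≤ d, W j ≤ V := by
    intro j hj
    refine le_trans ?_ hM
    calc W j ≤ ∏ i ∈ Finset.range j, ((1 + gridB d n) * (1 + gridB d n)) :=
          Finset.prod_le_prod' fun i _ => Nat.mul_le_mul
            (by have := hm (s.v xv + (2 * n) ^ i); omega)
            (by have := hm (s.v xv - (2 * n) ^ i); omega)
      _ = (1 + gridB d n) ^ (2 * j) := by
          rw [Finset.prod_const, Finset.card_range, ← sq, ← pow_mul]
      _ ≤ _ := Nat.pow_le_pow_right (by omega) (by omega)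
  have hpow : ∀ j ≤ d, (2 * n) ^ j ≤ V := by
    intro j hj
    have := Nat.pow_le_pow_right (show 0 < 2 * n by have := hr.two_le_n; omega) hj
    omega
  let Inv : ℕ → Store → Prop := fun j s' => j ≤ d ∧ Consts d n X V s' ∧ s'.v xw = W j ∧
    s'.v xp = (2 * n) ^ j ∧ s'.v xi = d - j ∧ s'.a = s.a ∧
    (∀ x, 7 ≤ x → x ≤ 11 → s'.v x = s.v x)
  have hinit := Runs.base (X := X) (V := V)
    (p := set xw (lit 1) ;; set xp (lit 1) ;; set xi (var xd)) ⟨trivial, trivial, trivial⟩ h.within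
  set s₁ := Com.run (set xw (lit 1) ;; set xp (lit 1) ;; set xi (var xd)) s with hs₁
  have hI : Inv 0 s₁ := by
    refine ⟨by omega, ?_, ?_, ?_, ?_, ?_, ?_⟩
    · simp only [hs₁, Com.run, val_lit, val_var]
      refine ((h.set hr (by norm_num) (by norm_num) (by omega)).set hr (by norm_num) (by norm_num)
        (by omega)).set hr (by norm_num) (by norm_num) ?_
      simp [h.vd]; omega
    · simp [hs₁, Com.run, hW]
    · simp [hs₁, Com.run]
    · simp [hs₁, Com.run, h.vd]
    · simp [hs₁, Com.run]
    · intro x h1 h2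
      simp only [hs₁, Com.run, Store.set_v]
      rw [if_neg (by omega), if_neg (by omega), if_neg (by omega)]
  obtain ⟨s', h1, h2⟩ := Runs.loop_count (X := X) (V := V) (x := xi) (k := 1)
    (p := edgeCom) d Inv
    (fun _ _ h => h.2.1.within)
    (fun i s hi h => by rw [h.2.2.2.2.1]; omega)
    (fun s h => by rw [h.2.2.2.2.1]; omega)
    (by
      rintro j t hj ⟨-, hc, hw, hp, hi, ha, hv⟩
      refine ⟨_, Runs.base (p := edgeCom) ⟨trivial, trivial, trivial⟩ hc.within, by omega,
        ?_, ?_, ?_, ?_, ?_, ?_⟩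
      · have e1 := hWle (j + 1) (by omega)
        have e2 := hpow (j + 1) (by omega)
        rw [hW] at e1
        simp only [Finset.prod_range_succ] at e1
        rw [pow_succ] at e2
        simp only [edgeCom, Com.run]
        refine ((hc.set hr (by norm_num) (by norm_num) ?_).set hr (by norm_num) (by norm_num)
          ?_).set hr (by norm_num) (by norm_num) ?_
        · simp only [val_mul, val_add, val_sub, val_lit, val_get, val_var, hw, hp, ha,
            hv xv (by norm_num) (by norm_num)]
          exact e1
        · simp [hp, hc.vb]
          exact e2
        · simp [hi]; omega
      · simp only [edgeCom, Com.run, Store.set_v, val_mul, val_add, val_sub, val_lit, val_get,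
          val_var, hw, hp,
          ha, hv xv (by norm_num) (by norm_num)]
        simp [hW, Finset.prod_range_succ]
      · simp [edgeCom, Com.run, hp, hc.vb, pow_succ]
      · simp [edgeCom, Com.run, hi]; omega
      · simp [edgeCom, Com.run, ha]
      · intro x h1 h2
        simp only [edgeCom, Com.run, Store.set_v]
        rw [if_neg (by omega), if_neg (by omega), if_neg (by omega)]
        exact hv x h1 h2) hI
  obtain ⟨-, hc, hw, -, -, ha, hv⟩ := h2
  exact ⟨s', (Runs.seq hinit h1).mono (by omega), hc, hw, ha, hv⟩

end

/-! ### Single steps of the recursion -/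

open Classical

section

variable {d n X V : ℕ}

/-- The state of the recursion at number `v` in box `q`, with the set `A` of chosen vertices; the
flag `up` tells whether the value of the rest of the recursion has been computed. -/
structure EvalInv (d n X V : ℕ) (s : Store) (q v up : ℕ) (A : Finset (Fin d → Fin n)) : Prop
    extends Consts d n X V s where
  vq : s.v xq = q
  vv : s.v xv = v
  vup : s.v xup = up
  vgo : s.v xgo = 1
  cut : ∀ c, s.a aCut c = cutArray d n c
  mark : ∀ c, s.a aMark c = marks (gridB d n) A c

namespace EvalInv

variable {s : Store} {q v up : ℕ} {A : Finset (Fin d → Fin n)}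

theorem set (h : EvalInv d n X V s q v up A) (hr : Room d n X V) {x e : ℕ} (hx : x = 10 ∨ 12 ≤ x)
    (hx' : x < 20) (he : e ≤ V) : EvalInv d n X V (s.set x e) q v up A where
  toConsts := h.toConsts.set hr (by omega) hx' he
  vq := by rw [Store.set_v, if_neg (by omega)]; exact h.vq
  vv := by rw [Store.set_v, if_neg (by omega)]; exact h.vv
  vup := by rw [Store.set_v, if_neg (by omega)]; exact h.vup
  vgo := by rw [Store.set_v, if_neg (by omega)]; exact h.vgo
  cut := h.cut
  mark := h.mark

theorem set_q (h : EvalInv d n X V s q v up A) (hr : Room d n X V) {e : ℕ} (he : e ≤ V) :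
    EvalInv d n X V (s.set xq e) e v up A where
  toConsts := h.toConsts.set hr (by norm_num) (by norm_num) he
  vq := by simp
  vv := by simp [h.vv]
  vup := by simp [h.vup]
  vgo := by simp [h.vgo]
  cut := h.cut
  mark := h.mark

theorem set_v (h : EvalInv d n X V s q v up A) (hr : Room d n X V) {e : ℕ} (he : e ≤ V) :
    EvalInv d n X V (s.set xv e) q e up A where
  toConsts := h.toConsts.set hr (by norm_num) (by norm_num) he
  vq := by simp [h.vq]
  vv := by simp
  vup := by simp [h.vup]
  vgo := by simp [h.vgo]
  cut := h.cut
  mark := h.mark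

theorem set_up (h : EvalInv d n X V s q v up A) (hr : Room d n X V) {e : ℕ} (he : e ≤ V) :
    EvalInv d n X V (s.set xup e) q v e A where
  toConsts := h.toConsts.set hr (by norm_num) (by norm_num) he
  vq := by simp [h.vq]
  vv := by simp [h.vv]
  vup := by simp
  vgo := by simp [h.vgo]
  cut := h.cut
  mark := h.mark

theorem put (h : EvalInv d n X V s q v up A) {k : Fin 4} (hk : k ≠ 0) (hk' : k ≠ 1) {i e : ℕ}
    (hi : i < X) (he : e ≤ V) : EvalInv d n X V (s.put k i e) q v up A where
  toConsts := h.toConsts.put hi he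
  vq := h.vq
  vv := h.vv
  vup := h.vup
  vgo := h.vgo
  cut c := by rw [Store.put_a, if_neg (fun hh => hk hh.1.symm)]; exact h.cut c
  mark c := by rw [Store.put_a, if_neg (fun hh => hk' hh.1.symm)]; exact h.mark c

theorem put_mark (h : EvalInv d n X V s q v up A) {i e : ℕ} (hi : i < X) (he : e ≤ V)
    {A' : Finset (Fin d → Fin n)}
    (hA : ∀ c, marks (gridB d n) A' c = if c = i then e else marks (gridB d n) A c) :
    EvalInv d n X V (s.put aMark i e) q v up A' where
  toConsts := h.toConsts.put hi he
  vq := h.vq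
  vv := h.vv
  vup := h.vup
  vgo := h.vgo
  cut c := by rw [Store.put_a, if_neg (by simp)]; exact h.cut c
  mark c := by
    rw [Store.put_a, hA c]
    by_cases hc : c = i <;> simp [hc, h.mark]

end EvalInv

/-- The main loop gets from store `s` to store `s'` with cost at most `k`: every way to finish the
loop from `s'` gives a way to finish it from `s`. -/
def Reach (X V : ℕ) (s s' : Store) (k : ℕ) : Prop :=
  ∀ s₂ k₂, Runs X V (loop xgo stepCom) s' s₂ k₂ → Runs X V (loop xgo stepCom) s s₂ (k + k₂)

theorem Reach.trans {s s' s'' : Store} {k k' : ℕ} (h : Reach X V s s' k)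
    (h' : Reach X V s' s'' k') :
    Reach X V s s'' (k + k') := fun s₂ k₂ hr => by
  rw [add_assoc]
  exact h _ _ (h' _ _ hr)

theorem Reach.mono {s s' : Store} {k k' : ℕ} (h : Reach X V s s' k) (hk : k ≤ k') :
    Reach X V s s' k' := fun s₂ k₂ hr => (h s₂ k₂ hr).mono (by omega)

/-- A bound for the cost of one step of the recursion. -/
def stepCost (d : ℕ) : ℕ := 2 * d + 12

theorem EvalInv.reach {s s' : Store} {q v up k : ℕ} {A : Finset (Fin d → Fin n)}
    (h : EvalInv d n X V s q v up A) (hk : k + 1 ≤ stepCost d) (hs : Runs X V stepCom s s' k) :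
    Reach X V s s' (stepCost d) := fun s₂ k₂ hr =>
  (Runs.loop_step h.within (by rw [h.vgo]; norm_num) hs hr).mono (by omega)

theorem loopFree_downCom : downCom.LoopFree := by simp [downCom, Com.LoopFree]

theorem loopFree_returnCom : returnCom.LoopFree := by simp [returnCom, Com.LoopFree]

theorem loopFree_firstCom : firstCom.LoopFree := by simp [firstCom, Com.LoopFree]

variable {s : Store} {q v : ℕ} {A : Finset (Fin d → Fin n)}

theorem EvalInv.down (h : EvalInv d n X V s q v 0 A) : Reach X V s (downCom.run s) (stepCost d) :=
  h.reach (k := 2) (by unfold stepCost; omega)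
    (Runs.ite_zero h.within h.vup (Runs.base loopFree_downCom h.within))

theorem EvalInv.down_next (hr : Room d n X V) (h : EvalInv d n X V s q v 0 A)
    (hv : v < (2 * n) ^ d) : ∃ s', Reach X V s s' (stepCost d) ∧
      EvalInv d n X V s' q (v + 1) 0 A ∧ s'.a = s.a := by
  have h8 := hr.eight_mul_le
  refine ⟨_, h.down, ?_⟩
  have e : downCom.run s = (s.set xc ((2 * n) ^ d - v)).set xv (v + 1) := by
    have : (2 * n) ^ d - v ≠ 0 := by omega
    simp only [downCom, Com.run, val_sub, val_var, h.vK, h.vv, Store.set_v, val_add, val_lit]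
    simp [this]
  rw [e]
  exact ⟨(h.set hr (by norm_num) (by norm_num) (by omega)).set_v hr (by omega), rfl⟩

theorem EvalInv.down_child (hr : Room d n X V) (h : EvalInv d n X V s q ((2 * n) ^ d) 0 A)
    (hq : q < (2 * n) ^ d) : ∃ s', Reach X V s s' (stepCost d) ∧
      EvalInv d n X V s' (2 * q) 0 0 A ∧ s'.a = s.a := by
  have h8 := hr.eight_mul_le
  refine ⟨_, h.down, ?_⟩
  have e : downCom.run s =
      (((s.set xc 0).set xc ((2 * n) ^ d - q)).set xq (2 * q)).set xv 0 := by
    have : (2 * n) ^ d - q ≠ 0 := by omega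
    simp only [downCom, Com.run, val_sub, val_var, h.vK, h.vv, Store.set_v, val_add, val_lit]
    simp [this, h.vq]
  rw [e]
  exact ⟨((((h.set hr (by norm_num) (by norm_num) (by omega)).set hr (by norm_num) (by norm_num)
    (by omega)).set_q hr (by omega)).set_v hr (by omega)), rfl⟩

theorem EvalInv.down_leaf (hr : Room d n X V) (h : EvalInv d n X V s q ((2 * n) ^ d) 0 A)
    (hq : (2 * n) ^ d ≤ q) : ∃ s', Reach X V s s' (stepCost d) ∧
      EvalInv d n X V s' q ((2 * n) ^ d) 1 A ∧ s'.v xr = 1 ∧ s'.a = s.a := by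
  have h8 := hr.eight_mul_le
  refine ⟨_, h.down, ?_⟩
  have e : downCom.run s = (((s.set xc 0).set xc 0).set xr 1).set xup 1 := by
    have : (2 * n) ^ d - q = 0 := by omega
    simp only [downCom, Com.run, val_sub, val_var, h.vK, h.vv, Store.set_v, val_add, val_lit]
    simp [this, h.vq]
  rw [e]
  exact ⟨((((h.set hr (by norm_num) (by norm_num) (by omega)).set hr (by norm_num) (by norm_num)
    (by omega)).set hr (by norm_num) (by norm_num) (by omega)).set_up hr (by omega)), by simp, rfl⟩

/-- The comparison at the beginning of a step upwards to number `v`. -/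
theorem EvalInv.up_test (hr : Room d n X V) (h : EvalInv d n X V s q (v + 1) 1 A) (hq : q ≤ V) :
    ∃ s', Runs X V testCom s s' 1 ∧
      EvalInv d n X V s' q v 1 A ∧ s'.a = s.a ∧ s'.v xr = s.v xr ∧
      (s'.v xc = 0 ↔ cutArray d n v = q) := by
  have h8 := hr.eight_mul_le
  have hv : v + 1 ≤ V := by rw [← h.vv]; exact h.within.var_le _
  have hc := cutArray_lt (d := d) (n := n) (by have := hr.two_le_d; omega)
    (by have := hr.two_le_n; omega) v
  refine ⟨_, Runs.base (p := testCom) ⟨trivial, trivial⟩ h.within, ?_⟩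
  have e : testCom.run s =
      (s.set xv v).set xc ((cutArray d n v - q) + (q - cutArray d n v)) := by
    simp only [testCom, Com.run, val_sub, val_var, h.vv, Store.set_v, val_add, val_lit]
    simp [h.vq, h.cut]
  rw [e]
  refine ⟨(h.set_v hr (by omega)).set hr (by norm_num) (by norm_num) (by omega), rfl, by simp, ?_⟩
  simp only [Store.set_v, if_true]
  omega

/-- A number that does not belong to a vertex on the cut of the current box. -/
theorem EvalInv.up_skip (hr : Room d n X V) (h : EvalInv d n X V s q (v + 1) 1 A) (hq : q ≤ V)
    (hc : cutArray d n v ≠ q) : ∃ s', Reach X V s s' (stepCost d) ∧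
      EvalInv d n X V s' q v 1 A ∧ s'.v xr = s.v xr ∧ s'.a = s.a := by
  obtain ⟨s₁, h1, h2, h3, h4, h5⟩ := h.up_test hr hq
  refine ⟨s₁, h.reach (k := 5) (by unfold stepCost; omega) ?_, h2, h4, h3⟩
  refine Runs.ite_pos h.within (by rw [h.vup]; norm_num) ?_
  refine (Runs.ite_pos h.within (by rw [h.vv]; omega) ?_ : Runs X V _ s s₁ 4)
  refine (Runs.seq h1 ?_ : Runs X V _ s s₁ (1 + 2))
  exact Runs.ite_pos h2.within (fun e => hc (h5.mp e)) (Runs.base (p := skip) trivial h2.within)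

theorem marks_insert {u : Fin d → Fin n} (B : ℕ) (c : ℕ) :
    marks B (insert u A) c = if c = vertexCode u then B else marks B A c := by
  unfold marks
  by_cases hc : c = vertexCode u
  · rw [if_pos hc, if_pos ⟨u, Finset.mem_insert_self _ _, hc.symm⟩]
  · rw [if_neg hc]
    congr 1
    simp only [Finset.mem_insert, eq_iff_iff]
    constructor
    · rintro ⟨w, rfl | hw, h⟩
      · exact absurd h.symm hc
      · exact ⟨w, hw, h⟩
    · rintro ⟨w, hw, h⟩
      exact ⟨w, Or.inr hw, h⟩

theorem marks_of_notMem (hn : 1 ≤ n) {u : Fin d → Fin n} (hu : u ∉ A) (B : ℕ) :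
    marks B A (vertexCode u) = 0 := by
  unfold marks
  rw [if_neg]
  rintro ⟨w, hw, h⟩
  exact hu (vertexCode_injective hn h ▸ hw)

/-- The value without the vertex `u` has been computed. It is stored
with its weight, and the vertex is chosen. -/
theorem EvalInv.up_first (hr : Room d n X V) {u : Fin d → Fin n}
    (h : EvalInv d n X V s q (vertexCode u + 1) 1 A) (hq : q ≤ V)
    (hc : cutArray d n (vertexCode u) = q) (hu : u ∉ A) (hle : (gridM d n - 1) * s.v xr ≤ V) :
    ∃ s', Reach X V s s' (stepCost d) ∧
      EvalInv d n X V s' q (vertexCode u + 1) 0 (insert u A) ∧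
      s'.a aFst (vertexCode u) = (gridM d n - 1) * s.v xr ∧
      (∀ c, c ≠ vertexCode u → s'.a aFst c = s.a aFst c) ∧ s'.a aLeft = s.a aLeft := by
  have h8 := hr.eight_mul_le
  have hX := hr.index
  have hlt := vertexCode_lt (by have := hr.two_le_n; omega) u
  have hBM := gridB_lt_gridM (d := d) (n := n)
  have hMV := hr.gridM_le
  obtain ⟨s₁, h1, h2, h3, h4, h5⟩ := h.up_test hr hq
  have hmark : s₁.a aMark (vertexCode u) = 0 := by
    rw [h2.mark, marks_of_notMem (by have := hr.two_le_n; omega) hu]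
  set s₂ := s₁.set xc 0 with hs₂
  have h2' : EvalInv d n X V s₂ q (vertexCode u) 1 A :=
    h2.set hr (by norm_num) (by norm_num) (by omega)
  have hrun : Runs X V readCom s₁ s₂ 1 := by
    have := Runs.base (X := X) (V := V) (p := readCom) trivial h2.within
    simpa [readCom, Com.run, h2.vv, hmark] using this
  have e : firstCom.run s₂ = (((s₂.put aFst (vertexCode u) ((gridM d n - 1) * s.v xr)).put aMark
      (vertexCode u) (gridB d n)).set xv (vertexCode u + 1)).set xup 0 := by
    have : s₂.v xr = s.v xr := by simp [hs₂, h4]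
    simp only [firstCom, Com.run, val_sub, val_mul, val_var, val_lit, h2'.vv, h2'.vM, this,
      Store.put_v, h2'.vB, val_add]
  refine ⟨firstCom.run s₂, h.reach (k := 7) (by unfold stepCost; omega) ?_, ?_⟩
  · refine Runs.ite_pos h.within (by rw [h.vup]; norm_num) ?_
    refine (Runs.ite_pos h.within (by rw [h.vv]; omega) ?_ : Runs X V _ s _ 6)
    refine (Runs.seq h1 ?_ : Runs X V _ s _ (1 + 4))
    refine Runs.ite_zero h2.within (h5.mpr hc) ?_
    refine (Runs.seq hrun ?_ : Runs X V _ s₁ _ (1 + 2))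
    exact Runs.ite_zero h2'.within (by simp [hs₂]) (Runs.base loopFree_firstCom h2'.within)
  · rw [e]
    refine ⟨?_, ?_, ?_, ?_⟩
    · refine (((h2'.put (by simp) (by simp) (by omega) hle).put_mark (by omega) (by omega)
        fun c => ?_).set_v hr (by omega)).set_up hr (by omega)
      exact marks_insert _ c
    · simp [Store.put_a]
    · intro c hcc
      simp [Store.put_a, hcc, hs₂, h3]
    · funext c
      simp [Store.put_a, hs₂, h3]

/-- The value with the vertex `u` has been computed. Both values are added, and the vertex is no
longer chosen. -/
theorem EvalInv.up_second (hr : Room d n X V) {u : Fin d → Fin n}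
    (h : EvalInv d n X V s q (vertexCode u + 1) 1 (insert u A)) (hq : q ≤ V)
    (hc : cutArray d n (vertexCode u) = q) (hu : u ∉ A)
    (hle : s.a aFst (vertexCode u) +
      (1 + gridB d n) ^ nbrsIn (gridGraph d n) u A * s.v xr ≤ V) :
    ∃ s', Reach X V s s' (stepCost d) ∧ EvalInv d n X V s' q (vertexCode u) 1 A ∧
      s'.v xr = s.a aFst (vertexCode u) +
        (1 + gridB d n) ^ nbrsIn (gridGraph d n) u A * s.v xr ∧
      s'.a aFst = s.a aFst ∧ s'.a aLeft = s.a aLeft := by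
  have h8 := hr.eight_mul_le
  have hX := hr.index
  have hlt := vertexCode_lt (by have := hr.two_le_n; omega) u
  have hBM := gridB_lt_gridM (d := d) (n := n)
  have hMV := hr.gridM_le
  have hB2 := two_le_gridB (d := d) (n := n)
  obtain ⟨s₁, h1, h2, h3, h4, h5⟩ := h.up_test hr hq
  have hmark : s₁.a aMark (vertexCode u) = gridB d n := by
    rw [h2.mark, marks_insert, if_pos rfl]
  set s₂ := s₁.set xc (gridB d n) with hs₂
  have h2' : EvalInv d n X V s₂ q (vertexCode u) 1 (insert u A) :=
    h2.set hr (by norm_num) (by norm_num) (by omega)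
  have hrun : Runs X V readCom s₁ s₂ 1 := by
    have := Runs.base (X := X) (V := V) (p := readCom) trivial h2.within
    simpa [readCom, Com.run, h2.vv, hmark] using this
  obtain ⟨s₃, g1, g2, g3, g4, g5⟩ := runs_weightCom hr h2'.toConsts (fun c => by
    rw [h2'.mark, marks]
    split_ifs <;> omega)
  have hw : s₃.v xw = (1 + gridB d n) ^ nbrsIn (gridGraph d n) u A := by
    rw [g3]
    simp only [h2'.mark, h2'.vv]
    rw [prod_marks hr.two_le_n]
    congr 1
    unfold nbrsIn
    rw [Finset.filter_insert, if_neg ((gridGraph d n).loopless.irrefl u)]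
  have i3 : EvalInv d n X V s₃ q (vertexCode u) 1 (insert u A) :=
    { toConsts := g2
      vq := (g5 _ (by norm_num) (by norm_num)).trans h2'.vq
      vv := (g5 _ (by norm_num) (by norm_num)).trans h2'.vv
      vup := (g5 _ (by norm_num) (by norm_num)).trans h2'.vup
      vgo := (g5 _ (by norm_num) (by norm_num)).trans h2'.vgo
      cut := fun c => by rw [g4]; exact h2'.cut c
      mark := fun c => by rw [g4]; exact h2'.mark c }
  have ha : s₃.a = s.a := by rw [g4, hs₂, Store.set_a, h3]
  have hrr : s₃.v xr = s.v xr := by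
    rw [g5 _ (by norm_num) (by norm_num)]
    simp [hs₂, h4]
  set s₄ := (s₃.set xr (s.a aFst (vertexCode u) +
      (1 + gridB d n) ^ nbrsIn (gridGraph d n) u A * s.v xr)).put aMark (vertexCode u) 0 with hs₄
  have hlast : Runs X V sumCom s₃ s₄ 1 := by
    have e : sumCom.run s₃ = s₄ := by
      simp only [sumCom, Com.run, val_add, val_mul, val_get, val_var, val_lit, i3.vv, hw, hrr, ha,
        Store.set_v, hs₄]
      simp
    rw [← e]
    exact Runs.base (p := sumCom) ⟨trivial, trivial⟩ i3.within
  have hne : s₂.v xc ≠ 0 := by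
    simp only [hs₂, Store.set_v, if_true]
    omega
  have r0 : Runs X V secondCom s₂ s₄ (2 * d + 2 + 1) := Runs.seq g1 hlast
  have r1 : Runs X V (ite xc secondCom firstCom) s₂ s₄ (2 * d + 2 + 1 + 1) :=
    Runs.ite_pos h2'.within hne r0
  have r2 : Runs X V (ite xc skip (readCom ;; ite xc secondCom firstCom)) s₁ s₄
      (1 + (2 * d + 2 + 1 + 1) + 1) :=
    Runs.ite_zero h2.within (h5.mpr hc) (Runs.seq hrun r1)
  have r3 : Runs X V upCom s s₄ (1 + (1 + (2 * d + 2 + 1 + 1) + 1) + 1) :=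
    Runs.ite_pos h.within (by rw [h.vv]; omega) (Runs.seq h1 r2)
  have r4 : Runs X V stepCom s s₄ (1 + (1 + (2 * d + 2 + 1 + 1) + 1) + 1 + 1) :=
    Runs.ite_pos h.within (by rw [h.vup]; norm_num) r3
  refine ⟨s₄, h.reach (by unfold stepCost; omega) r4, ?_, ?_, ?_, ?_⟩
  · refine (i3.set hr (by norm_num) (by norm_num) hle).put_mark (by omega) (by omega) fun c => ?_
    rw [marks_insert]
    by_cases hcu : c = vertexCode u
    · rw [if_pos hcu, hcu, marks_of_notMem (by have := hr.two_le_n; omega) hu]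
    · rw [if_neg hcu, if_neg hcu]
  · simp [hs₄]
  · funext c
    simp [hs₄, Store.put_a, ha]
  · funext c
    simp [hs₄, Store.put_a, ha]

theorem EvalInv.up_return (h : EvalInv d n X V s q 0 1 A) :
    Reach X V s (returnCom.run s) (stepCost d) :=
  h.reach (k := 3) (by unfold stepCost; omega)
    (Runs.ite_pos h.within (by rw [h.vup]; norm_num)
      (Runs.ite_zero h.within h.vv (Runs.base loopFree_returnCom h.within)))

/-- The value of a left half, with an even number, is stored, and the right half is next. -/
theorem EvalInv.up_left (hr : Room d n X V) (h : EvalInv d n X V s (2 * q) 0 1 A) (hq : 1 ≤ q)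
    (hq' : q < (2 * n) ^ d) : ∃ s', Reach X V s s' (stepCost d) ∧
      EvalInv d n X V s' (2 * q + 1) 0 0 A ∧ s'.a aFst = s.a aFst ∧
      s'.a aLeft (2 * q) = s.v xr ∧ (∀ q', q' ≠ 2 * q → s'.a aLeft q' = s.a aLeft q') := by
  have h8 := hr.eight_mul_le
  have hX := hr.index
  have hrV : s.v xr ≤ V := h.within.var_le _
  refine ⟨_, h.up_return, ?_⟩
  have e : returnCom.run s = ((((s.set xc (2 * q - 1)).set xc 0).put aLeft (2 * q) (s.v xr)).set xq
      (2 * q + 1)).set xup 0 := by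
    have : 2 * q - 1 ≠ 0 := by omega
    simp only [returnCom, Com.run, val_sub, val_mod, val_var, h.vq, val_lit]
    simp [this, h.vq]
  rw [e]
  refine ⟨((((h.set hr (by norm_num) (by norm_num) (by omega)).set hr (by norm_num) (by norm_num)
    (by omega)).put (by simp) (by simp) (by omega) hrV).set_q hr (by omega)).set_up hr (by omega),
    ?_, ?_, ?_⟩
  · funext c; simp [Store.put_a]
  · simp [Store.put_a]
  · intro q' hne; simp [Store.put_a, hne]

/-- The value of a right half, with an odd number, is multiplied by that of the left half. -/
theorem EvalInv.up_right (hr : Room d n X V) (h : EvalInv d n X V s (2 * q + 1) 0 1 A)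
    (hq : 1 ≤ q) (hq' : q < (2 * n) ^ d) (hle : s.a aLeft (2 * q) * s.v xr ≤ V) :
    ∃ s', Reach X V s s' (stepCost d) ∧ EvalInv d n X V s' q ((2 * n) ^ d) 1 A ∧
      s'.v xr = s.a aLeft (2 * q) * s.v xr ∧ s'.a = s.a := by
  have h8 := hr.eight_mul_le
  refine ⟨_, h.up_return, ?_⟩
  have e : returnCom.run s = ((((s.set xc (2 * q)).set xc 1).set xr
      (s.a aLeft (2 * q) * s.v xr)).set xq q).set xv ((2 * n) ^ d) := by
    have h1 : q ≠ 0 := by omega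
    have h2 : (2 * q + 1) / 2 = q := by omega
    simp only [returnCom, Com.run, val_sub, val_mod, val_var, h.vq, val_lit]
    simp [h1, h2, h.vq, h.vK]
  rw [e]
  exact ⟨((((h.set hr (by norm_num) (by norm_num) (by omega)).set hr (by norm_num) (by norm_num)
    (by omega)).set hr (by norm_num) (by norm_num) hle).set_q hr (by omega)).set_v hr (by omega),
    by simp, rfl⟩

end

/-! ### The recursion -/

section

variable {d n X V : ℕ}

/-- Every edge is given by its lower end and its direction. -/
theorem card_edgeFinset_gridGraph_le :
    (gridGraph d n).edgeFinset.card ≤ d * n ^ d := by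
  let f : Fin d × (Fin d → Fin n) → Sym2 (Fin d → Fin n) := fun p =>
    if h : ∃ w : Fin d → Fin n, (p.2 p.1 : ℕ) + 1 = w p.1 ∧ ∀ j, j ≠ p.1 → p.2 j = w j then
      s(p.2, h.choose) else s(p.2, p.2)
  have key : ∀ (i : Fin d) (u w : Fin d → Fin n), (u i : ℕ) + 1 = w i → (∀ j, j ≠ i → u j = w j) →
      f (i, u) = s(u, w) := by
    intro i u w h hj
    have hex : ∃ w : Fin d → Fin n, (u i : ℕ) + 1 = w i ∧ ∀ j, j ≠ i → u j = w j := ⟨w, h, hj⟩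
    simp only [f]
    rw [dif_pos hex]
    have := hex.choose_spec
    congr 2
    funext j
    by_cases hji : j = i
    · subst hji
      exact Fin.ext (by omega)
    · rw [← this.2 j hji, hj j hji]
  have hsub : (gridGraph d n).edgeFinset ⊆ Finset.univ.image f := by
    intro e he
    induction e using Sym2.ind with
    | _ u w =>
      rw [SimpleGraph.mem_edgeFinset, SimpleGraph.mem_edgeSet] at he
      obtain ⟨i, h | h, hj⟩ := he
      · exact Finset.mem_image.mpr ⟨(i, u), Finset.mem_univ _, key i u w h hj⟩
      · exact Finset.mem_image.mpr ⟨(i, w), Finset.mem_univ _,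
          (key i w u h fun j hji => (hj j hji).symm).trans Sym2.eq_swap⟩
  refine (Finset.card_le_card hsub).trans (Finset.card_image_le.trans ?_)
  simp

/-- The value of the recursion for a set `U` of vertices, if the vertices in `A` are chosen. -/
noncomputable def gridSum (d n : ℕ) (U A : Finset (Fin d → Fin n)) : ℕ :=
  partitionSum (gridGraph d n) (gridM d n - 1) (1 + gridB d n) U A

theorem gridSum_le (U A : Finset (Fin d → Fin n)) :
    gridSum d n U A ≤ gridM d n ^ (2 * n ^ d + 1) := by
  have h1 := two_le_gridB (d := d) (n := n)
  have h2 := gridB_lt_gridM (d := d) (n := n)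
  have h3 := partitionSum_le (gridGraph d n) (gridM d n - 1) (1 + gridB d n) (M := gridM d n)
    (by omega) (by omega) (by omega) (by
      unfold gridM
      exact Nat.pow_le_pow_right (by omega) (card_edgeFinset_gridGraph_le.trans (by omega))) U A
  simpa [gridSum] using h3

theorem Room.gridSum_mul_le (hr : Room d n X V) (U A : Finset (Fin d → Fin n)) :
    (gridM d n - 1) * gridSum d n U A ≤ V := by
  refine le_trans ?_ hr.power
  rw [show 2 * n ^ d + 2 = (2 * n ^ d + 1) + 1 by ring, pow_succ, mul_comm]
  exact Nat.mul_le_mul (gridSum_le U A) (by omega)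

theorem Room.gridSum_le (hr : Room d n X V) (U A : Finset (Fin d → Fin n)) :
    gridSum d n U A ≤ V := by
  refine ((RAM.gridSum_le U A).trans (Nat.pow_le_pow_right ?_ (by omega))).trans hr.power
  have h1 := two_le_gridB (d := d) (n := n)
  have h2 := gridB_lt_gridM (d := d) (n := n)
  omega

/-- The recursion at number `v` in box `q` has led from `s` to `s'`: the value has been computed,
and the array entries that are still needed have been preserved. These belong to boxes with smaller
numbers, to earlier vertices on the cut of box `q`, and to left halves with numbers up to `q`. -/
structure Evaluated (d n X V t q v : ℕ) (A : Finset (Fin d → Fin n)) (s s' : Store) : Prop where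
  inv : EvalInv d n X V s' q v 1 A
  value : s'.v xr = gridSum d n (boxRest d n t q v) A
  fst : ∀ c, (cutArray d n c < q ∨ cutArray d n c = q ∧ c < v) → s'.a aFst c = s.a aFst c
  left : ∀ q' ≤ q, s'.a aLeft q' = s.a aLeft q'

/-- Evaluation of the vertices on the cut of a box, one after the other. Each of them doubles the
cost, and `F` is the cost for the rest of the box. -/
theorem evaluated_cut (hr : Room d n X V) {t q F : ℕ} (h1 : 2 ^ t ≤ q) (h2 : q < 2 ^ (t + 1))
    (hq : q < 2 * (2 * n) ^ d)
    (hend : ∀ A s, EvalInv d n X V s q ((2 * n) ^ d) 0 A →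
      Disjoint (boxRest d n t q ((2 * n) ^ d)) A →
      ∃ s', Reach X V s s' (stepCost d * F) ∧ Evaluated d n X V t q ((2 * n) ^ d) A s s') :
    ∀ j v A s, v + j = (2 * n) ^ d → EvalInv d n X V s q v 0 A → Disjoint (boxRest d n t q v) A →
      ∃ s', Reach X V s s' (stepCost d * ((3 * j + F) * 2 ^ (cutRest d n t q v).card)) ∧
        Evaluated d n X V t q v A s s' := by
  have hd : 0 < d := by have := hr.two_le_d; omega
  have hn : 1 ≤ n := by have := hr.two_le_n; omega
  have h8 := hr.eight_mul_le
  have hqV : q ≤ V := by omega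
  intro j
  induction j with
  | zero =>
    intro v A s hv hs hA
    have : v = (2 * n) ^ d := by omega
    subst this
    obtain ⟨s', e1, e2⟩ := hend A s hs hA
    refine ⟨s', e1.mono (Nat.mul_le_mul_left _ ?_), e2⟩
    have : 1 ≤ 2 ^ (cutRest d n t q ((2 * n) ^ d)).card := Nat.one_le_two_pow
    nlinarith
  | succ j ih =>
    intro v A s hv hs hA
    obtain ⟨s₁, r1, i1, a1⟩ := hs.down_next hr (by omega)
    by_cases hc : cutArray d n v = q
    · have hq0 : 0 < 2 ^ t := by positivity
      obtain ⟨u, rfl⟩ := exists_of_cutArray_ne_zero (d := d) (n := n) (c := v) (by omega)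
      have hcb : cutBox d n (coords u) = q := by rw [← cutArray_vertexCode hn, hc]
      have hbox := boxRest_succ_of_eq hn hcb h1 h2
      have hcut := cutRest_succ_of_eq hn hcb h1 h2
      set U := boxRest d n t q (vertexCode u + 1) with hU
      have huU : u ∉ U := by
        rw [hU, mem_boxRest]
        have := cutTime_eq_of_cutBox hcb h1 h2
        omega
      rw [hbox, Finset.disjoint_insert_left] at hA
      obtain ⟨s₂, r2, e2⟩ := ih _ A s₁ (by omega) i1 hA.2
      obtain ⟨s₃, r3, i3, f3, g3, l3⟩ := e2.inv.up_first hr hqV hc hA.1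
        (by rw [e2.value]; exact hr.gridSum_mul_le _ _)
      obtain ⟨s₄, r4, e4⟩ := ih _ (insert u A) s₃ (by omega) i3
        (Finset.disjoint_insert_right.mpr ⟨huU, hA.2⟩)
      have hF : s₄.a aFst (vertexCode u) = (gridM d n - 1) * gridSum d n U A := by
        rw [e4.fst _ (Or.inr ⟨hc, by omega⟩), f3, e2.value]
      have hsum : s₄.a aFst (vertexCode u) +
          (1 + gridB d n) ^ nbrsIn (gridGraph d n) u A * s₄.v xr = gridSum d n (insert u U) A := by
        rw [hF, e4.value]
        exact (partitionSum_insert _ _ _ huU hA.1).symm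
      obtain ⟨s₅, r5, i5, w5, f5, l5⟩ := e4.inv.up_second hr hqV hc hA.1
        (by rw [hsum]; exact hr.gridSum_le _ _)
      refine ⟨s₅, (r1.trans (r2.trans (r3.trans (r4.trans r5)))).mono ?_, i5, ?_, ?_, ?_⟩
      · rw [hcut, pow_succ]
        set P := 2 ^ (cutRest d n t q (vertexCode u + 1)).card with hP
        have hP1 : 1 ≤ P := Nat.one_le_two_pow
        have : 1 + ((3 * j + F) * P + (1 + ((3 * j + F) * P + 1))) ≤
            (3 * (j + 1) + F) * (P * 2) := by nlinarith
        calc _ = stepCost d * (1 + ((3 * j + F) * P + (1 + ((3 * j + F) * P + 1)))) := by ring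
          _ ≤ _ := Nat.mul_le_mul_left _ this
      · rw [w5, hsum, hbox]
      · intro c hcc
        have hne : c ≠ vertexCode u := by
          rintro rfl
          omega
        rw [f5, e4.fst c (by omega), g3 c hne, e2.fst c (by omega), a1]
      · intro q' hq'
        rw [l5, e4.left q' hq', l3, e2.left q' hq', a1]
    · have hbox := boxRest_succ_of_ne (d := d) (t := t) hn hc
      rw [hbox] at hA
      obtain ⟨s₂, r2, e2⟩ := ih _ A s₁ (by omega) i1 hA
      obtain ⟨s₃, r3, i3, w3, a3⟩ := e2.inv.up_skip hr hqV hc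
      refine ⟨s₃, (r1.trans (r2.trans r3)).mono ?_, i3, ?_, ?_, ?_⟩
      · have hP := Nat.pow_le_pow_right (show 0 < 2 by norm_num)
          (card_cutRest_mono (d := d) (n := n) (t := t) (q := q) (Nat.le_succ v))
        have hP1 : 1 ≤ 2 ^ (cutRest d n t q v).card := Nat.one_le_two_pow
        calc stepCost d + (stepCost d * ((3 * j + F) * 2 ^ (cutRest d n t q (v + 1)).card) +
              stepCost d)
            = stepCost d * ((3 * j + F) * 2 ^ (cutRest d n t q (v + 1)).card + 2) := by ring
          _ ≤ stepCost d * ((3 * j + F) * 2 ^ (cutRest d n t q v).card +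
              2 * 2 ^ (cutRest d n t q v).card) := by
            refine Nat.mul_le_mul_left _ (Nat.add_le_add (Nat.mul_le_mul_left _ hP) (by omega))
          _ ≤ _ := by
            refine Nat.mul_le_mul_left _ ?_
            rw [← add_mul]
            exact Nat.mul_le_mul_right _ (by omega)
      · rw [w3, e2.value, hbox]
      · intro c hcc
        rw [a3, e2.fst c (by omega), a1]
      · intro q' hq'
        rw [a3, e2.left q' hq', a1]

/-- Evaluation of a box at level `t`, by induction on the number `ρ` of levels below it. The cost is
proportional to the number `2 ^ (ρ + 1) - 1` of boxes, apart from the doubling by the vertices on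
the cuts. The two halves of a box are evaluated one after the other, so that only the largest cut of
each level enters the exponent. -/
theorem evaluated_box (hr : Room d n X V) : ∀ ρ t q A s, (2 * n) ^ d ≤ 2 ^ (t + ρ) → 2 ^ t ≤ q →
    q < 2 ^ (t + 1) → q < 2 * (2 * n) ^ d → EvalInv d n X V s q 0 0 A →
    Disjoint (boxRest d n t q 0) A →
    ∃ s', Reach X V s s' (stepCost d * ((3 * (2 * n) ^ d + 3) * (2 ^ (ρ + 1) - 1) *
        2 ^ ∑ i ∈ Finset.range (ρ + 1), cutSize d n (t + i))) ∧
      Evaluated d n X V t q 0 A s s' := by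
  have hd : 0 < d := by have := hr.two_le_d; omega
  have hn : 1 ≤ n := by have := hr.two_le_n; omega
  have h8 := hr.eight_mul_le
  have hleaf : ∀ t q, (2 * n) ^ d ≤ q → ∀ A s, EvalInv d n X V s q ((2 * n) ^ d) 0 A →
      Disjoint (boxRest d n t q ((2 * n) ^ d)) A →
      ∃ s', Reach X V s s' (stepCost d * 1) ∧ Evaluated d n X V t q ((2 * n) ^ d) A s s' := by
    intro t q hq A s hs _
    obtain ⟨s', r, i, w, a⟩ := hs.down_leaf hr hq
    refine ⟨s', r.mono (by omega), i, ?_, fun c _ => by rw [a], fun q' _ => by rw [a]⟩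
    rw [w, boxRest_end_of_le hd hn hq]
    exact (partitionSum_empty _ _ _ _).symm
  intro ρ
  induction ρ with
  | zero =>
    intro t q A s ht h1 h2 hq hs hA
    obtain ⟨s', r, e⟩ := evaluated_cut hr h1 h2 hq (hleaf t q (by simpa using ht.trans h1))
      ((2 * n) ^ d) 0 A s (by omega) hs hA
    refine ⟨s', r.mono (Nat.mul_le_mul_left _ ?_), e⟩
    have hcard := card_cutRest_le (n := n) hd t q 0
    simp only [zero_add, Finset.sum_range_one, add_zero, pow_one]
    refine Nat.mul_le_mul (by omega) (Nat.pow_le_pow_right (show 0 < 2 by norm_num) hcard)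
  | succ ρ ih =>
    intro t q A s ht h1 h2 hq hs hA
    have hq1 : 1 ≤ q := Nat.one_le_two_pow.trans h1
    set S := ∑ i ∈ Finset.range (ρ + 1), cutSize d n (t + 1 + i) with hS
    set Y := (3 * (2 * n) ^ d + 3) * (2 ^ (ρ + 1) - 1) with hY
    -- the rest of the box after its cut is either empty or consists of the two halves
    have hend : ∀ A s, EvalInv d n X V s q ((2 * n) ^ d) 0 A →
        Disjoint (boxRest d n t q ((2 * n) ^ d)) A →
        ∃ s', Reach X V s s' (stepCost d * ((3 + 2 * Y) * 2 ^ S)) ∧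
          Evaluated d n X V t q ((2 * n) ^ d) A s s' := by
      intro A s hs hA
      have hP1 : 1 ≤ 2 ^ S := Nat.one_le_two_pow
      by_cases hqK : (2 * n) ^ d ≤ q
      · obtain ⟨s', r, e⟩ := hleaf t q hqK A s hs hA
        refine ⟨s', r.mono (Nat.mul_le_mul_left _ ?_), e⟩
        nlinarith
      · have hsplit := boxRest_end (d := d) hn t q
        rw [hsplit, Finset.disjoint_union_left] at hA
        have hp : (2 * n) ^ d ≤ 2 ^ (t + 1 + ρ) := by rwa [show t + 1 + ρ = t + (ρ + 1) by ring]
        obtain ⟨s₁, r1, i1, a1⟩ := hs.down_child hr (by omega)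
        obtain ⟨s₂, r2, e2⟩ := ih (t + 1) (2 * q) A s₁ hp (by rw [pow_succ]; omega)
          (by rw [pow_succ]; omega) (by omega) i1 hA.1
        obtain ⟨s₃, r3, i3, f3, l3, m3⟩ := e2.inv.up_left hr hq1 (by omega)
        obtain ⟨s₄, r4, e4⟩ := ih (t + 1) (2 * q + 1) A s₃ hp (by rw [pow_succ]; omega)
          (by rw [pow_succ]; omega) (by omega) i3 hA.2
        have hprod : s₄.a aLeft (2 * q) * s₄.v xr =
            gridSum d n (boxRest d n t q ((2 * n) ^ d)) A := by
          rw [e4.left _ (by omega), l3, e2.value, e4.value, hsplit]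
          exact (partitionSum_union _ _ _ (disjoint_boxRest (by omega)) hA.1 hA.2
            fun u hu w hw => not_adj_boxRest (by omega) hu hw).symm
        obtain ⟨s₅, r5, i5, w5, a5⟩ := e4.inv.up_right hr hq1 (by omega)
          (by rw [hprod]; exact hr.gridSum_le _ _)
        refine ⟨s₅, (r1.trans (r2.trans (r3.trans (r4.trans r5)))).mono ?_, i5, ?_, ?_, ?_⟩
        · calc _ = stepCost d * (3 + 2 * Y * 2 ^ S) := by ring
            _ ≤ _ := Nat.mul_le_mul_left _ (by nlinarith)
        · rw [w5, hprod]
        · intro c hc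
          rw [a5, e4.fst c (by omega), f3, e2.fst c (by omega), a1]
        · intro q' hq'
          rw [a5, e4.left q' (by omega), m3 q' (by omega), e2.left q' (by omega), a1]
    obtain ⟨s', r, e⟩ := evaluated_cut hr h1 h2 hq hend ((2 * n) ^ d) 0 A s (by omega) hs hA
    refine ⟨s', r.mono (Nat.mul_le_mul_left _ ?_), e⟩
    have hcard := card_cutRest_le (n := n) hd t q 0
    have hsum : ∑ i ∈ Finset.range (ρ + 1 + 1), cutSize d n (t + i) = S + cutSize d n t := by
      rw [Finset.sum_range_succ', hS, add_zero]
      congr 1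
      exact Finset.sum_congr rfl fun i _ => by rw [add_assoc, add_comm 1]
    have hPS : 1 ≤ 2 ^ S := Nat.one_le_two_pow
    have h2p : 1 ≤ 2 ^ (ρ + 1) := Nat.one_le_two_pow
    have hYY : (3 * (2 * n) ^ d + 3) * (2 ^ (ρ + 1 + 1) - 1) = 3 * (2 * n) ^ d + 3 + 2 * Y := by
      rw [hY, pow_succ 2 (ρ + 1)]
      obtain ⟨z, hz⟩ : ∃ z, 2 ^ (ρ + 1) = z + 1 := ⟨2 ^ (ρ + 1) - 1, by omega⟩
      rw [hz, show (z + 1) * 2 - 1 = 2 * z + 1 by omega, show z + 1 - 1 = z by omega]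
      ring
    clear_value Y
    have hle : 3 * (2 * n) ^ d + (3 + 2 * Y) * 2 ^ S ≤ (3 * (2 * n) ^ d + 3 + 2 * Y) * 2 ^ S := by
      nlinarith
    calc _ ≤ ((3 * (2 * n) ^ d + 3 + 2 * Y) * 2 ^ S) * 2 ^ cutSize d n t :=
          Nat.mul_le_mul hle (Nat.pow_le_pow_right (show 0 < 2 by norm_num) hcard)
      _ = _ := by rw [hsum, hYY, pow_add, mul_assoc]

end

/-! ### Preparations for the recursion -/

/-- One factor of the powers of the base and of the number of vertices. -/
def powStep : Com :=
  set xK (var xK * var xb) ;; set xN (var xN * var xn) ;; set xi (var xi - lit 1)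

/-- The base for the numbers of vertices, the number of all numbers, and the number of vertices. -/
def powCom : Com :=
  (set xb (lit 2 * var xn) ;; set xK (lit 1) ;; set xN (lit 1) ;; set xi (var xd)) ;;
  loop xi powStep

/-- Doubling. -/
def baseStep : Com := set xB (var xB * lit 2) ;; set xi (var xi - lit 1)

/-- The base for the edge cover polynomial. -/
def baseCom : Com := (set xi (var xd * var xN + lit 1) ;; set xB (lit 1)) ;; loop xi baseStep

/-- One factor of the modulus. -/
def modStep : Com := set xM (var xM * (lit 1 + var xB)) ;; set xi (var xi - lit 1)

/-- The modulus. -/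
def modCom : Com := (set xi (var xd * var xN + lit 1) ;; set xM (lit 1)) ;; loop xi modStep

/-- The test of one digit. -/
def validStep : Com :=
  set xx (Ex.mod (var xv / var xp) (var xb)) ;;
  set xc (var xx * (var xn + lit 1 - var xx)) ;;
  ite xc skip (set xok (lit 0)) ;;
  set xp (var xp * var xb) ;;
  set xi (var xi - lit 1)

/-- The test whether a number belongs to a vertex. -/
def validCom : Com :=
  (set xok (lit 1) ;; set xp (lit 1) ;; set xi (var xd)) ;; loop xi validStep

/-- The half of the current box that contains the vertex, and the test whether the bisection of the
box removes the vertex. -/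
def pathProbe : Com :=
  set xx (Ex.mod (var xv / var xp) (var xb)) ;;
  set xw ((var xx * var xg + var xn) / (var xn + lit 1)) ;;
  set xc ((var xx + lit 1) * var xg - (var xn + lit 1) * var xw)

/-- The step from a box to one of its halves. -/
def pathMove : Com :=
  set xh (lit 2 * var xh + Ex.mod (var xw + lit 1) (lit 2)) ;;
  set xp (var xp * var xb) ;;
  set xc (var xK - var xp)

/-- One step of bisection. -/
def pathStep : Com :=
  pathProbe ;; ite xc (set xgo (lit 0))
    (pathMove ;; ite xc skip (set xp (lit 1) ;; set xg (lit 2 * var xg)))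

/-- The number of the box whose bisection removes a vertex. -/
def pathCom : Com :=
  (set xh (lit 1) ;; set xp (lit 1) ;; set xg (lit 2) ;; set xgo (lit 1)) ;; loop xgo pathStep

/-- The entry of the array of boxes for the number of a vertex. -/
def entryCom : Com := pathCom ;; put aCut (var xv) (var xh)

/-- The entry of the array of boxes for one number. -/
def cutStep : Com := set xv (var xv - lit 1) ;; validCom ;; ite xok entryCom skip

/-- The array of boxes. -/
def cutCom : Com := set xv (var xK) ;; loop xv cutStep

section

variable {d n X V : ℕ}

theorem runs_powCom (hr : Room d n X V) {s : Store} (hw0 : s.Within X V) (hsd : s.v xd = d)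
    (hsn : s.v xn = n) (hsa : s.a = fun _ _ => 0) :
    ∃ s', Runs X V powCom s s' (2 * d + 2) ∧ s'.Within X V ∧ s'.v xd = d ∧
      s'.v xn = n ∧ s'.v xb = 2 * n ∧ s'.v xK = (2 * n) ^ d ∧ s'.v xN = n ^ d ∧
      s'.a = fun _ _ => 0 := by
  have h8 := hr.eight_mul_le
  have hX := hr.index
  have hd := hr.d_le
  have hb := hr.base_le
  have hn := hr.two_le_n
  have hp : ∀ j ≤ d, (2 * n) ^ j ≤ (2 * n) ^ d := fun j hj =>
    Nat.pow_le_pow_right (by omega) hj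
  have hp' : ∀ j, n ^ j ≤ (2 * n) ^ j := fun j => Nat.pow_le_pow_left (by omega) j
  let Inv : ℕ → Store → Prop := fun j s => j ≤ d ∧ s.Within X V ∧ s.v xd = d ∧ s.v xn = n ∧
    s.v xb = 2 * n ∧ s.v xK = (2 * n) ^ j ∧ s.v xN = n ^ j ∧ s.v xi = d - j ∧ s.a = fun _ _ => 0
  have hinit := Runs.base (X := X) (V := V)
    (p := set xb (lit 2 * var xn) ;; set xK (lit 1) ;; set xN (lit 1) ;; set xi (var xd))
    ⟨trivial, trivial, trivial, trivial⟩ hw0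
  obtain ⟨s', h1, h2⟩ := Runs.loop_count (X := X) (V := V) (x := xi) (k := 1) (p := powStep) d Inv
    (fun _ _ h => h.2.1)
    (fun i s hi h => by rw [h.2.2.2.2.2.2.2.1]; omega)
    (fun s h => by rw [h.2.2.2.2.2.2.2.1]; omega)
    (by
      rintro j t hj ⟨-, hc, hvd, hvn, hvb, hvK, hvN, hvi, ha⟩
      refine ⟨_, Runs.base (p := powStep) ⟨trivial, trivial, trivial⟩ hc, by omega, ?_, ?_, ?_, ?_,
        ?_, ?_, ?_, ?_⟩
      · simp only [powStep, Com.run]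
        refine ((hc.set (by omega) ?_).set (by omega) ?_).set (by omega) ?_
        · have := hp (j + 1) (by omega)
          rw [pow_succ] at this
          simp only [val_mul, val_var, hvK, hvb]
          omega
        · have := hp (j + 1) (by omega)
          have h2 := hp' (j + 1)
          rw [pow_succ n] at h2
          simp [hvN, hvn]
          omega
        · simp [hvi]; omega
      · simp [powStep, Com.run, hvd]
      · simp [powStep, Com.run, hvn]
      · simp [powStep, Com.run, hvb]
      · simp [powStep, Com.run, hvK, hvb, pow_succ]
      · simp [powStep, Com.run, hvN, hvn, pow_succ]
      · simp [powStep, Com.run, hvi]; omega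
      · simp [powStep, Com.run, ha])
    (s := Com.run (set xb (lit 2 * var xn) ;; set xK (lit 1) ;; set xN (lit 1) ;; set xi (var xd))
      s)
    (by
      refine ⟨by omega, ?_, ?_, ?_, ?_, ?_, ?_, ?_, ?_⟩
      · simp only [Com.run]
        refine (((hw0.set (by omega) ?_).set (by omega) ?_).set (by omega) ?_).set (by omega) ?_
        · simp [hsn]; omega
        · simp; omega
        · simp; omega
        · simp [hsn]; omega
      all_goals simp [Com.run, hsd, hsn, hsa])
  obtain ⟨-, hc, hvd, hvn, hvb, hvK, hvN, -, ha⟩ := h2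
  exact ⟨s', (Runs.seq hinit h1).mono (by omega), hc, hvd, hvn, hvb, hvK, hvN, ha⟩

theorem runs_baseCom (hr : Room d n X V) {s : Store} (hw : s.Within X V) (hd : s.v xd = d)
    (hn : s.v xn = n) (hb : s.v xb = 2 * n) (hK : s.v xK = (2 * n) ^ d) (hN : s.v xN = n ^ d)
    (ha : s.a = fun _ _ => 0) :
    ∃ s', Runs X V baseCom s s' (2 * (d * n ^ d + 1) + 2) ∧ s'.Within X V ∧ s'.v xd = d ∧
      s'.v xn = n ∧ s'.v xb = 2 * n ∧ s'.v xK = (2 * n) ^ d ∧ s'.v xN = n ^ d ∧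
      s'.v xB = gridB d n ∧ s'.a = fun _ _ => 0 := by
  have h8 := hr.eight_mul_le
  have hX := hr.index
  have hBM := gridB_lt_gridM (d := d) (n := n)
  have hMV := hr.gridM_le
  have hp : ∀ j ≤ d * n ^ d + 1, 2 ^ j ≤ V := fun j hj =>
    ((Nat.pow_le_pow_right (by norm_num) hj).trans hBM.le).trans hMV
  let Inv : ℕ → Store → Prop := fun j s => j ≤ d * n ^ d + 1 ∧ s.Within X V ∧ s.v xd = d ∧
    s.v xn = n ∧ s.v xb = 2 * n ∧ s.v xK = (2 * n) ^ d ∧ s.v xN = n ^ d ∧ s.v xB = 2 ^ j ∧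
    s.v xi = d * n ^ d + 1 - j ∧ s.a = fun _ _ => 0
  have hinit := Runs.base (X := X) (V := V)
    (p := set xi (var xd * var xN + lit 1) ;; set xB (lit 1)) ⟨trivial, trivial⟩ hw
  obtain ⟨s', h1, h2⟩ := Runs.loop_count (X := X) (V := V) (x := xi) (k := 1) (p := baseStep)
    (d * n ^ d + 1) Inv
    (fun _ _ h => h.2.1)
    (fun i s hi h => by rw [h.2.2.2.2.2.2.2.2.1]; omega)
    (fun s h => by rw [h.2.2.2.2.2.2.2.2.1]; omega)
    (by
      rintro j t hj ⟨-, hc, hvd, hvn, hvb, hvK, hvN, hvB, hvi, ha⟩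
      refine ⟨_, Runs.base (p := baseStep) ⟨trivial, trivial⟩ hc, by omega, ?_, ?_, ?_, ?_,
        ?_, ?_, ?_, ?_, ?_⟩
      · simp only [baseStep, Com.run]
        refine (hc.set (by omega) ?_).set (by omega) ?_
        · have := hp (j + 1) (by omega)
          rw [pow_succ] at this
          simp only [val_mul, val_var, hvB, val_lit]
          omega
        · simp [hvi]; omega
      · simp [baseStep, Com.run, hvd]
      · simp [baseStep, Com.run, hvn]
      · simp [baseStep, Com.run, hvb]
      · simp [baseStep, Com.run, hvK]
      · simp [baseStep, Com.run, hvN]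
      · simp [baseStep, Com.run, hvB, pow_succ]
      · simp [baseStep, Com.run, hvi]; omega
      · simp [baseStep, Com.run, ha])
    (s := Com.run (set xi (var xd * var xN + lit 1) ;; set xB (lit 1)) s)
    (by
      refine ⟨by omega, ?_, ?_, ?_, ?_, ?_, ?_, ?_, ?_, ?_⟩
      · simp only [Com.run]
        refine (hw.set (by omega) ?_).set (by omega) ?_
        · simp [hd, hN]; omega
        · simp; omega
      all_goals simp [Com.run, hd, hn, hb, hK, hN, ha])
  obtain ⟨-, hc, hvd, hvn, hvb, hvK, hvN, hvB, -, ha⟩ := h2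
  exact ⟨s', (Runs.seq hinit h1).mono (by omega), hc, hvd, hvn, hvb, hvK, hvN, hvB, ha⟩

theorem runs_modCom (hr : Room d n X V) {s : Store} (hw : s.Within X V) (hd : s.v xd = d)
    (hn : s.v xn = n) (hb : s.v xb = 2 * n) (hK : s.v xK = (2 * n) ^ d) (hN : s.v xN = n ^ d)
    (hB : s.v xB = gridB d n) (ha : s.a = fun _ _ => 0) :
    ∃ s', Runs X V modCom s s' (2 * (d * n ^ d + 1) + 2) ∧ Consts d n X V s' ∧
      s'.a = fun _ _ => 0 := by
  have h8 := hr.eight_mul_le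
  have hX := hr.index
  have hMV := hr.gridM_le
  have hp : ∀ j ≤ d * n ^ d + 1, (1 + gridB d n) ^ j ≤ V := fun j hj =>
    (Nat.pow_le_pow_right (by omega) hj).trans hMV
  let Inv : ℕ → Store → Prop := fun j s => j ≤ d * n ^ d + 1 ∧ s.Within X V ∧ s.v xd = d ∧
    s.v xn = n ∧ s.v xb = 2 * n ∧ s.v xK = (2 * n) ^ d ∧ s.v xN = n ^ d ∧ s.v xB = gridB d n ∧
    s.v xM = (1 + gridB d n) ^ j ∧ s.v xi = d * n ^ d + 1 - j ∧ s.a = fun _ _ => 0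
  have hinit := Runs.base (X := X) (V := V)
    (p := set xi (var xd * var xN + lit 1) ;; set xM (lit 1)) ⟨trivial, trivial⟩ hw
  obtain ⟨s', h1, h2⟩ := Runs.loop_count (X := X) (V := V) (x := xi) (k := 1) (p := modStep)
    (d * n ^ d + 1) Inv
    (fun _ _ h => h.2.1)
    (fun i s hi h => by rw [h.2.2.2.2.2.2.2.2.2.1]; omega)
    (fun s h => by rw [h.2.2.2.2.2.2.2.2.2.1]; omega)
    (by
      rintro j t hj ⟨-, hc, hvd, hvn, hvb, hvK, hvN, hvB, hvM, hvi, ha⟩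
      refine ⟨_, Runs.base (p := modStep) ⟨trivial, trivial⟩ hc, by omega, ?_, ?_, ?_, ?_,
        ?_, ?_, ?_, ?_, ?_, ?_⟩
      · simp only [modStep, Com.run]
        refine (hc.set (by omega) ?_).set (by omega) ?_
        · have := hp (j + 1) (by omega)
          rw [pow_succ] at this
          simp only [val_mul, val_var, val_add, hvB, hvM, val_lit]
          exact this
        · simp [hvi]; omega
      · simp [modStep, Com.run, hvd]
      · simp [modStep, Com.run, hvn]
      · simp [modStep, Com.run, hvb]
      · simp [modStep, Com.run, hvK]
      · simp [modStep, Com.run, hvN]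
      · simp [modStep, Com.run, hvB]
      · simp [modStep, Com.run, hvM, hvB, pow_succ]
      · simp [modStep, Com.run, hvi]; omega
      · simp [modStep, Com.run, ha])
    (s := Com.run (set xi (var xd * var xN + lit 1) ;; set xM (lit 1)) s)
    (by
      refine ⟨by omega, ?_, ?_, ?_, ?_, ?_, ?_, ?_, ?_, ?_, ?_⟩
      · simp only [Com.run]
        refine (hw.set (by omega) ?_).set (by omega) ?_
        · simp [hd, hN]; omega
        · simp; omega
      all_goals simp [Com.run, hd, hn, hb, hK, hN, hB, ha])
  obtain ⟨-, hc, hvd, hvn, hvb, hvK, hvN, hvB, hvM, -, ha⟩ := h2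
  exact ⟨s', (Runs.seq hinit h1).mono (by omega), ⟨hvd, hvn, hvb, hvK, hvN, hvB, hvM, hc⟩, ha⟩

theorem runs_validCom (hr : Room d n X V) {s : Store} (h : Consts d n X V s)
    (hv : s.v xv < (2 * n) ^ d) :
    ∃ s', Runs X V validCom s s' (2 * d + 2) ∧ Consts d n X V s' ∧ s'.v xv = s.v xv ∧
      (s'.v xok ≠ 0 ↔ ∀ i < d, 1 ≤ digit (2 * n) (s.v xv) i ∧ digit (2 * n) (s.v xv) i ≤ n) ∧
      s'.a = s.a := by
  have h8 := hr.eight_mul_le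
  have hsm := hr.small
  have hd := hr.d_le
  have hb := hr.base_le
  have hn := hr.two_le_n
  have hp : ∀ j ≤ d, (2 * n) ^ j ≤ (2 * n) ^ d := fun j hj =>
    Nat.pow_le_pow_right (by omega) hj
  let Inv : ℕ → Store → Prop := fun j s' => j ≤ d ∧ Consts d n X V s' ∧ s'.v xv = s.v xv ∧
    (s'.v xok ≠ 0 ↔ ∀ i < j, 1 ≤ digit (2 * n) (s.v xv) i ∧ digit (2 * n) (s.v xv) i ≤ n) ∧
    s'.v xp = (2 * n) ^ j ∧ s'.v xi = d - j ∧ s'.a = s.a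
  have hinit := Runs.base (X := X) (V := V)
    (p := set xok (lit 1) ;; set xp (lit 1) ;; set xi (var xd)) ⟨trivial, trivial, trivial⟩
    h.within
  obtain ⟨s', h1, h2⟩ := Runs.loop_count (X := X) (V := V) (x := xi) (k := 1) (p := validStep) d Inv
    (fun _ _ h => h.2.1.within)
    (fun i s hi h => by rw [h.2.2.2.2.2.1]; omega)
    (fun s h => by rw [h.2.2.2.2.2.1]; omega)
    (by
      rintro j t hj ⟨-, hc, hvv, hok, hvp, hvi, ha⟩
      refine ⟨_, Runs.base (p := validStep) ⟨trivial, trivial, ⟨trivial, trivial⟩, trivial, trivial⟩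
        hc.within, by omega, ?_⟩
      set g := digit (2 * n) (s.v xv) j with hg
      have hglt : g < 2 * n := Nat.mod_lt _ (by omega)
      have hgn : g * (n + 1 - g) ≤ V := by
        have : g * (n + 1 - g) ≤ (2 * n) * (2 * n) := Nat.mul_le_mul (by omega) (by omega)
        have h3 : (2 * n) * (2 * n) ≤ (2 * n) ^ d * (2 * n) ^ d := Nat.mul_le_mul hb hb
        have h4 : 4 * (2 * n) ^ d * (2 * n) ^ d = 4 * ((2 * n) ^ d * (2 * n) ^ d) := by ring
        omega
      set okv := if g * (n + 1 - g) = 0 then 0 else t.v xok with hokv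
      have e : validStep.run t = ((((t.set xx g).set xc (g * (n + 1 - g))).set xok okv).set xp
          ((2 * n) ^ (j + 1))).set xi (d - (j + 1)) := by
        have hx : t.v xv / t.v xp % t.v xb = g := by rw [hvv, hvp, hc.vb]; rfl
        have e1 : (2 * n) ^ j * (2 * n) = (2 * n) ^ (j + 1) := (pow_succ _ _).symm
        simp only [validStep, Com.run, val_mod, val_div, val_var, hx]
        by_cases hz : g * (n + 1 - g) = 0
        · simp [hokv, hz, hc.vn, hvp, hc.vb, e1, hvi, Nat.sub_sub]
        · simp only [hokv, hz, if_false]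
          simp only [Store.set_v, val_mul, val_sub, val_add, val_var, val_lit]
          simp only [hc.vn, if_true, ne_eq]
          norm_num [hz, e1, Nat.sub_sub, hc.vn, hvp, hvi, hc.vb]
          ext y
          · simp only [Store.set_v]
            by_cases hy : y = xok
            · subst hy; simp
            · simp [hy]
          · rfl
      rw [e]
      have hpj := hp (j + 1) (by omega)
      have hokV : okv ≤ V := by
        have := hc.within.var_le xok
        rw [hokv]
        split_ifs <;> omega
      refine ⟨((((hc.set hr (by norm_num) (by norm_num) (by omega)).set hr (by norm_num)
        (by norm_num) hgn).set hr (by norm_num) (by norm_num) hokV).set hr (by norm_num)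
        (by norm_num) (by omega)).set hr (by norm_num) (by norm_num) (by omega), ?_, ?_, ?_, ?_, ?_⟩
      · simp [hvv]
      · have hgz : g * (n + 1 - g) = 0 ↔ ¬ (1 ≤ g ∧ g ≤ n) := by
          rw [Nat.mul_eq_zero]; omega
        have : (((((t.set xx g).set xc (g * (n + 1 - g))).set xok okv).set xp
          ((2 * n) ^ (j + 1))).set xi (d - (j + 1))).v xok = okv := by simp
        rw [this, hokv, Nat.forall_lt_succ_right, ← hok]
        by_cases hz : g * (n + 1 - g) = 0
        · rw [if_pos hz]
          rw [hgz] at hz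
          simp only [ne_eq, not_true_eq_false, false_iff, not_and]
          intro _
          rw [← hg]
          omega
        · rw [if_neg hz]
          rw [hgz, not_not] at hz
          rw [← hg]
          tauto
      · simp
      · simp
      · simp [ha])
    (s := Com.run (set xok (lit 1) ;; set xp (lit 1) ;; set xi (var xd)) s)
    (by
      refine ⟨by omega, ?_, ?_, ?_, ?_, ?_, ?_⟩
      · simp only [Com.run]
        refine ((h.set hr (by norm_num) (by norm_num) ?_).set hr (by norm_num) (by norm_num)
          ?_).set hr (by norm_num) (by norm_num) ?_
        · simp; omega
        · simp; omega
        · simp [h.vd]; omega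
      all_goals simp [Com.run, h.vd])
  obtain ⟨-, hc, hvv, hok, -, -, ha⟩ := h2
  exact ⟨s', (Runs.seq hinit h1).mono (by omega), hc, hvv, hok, ha⟩

end

/-! ### The array of boxes -/

section

variable {d n X V : ℕ}

theorem run_seq (p q : Com) (s : Store) : (p ;; q).run s = q.run (p.run s) := rfl

theorem run_ite_pos {x : ℕ} {p q : Com} {s : Store} (h : s.v x ≠ 0) :
    (ite x p q).run s = p.run s := if_pos h

theorem run_ite_zero {x : ℕ} {p q : Com} {s : Store} (h : s.v x = 0) :
    (ite x p q).run s = q.run s := if_neg (not_not.mpr h)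

/-- The digits of a vertex are followed through the bisections until one of them removes the
vertex. -/
theorem runs_pathCom (hr : Room d n X V) {s : Store} (h : Consts d n X V s) :
    ∃ s', Runs X V pathCom s s' (2 * (d * n + 1) + 2) ∧ Consts d n X V s' ∧ s'.v xv = s.v xv ∧
      s'.v xh = cutBox d n (digit (2 * n) (s.v xv)) ∧ s'.a = s.a := by
  have h8 := hr.eight_mul_le
  have hsm := hr.small
  have hd : 0 < d := by have := hr.two_le_d; omega
  have hb := hr.base_le
  have hn := hr.two_le_n
  set x := digit (2 * n) (s.v xv) with hx
  set T := cutTime d n x with hT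
  have hTle : T ≤ d * Nat.log 2 n := cutTime_le hd x
  have hTn : T ≤ d * n := hTle.trans (Nat.mul_le_mul_left _ (Nat.log_le_self 2 n))
  have hg : ∀ j ≤ T, 2 ^ (j / d + 1) ≤ 2 * n := by
    intro j hj
    have h1 : j / d ≤ Nat.log 2 n := by
      rw [Nat.div_le_iff_le_mul_add_pred hd]
      omega
    have h2 : 2 ^ (j / d) ≤ n :=
      (Nat.pow_le_pow_right (by norm_num) h1).trans (Nat.pow_log_le_self 2 (by omega))
    rw [pow_succ]
    omega
  have hbb : (2 * n) * (2 * n) ≤ (2 * n) ^ d * (2 * n) ^ d := Nat.mul_le_mul hb hb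
  have h4 : 4 * (2 * n) ^ d * (2 * n) ^ d = 4 * ((2 * n) ^ d * (2 * n) ^ d) := by ring
  have hp : ∀ j, (2 * n) ^ (j % d + 1) ≤ (2 * n) ^ d := fun j =>
    Nat.pow_le_pow_right (by omega) (Nat.mod_lt j hd)
  have hbox : ∀ j ≤ T, boxAt d n x j < (2 * n) ^ d := fun j hj =>
    (boxAt_mono x hj).trans_lt (cutBox_lt hd (by omega) x)
  -- after the last iteration `T + 1`, only the number of the box and the end of the loop matter
  let Inv : ℕ → Store → Prop := fun j s' => Consts d n X V s' ∧ s'.v xv = s.v xv ∧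
    (j ≤ T → s'.v xgo = 1 ∧ s'.v xh = boxAt d n x j ∧ s'.v xp = (2 * n) ^ (j % d) ∧
      s'.v xg = 2 ^ (j / d + 1)) ∧
    (j = T + 1 → s'.v xgo = 0 ∧ s'.v xh = cutBox d n x) ∧ s'.a = s.a
  have hinit := Runs.base (X := X) (V := V)
    (p := set xh (lit 1) ;; set xp (lit 1) ;; set xg (lit 2) ;; set xgo (lit 1))
    ⟨trivial, trivial, trivial, trivial⟩ h.within
  obtain ⟨s', h1, h2⟩ := Runs.loop_count (X := X) (V := V) (x := xgo) (k := 1) (p := pathStep)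
    (T + 1) Inv
    (fun _ _ h => h.1.within)
    (fun i s hi h => by rw [(h.2.2.1 (by omega)).1]; norm_num)
    (fun s h => (h.2.2.2.1 rfl).1)
    (by
      rintro j t hj ⟨hc, hvv, hlow, -, ha⟩
      obtain ⟨hgo, hvh, hvp, hvg⟩ := hlow (by omega)
      refine ⟨_, Runs.base (p := pathStep)
        ⟨⟨trivial, trivial, trivial⟩, trivial, ⟨trivial, trivial, trivial⟩, trivial, trivial,
          trivial⟩
        hc.within, ?_⟩
      set y := x (j % d) with hy
      set g := 2 ^ (j / d + 1) with hgdef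
      have hgle : g ≤ 2 * n := hg j (by omega)
      have hylt : y < 2 * n := Nat.mod_lt _ (by omega)
      have hyg : y * g ≤ (2 * n) * (2 * n) := Nat.mul_le_mul hylt.le hgle
      have hyg' : (y + 1) * g ≤ (2 * n) * (2 * n) := Nat.mul_le_mul hylt hgle
      set cond := (y + 1) * g - (n + 1) * piece n g y with hcond
      have hcondV : cond ≤ V := by omega
      have hw : piece n g y ≤ V := by
        have : piece n g y ≤ y * g + n := Nat.div_le_self _ _
        omega
      have hrun : pathProbe.run t = ((t.set xx y).set xw (piece n g y)).set xc cond := by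
        have e1 : t.v xv / t.v xp % t.v xb = y := by rw [hvv, hvp, hc.vb]; rfl
        have e2 : (y * g + n) / (n + 1) = piece n g y := rfl
        simp only [pathProbe, Com.run, val_mod, val_div, val_var, e1]
        simp [hvg, hc.vn, e2, hcond]
      set t₁ := ((t.set xx y).set xw (piece n g y)).set xc cond with ht₁
      have hc₁ : Consts d n X V t₁ := ((hc.set hr (by norm_num) (by norm_num) (by omega)).set hr
        (by norm_num) (by norm_num) hw).set hr (by norm_num) (by norm_num) hcondV
      have hc1 : t₁.v xc = cond := by simp [ht₁]
      rw [pathStep, run_seq, hrun]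
      have honcut : cond ≠ 0 ↔ OnCut d n x j := by
        change cond ≠ 0 ↔ (n + 1) * piece n g y < (y + 1) * g
        omega
      by_cases hon : OnCut d n x j
      · have hjT : j = T := by
          by_contra hne
          exact not_onCut_of_lt (by omega : j < cutTime d n x) hon
        rw [run_ite_pos (by rw [hc1]; exact honcut.mpr hon),
          show (set xgo (lit 0)).run t₁ = t₁.set xgo 0 from rfl]
        refine ⟨hc₁.set hr (by norm_num) (by norm_num) (by omega), ?_, fun h => by omega,
          fun _ => ⟨by simp, ?_⟩, ?_⟩
        · simp [ht₁, hvv]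
        · simp [ht₁, hvh, cutBox, hjT, hT]
        · simp [ht₁, ha]
      · have hjT : j < T := by
          by_contra hne
          have : j = T := by omega
          exact hon (this ▸ onCut_cutTime hd x)
        have hbox' := hbox (j + 1) (by omega)
        have hg' := hg (j + 1) (by omega)
        have hpj := hp j
        have hmod := Nat.mod_lt j hd
        have hdm := Nat.div_add_mod j d
        set t₂ := ((t₁.set xh (boxAt d n x (j + 1))).set xp ((2 * n) ^ (j % d + 1))).set xc
          ((2 * n) ^ d - (2 * n) ^ (j % d + 1)) with ht₂
        have hc₂ : Consts d n X V t₂ := ((hc₁.set hr (by norm_num) (by norm_num) (by omega)).set hr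
          (by norm_num) (by norm_num) (by omega)).set hr (by norm_num) (by norm_num) (by omega)
        have hrun₂ : pathMove.run t₁ = t₂ := by
          have e1 : 2 * boxAt d n x j + (piece n g y + 1) % 2 = boxAt d n x (j + 1) := rfl
          simp only [pathMove, Com.run, val_mod, val_add, val_mul, val_sub, val_lit, val_var]
          simp [ht₁, ht₂, hvh, hvp, e1, hc.vb, hc.vK, ← pow_succ]
        have hcc : t₂.v xc = (2 * n) ^ d - (2 * n) ^ (j % d + 1) := by simp [ht₂]
        rw [run_ite_zero (by rw [hc1]; exact not_not.mp (fun e => hon (honcut.mp e))), run_seq,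
          hrun₂]
        by_cases hlast : j % d + 1 = d
        · have hz : (2 * n) ^ d - (2 * n) ^ (j % d + 1) = 0 := by rw [hlast]; omega
          have hj1 : j + 1 = d * (j / d + 1) := by rw [Nat.mul_succ]; omega
          have e1 : (j + 1) / d = j / d + 1 := by rw [hj1, Nat.mul_div_cancel_left _ hd]
          have e2 : (j + 1) % d = 0 := by rw [hj1, Nat.mul_mod_right]
          have e4 : 2 * g = 2 ^ ((j + 1) / d + 1) := by rw [e1, hgdef]; ring
          have hgg : (t₂.set xp 1).v xg = g := by simp [ht₂, ht₁, hvg]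
          have e3 : Com.run (set xp (lit 1) ;; set xg (lit 2 * var xg)) t₂ =
              (t₂.set xp 1).set xg (2 * g) := by
            simp only [Com.run, val_mul, val_lit, val_var, hgg]
          rw [run_ite_zero (by rw [hcc, hz]), e3]
          refine ⟨(hc₂.set hr (by norm_num) (by norm_num) (by omega)).set hr (by norm_num)
            (by norm_num) (by omega), ?_, fun _ => ⟨?_, ?_, ?_, ?_⟩, fun h => by omega, ?_⟩
          · simp [ht₂, ht₁, hvv]
          · simp [ht₂, ht₁, hgo]
          · simp [ht₂]
          · simp [e2]
          · rw [← e4]; simp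
          · simp [ht₂, ht₁, ha]
        · have hlt : (2 * n) ^ (j % d + 1) < (2 * n) ^ d :=
            Nat.pow_lt_pow_right (by omega) (by omega)
          have hj1 : j + 1 = (j % d + 1) + d * (j / d) := by omega
          have e1 : (j + 1) / d = j / d := by
            conv_lhs => rw [hj1, Nat.add_mul_div_left _ _ hd, Nat.div_eq_of_lt (by omega)]
            omega
          have e2 : (j + 1) % d = j % d + 1 := by
            conv_lhs => rw [hj1, Nat.add_mul_mod_self_left, Nat.mod_eq_of_lt (by omega)]
          rw [run_ite_pos (by rw [hcc]; omega), show skip.run t₂ = t₂ from rfl]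
          refine ⟨hc₂, ?_, fun _ => ⟨?_, ?_, ?_, ?_⟩, fun h => by omega, ?_⟩
          · simp [ht₂, ht₁, hvv]
          · simp [ht₂, ht₁, hgo]
          · simp [ht₂]
          · simp [ht₂, e2]
          · rw [e1, ← hgdef]; simp [ht₂, ht₁, hvg]
          · simp [ht₂, ht₁, ha])
    (s := Com.run (set xh (lit 1) ;; set xp (lit 1) ;; set xg (lit 2) ;; set xgo (lit 1)) s)
    (by
      refine ⟨?_, ?_, fun _ => ?_, fun h => by omega, ?_⟩
      · simp only [Com.run]
        refine (((h.set hr (by norm_num) (by norm_num) ?_).set hr (by norm_num) (by norm_num)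
          ?_).set hr (by norm_num) (by norm_num) ?_).set hr (by norm_num) (by norm_num) ?_
        all_goals simp; omega
      all_goals simp [Com.run, boxAt])
  obtain ⟨hc, hvv, -, hfin, ha⟩ := h2
  exact ⟨s', (Runs.seq hinit h1).mono (by omega), hc, hvv, (hfin rfl).2, ha⟩

/-- A bound for the cost of one entry of the array of boxes. -/
def entryCost (d n : ℕ) : ℕ := 2 * d + 2 * (d * n) + 9

theorem runs_cutStep (hr : Room d n X V) {s : Store} (h : Consts d n X V s) {v : ℕ}
    (hv : s.v xv = v + 1) (hvK : v < (2 * n) ^ d) (h0 : s.a aCut v = 0) :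
    ∃ s', Runs X V cutStep s s' (entryCost d n) ∧ Consts d n X V s' ∧ s'.v xv = v ∧
      (∀ c, s'.a aCut c = if c = v then cutArray d n v else s.a aCut c) ∧
      ∀ k, k ≠ 0 → s'.a k = s.a k := by
  have h8 := hr.eight_mul_le
  have hX := hr.index
  have hstart := Runs.base (X := X) (V := V) (p := set xv (var xv - lit 1)) trivial h.within
  set s₀ := s.set xv v with hs₀
  have e0 : Com.run (set xv (var xv - lit 1)) s = s₀ := by simp [Com.run, hv, hs₀]
  rw [e0] at hstart
  have hc₀ : Consts d n X V s₀ := h.set hr (by norm_num) (by norm_num) (by omega)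
  have hv₀ : s₀.v xv = v := by simp [hs₀]
  obtain ⟨s₁, r1, c1, v1, ok1, a1⟩ := runs_validCom hr hc₀ (by rw [hv₀]; exact hvK)
  rw [hv₀] at v1 ok1
  by_cases hok : s₁.v xok = 0
  · have hcut : cutArray d n v = 0 := by
      rw [cutArray, if_neg]
      exact fun hh => (ok1.mpr hh.2) hok
    have r2 : Runs X V (ite xok entryCom skip) s₁ s₁ (1 + 1) :=
      Runs.ite_zero c1.within hok (Runs.base (p := skip) trivial c1.within)
    refine ⟨s₁, (Runs.seq hstart (Runs.seq r1 r2)).mono (by unfold entryCost; omega), c1, v1,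
      fun c => ?_, fun k _ => by rw [a1]; rfl⟩
    rw [a1]
    split_ifs with hcv
    · rw [hcv, hcut]; exact h0
    · rfl
  · obtain ⟨s₂, r2, c2, v2, w2, a2⟩ := runs_pathCom hr c1
    rw [v1] at v2 w2
    have hcut : cutArray d n v = s₂.v xh := by
      rw [cutArray, if_pos ⟨hvK, ok1.mp hok⟩, w2]
    have hput := Runs.base (X := X) (V := V) (p := put aCut (var xv) (var xh)) trivial c2.within
    have e2 : Com.run (put aCut (var xv) (var xh)) s₂ = s₂.put aCut v (cutArray d n v) := by
      simp [Com.run, v2, hcut]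
    rw [e2] at hput
    have r3 : Runs X V entryCom s₁ (s₂.put aCut v (cutArray d n v)) (2 * (d * n + 1) + 2 + 1) :=
      Runs.seq r2 hput
    have r4 := Runs.ite_pos (q := skip) c1.within hok r3
    refine ⟨_, (Runs.seq hstart (Runs.seq r1 r4)).mono (by unfold entryCost; omega),
      c2.put (by omega) (by rw [hcut]; exact c2.within.var_le _), v2, fun c => ?_, fun k hk => ?_⟩
    · rw [Store.put_a, a2, a1]
      by_cases hcv : c = v <;> simp [hcv, hs₀]
    · funext c
      rw [Store.put_a, if_neg (fun hh => hk hh.1), a2, a1]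
      rfl

theorem runs_cutCom (hr : Room d n X V) {s : Store} (h : Consts d n X V s)
    (h0 : s.a = fun _ _ => 0) :
    ∃ s', Runs X V cutCom s s' ((2 * n) ^ d * (entryCost d n + 1) + 2) ∧ Consts d n X V s' ∧
      (∀ c, s'.a aCut c = cutArray d n c) ∧ ∀ k, k ≠ 0 → s'.a k = fun _ => 0 := by
  have h8 := hr.eight_mul_le
  let Inv : ℕ → Store → Prop := fun j s' => j ≤ (2 * n) ^ d ∧ Consts d n X V s' ∧
    s'.v xv = (2 * n) ^ d - j ∧
    (∀ c, s'.a aCut c = if (2 * n) ^ d - j ≤ c then cutArray d n c else 0) ∧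
    ∀ k, k ≠ 0 → s'.a k = fun _ => 0
  have hinit := Runs.base (X := X) (V := V) (p := set xv (var xK)) trivial h.within
  obtain ⟨s', h1, h2⟩ := Runs.loop_count (X := X) (V := V) (x := xv) (k := entryCost d n)
    (p := cutStep) ((2 * n) ^ d) Inv
    (fun _ _ h => h.2.1.within)
    (fun i s hi h => by rw [h.2.2.1]; omega)
    (fun s h => by rw [h.2.2.1]; omega)
    (by
      rintro j t hj ⟨-, hc, hv, hcut, ha⟩
      obtain ⟨t', r, c', v', cut', a'⟩ := runs_cutStep hr hc (v := (2 * n) ^ d - (j + 1))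
        (by omega) (by omega) (by rw [hcut, if_neg (by omega)])
      refine ⟨t', r, by omega, c', v', fun c => ?_, fun k hk => (a' k hk).trans (ha k hk)⟩
      rw [cut' c]
      by_cases hcv : c = (2 * n) ^ d - (j + 1)
      · rw [if_pos hcv, if_pos (by omega), hcv]
      · rw [if_neg hcv, hcut]
        by_cases hle : (2 * n) ^ d - j ≤ c
        · rw [if_pos hle, if_pos (by omega)]
        · rw [if_neg hle, if_neg (by omega)])
    (s := Com.run (set xv (var xK)) s)
    (by
      refine ⟨by omega, ?_, ?_, fun c => ?_, fun k _ => ?_⟩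
      · simp only [Com.run]
        refine h.set hr (by norm_num) (by norm_num) ?_
        simp [h.vK]; omega
      · simp [Com.run, h.vK]
      · simp only [Com.run, Store.set_a, h0]
        split_ifs with hle
        · rw [cutArray, if_neg (by omega)]
        · rfl
      · simp [Com.run, h0])
  obtain ⟨-, hc, -, hcut, ha⟩ := h2
  refine ⟨s', (Runs.seq hinit h1).mono (by omega), hc, fun c => ?_, ha⟩
  rw [hcut, if_pos (by omega)]

end

/-! ### The whole computation -/

/-- The start of the recursion. -/
def startCom : Com := set xq (lit 1) ;; set xv (lit 0) ;; set xup (lit 0) ;; set xgo (lit 1)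

/-- The recursion. -/
def evalCom : Com := startCom ;; loop xgo stepCom

/-- One factor of the power of the base that belongs to the perfect matchings. -/
def digitStep : Com := set xw (var xw * var xB) ;; set xi (var xi - lit 1)

/-- The digit of the value that counts the perfect matchings. -/
def digitCom : Com :=
  ((set xr (Ex.mod (var xr) (var xM)) ;; set xw (lit 1) ;; set xi (var xN / lit 2)) ;;
    loop xi digitStep) ;;
  set xd (Ex.mod (var xr / var xw) (var xB))

/-- The number of perfect matchings of a grid of side length at least `2`. -/
def mainCom : Com := set xc (lit 0) ;; powCom ;; baseCom ;; modCom ;; cutCom ;; evalCom ;; digitCom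

/-- The number of perfect matchings of a grid. If the side length `n` is at most `1`, the number is
`1 - n`. -/
def gridCom : Com := set xc (var xn - lit 1) ;; ite xc mainCom (set xd (lit 1 - var xn))

section

variable {d n X V : ℕ}

/-- The exponent of the running time: the sum of bounds for the cuts on all levels. Boxes on level
`((2 * n) ^ d).size` have numbers of more than `(2 * n) ^ d` and are not bisected. -/
def gridExponent (d n : ℕ) : ℕ :=
  ∑ i ∈ Finset.range (((2 * n) ^ d).size + 1), cutSize d n i

theorem runs_evalCom (hr : Room d n X V) {s : Store} (h : Consts d n X V s)
    (hcut : ∀ c, s.a aCut c = cutArray d n c) (hmark : s.a aMark = fun _ => 0) :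
    ∃ s', Runs X V evalCom s s'
        (stepCost d * ((3 * (2 * n) ^ d + 3) * (4 * (2 * n) ^ d) * 2 ^ gridExponent d n) +
          stepCost d + 2) ∧
      Consts d n X V s' ∧ s'.v xr = gridSum d n Finset.univ ∅ := by
  have h8 := hr.eight_mul_le
  have hK : 0 < (2 * n) ^ d := by have := hr.base_le; have := hr.two_le_n; omega
  have hstart := Runs.base (X := X) (V := V) (p := startCom) ⟨trivial, trivial, trivial, trivial⟩
    h.within
  set s₁ := (((s.set xq 1).set xv 0).set xup 0).set xgo 1 with hs₁
  have e : startCom.run s = s₁ := rfl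
  rw [e] at hstart
  have i₁ : EvalInv d n X V s₁ 1 0 0 ∅ :=
    { toConsts := (((h.set hr (by norm_num) (by norm_num) (by omega)).set hr (by norm_num)
        (by norm_num) (by omega)).set hr (by norm_num) (by norm_num) (by omega)).set hr
        (by norm_num) (by norm_num) (by omega)
      vq := by simp [hs₁]
      vv := by simp [hs₁]
      vup := by simp [hs₁]
      vgo := by simp [hs₁]
      cut := hcut
      mark := fun c => by
        simp only [hs₁, Store.set_a, hmark]
        simp [marks] }
  obtain ⟨s₂, r₂, e₂⟩ := evaluated_box hr ((2 * n) ^ d).size 0 1 ∅ s₁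
    (by rw [zero_add]; exact (Nat.lt_size_self _).le) (by norm_num) (by norm_num) (by omega) i₁
    (Finset.disjoint_empty_right _)
  have r₃ := e₂.inv.up_return
  set s₃ := (s₂.set xc 0).set xgo 0 with hs₃
  have e₃ : returnCom.run s₂ = s₃ := by
    simp only [returnCom, Com.run, val_sub, val_var, val_lit, e₂.inv.vq]
    simp [hs₃]
  rw [e₃] at r₃
  have c₃ : Consts d n X V s₃ := (e₂.inv.toConsts.set hr (by norm_num) (by norm_num) (by omega)).set
    hr (by norm_num) (by norm_num) (by omega)
  have hloop := (r₂.trans r₃) _ _ (Runs.loop_done c₃.within (by simp [hs₃]))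
  refine ⟨s₃, (Runs.seq hstart hloop).mono ?_, c₃, ?_⟩
  -- the number of boxes that are visited for fixed decisions is polynomial
  · have hsize : 2 ^ (((2 * n) ^ d).size + 1) - 1 ≤ 4 * (2 * n) ^ d := by
      obtain ⟨k, hk⟩ : ∃ k, ((2 * n) ^ d).size = k + 1 :=
        ⟨_, (Nat.succ_pred_eq_of_pos (Nat.size_pos.mpr hK)).symm⟩
      have : 2 ^ k ≤ (2 * n) ^ d := Nat.lt_size.mp (by omega)
      rw [hk, pow_succ, pow_succ]
      omega
    have hexp : ∑ i ∈ Finset.range (((2 * n) ^ d).size + 1), cutSize d n (0 + i) =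
        gridExponent d n := by simp [gridExponent]
    rw [hexp]
    have := Nat.mul_le_mul_left (stepCost d) (Nat.mul_le_mul_right (2 ^ gridExponent d n)
      (Nat.mul_le_mul_left (3 * (2 * n) ^ d + 3) hsize))
    omega
  · rw [show s₃.v xr = s₂.v xr by simp [hs₃], e₂.value, boxRest_root]

theorem runs_digitCom (hr : Room d n X V) {s : Store} (h : Consts d n X V s) :
    ∃ s', Runs X V digitCom s s' (2 * n ^ d + 3) ∧
      s'.v xd = s.v xr % gridM d n / gridB d n ^ (n ^ d / 2) % gridB d n := by
  have h8 := hr.eight_mul_le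
  have hNK := pow_le_two_mul_pow (d := d) (n := n)
  have hB2 := two_le_gridB (d := d) (n := n)
  have hBM := gridB_lt_gridM (d := d) (n := n)
  have hp : ∀ j ≤ n ^ d / 2, gridB d n ^ j ≤ V := fun j hj =>
    ((Nat.pow_le_pow_left hBM.le j).trans
      (Nat.pow_le_pow_right (by omega) (by omega))).trans hr.power
  let Inv : ℕ → Store → Prop := fun j s' => Consts d n X V s' ∧
    s'.v xr = s.v xr % gridM d n ∧ s'.v xw = gridB d n ^ j ∧ s'.v xi = n ^ d / 2 - j
  have hinit := Runs.base (X := X) (V := V)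
    (p := set xr (Ex.mod (var xr) (var xM)) ;; set xw (lit 1) ;; set xi (var xN / lit 2))
    ⟨trivial, trivial, trivial⟩ h.within
  set s₁ := ((s.set xr (s.v xr % gridM d n)).set xw 1).set xi (n ^ d / 2) with hs₁
  have e₁ : Com.run (set xr (Ex.mod (var xr) (var xM)) ;; set xw (lit 1) ;;
      set xi (var xN / lit 2)) s = s₁ := by
    simp only [Com.run, val_mod, val_var, h.vM, val_lit, val_div]
    simp [hs₁, h.vN]
  rw [e₁] at hinit
  obtain ⟨s', h1, hc, hvr, hvw, -⟩ := Runs.loop_count (X := X) (V := V) (x := xi) (k := 1)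
    (p := digitStep) (n ^ d / 2) Inv
    (fun _ _ h => h.1.within)
    (fun i s hi h => by rw [h.2.2.2]; omega)
    (fun s h => by rw [h.2.2.2]; omega)
    (by
      rintro j t hj ⟨hc, hvr, hvw, hvi⟩
      refine ⟨(t.set xw (gridB d n ^ (j + 1))).set xi (n ^ d / 2 - (j + 1)), ?_, ?_, ?_, ?_, ?_⟩
      · have := Runs.base (X := X) (V := V) (p := digitStep) ⟨trivial, trivial⟩ hc.within
        have e : digitStep.run t =
            (t.set xw (gridB d n ^ (j + 1))).set xi (n ^ d / 2 - (j + 1)) := by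
          simp only [digitStep, Com.run, val_mul, val_var, hvw, hc.vB, val_sub, val_lit]
          simp [hvi, pow_succ, Nat.sub_sub]
        rwa [e] at this
      · exact (hc.set hr (by norm_num) (by norm_num) (hp _ (by omega))).set hr (by norm_num)
          (by norm_num) (by omega)
      all_goals simp [hvr])
    (s := s₁)
    ⟨((h.set hr (by norm_num) (by norm_num) ((Nat.mod_le _ _).trans (h.within.var_le _))).set hr
      (by norm_num) (by norm_num) (by omega)).set hr (by norm_num) (by norm_num) (by omega),
      by simp [hs₁], by simp [hs₁], by simp [hs₁]⟩
  have hlast := Runs.base (X := X) (V := V) (p := set xd (Ex.mod (var xr / var xw) (var xB)))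
    trivial hc.within
  refine ⟨_, (Runs.seq (Runs.seq hinit h1) hlast).mono (by omega), ?_⟩
  simp only [Com.run, val_mod, val_div, val_var, hvr, hvw, hc.vB]
  simp

/-- The value of the recursion determines the number of perfect matchings. -/
theorem gridSum_univ_mod :
    gridSum d n Finset.univ ∅ % gridM d n / gridB d n ^ (n ^ d / 2) % gridB d n =
      numPerfectMatchings (gridGraph d n) := by
  have hE := card_edgeFinset_gridGraph_le (d := d) (n := n)
  have hB2 := two_le_gridB (d := d) (n := n)
  have hlt : ∑ F ∈ edgeCovers (gridGraph d n), gridB d n ^ F.card < gridM d n := by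
    refine (sum_edgeCovers_le _ _).trans_lt ?_
    unfold gridM
    exact Nat.pow_lt_pow_right (by omega) (by omega)
  have hdigit := sum_edgeCovers_digit (gridGraph d n) (B := gridB d n)
    (by unfold gridB; exact Nat.pow_lt_pow_right (by norm_num) (by omega))
  rw [gridSum, partitionSum_mod _ (by omega) hlt, ← hdigit]
  simp

/-- A bound for the cost of `gridCom` apart from the exponential factor. -/
def gridOverhead (d n : ℕ) : ℕ :=
  stepCost d * ((3 * (2 * n) ^ d + 3) * (4 * (2 * n) ^ d)) + stepCost d +
    (2 * n) ^ d * (entryCost d n + 1) + 4 * (d * n ^ d) + 2 * n ^ d + 2 * d + 20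

/-- The store for the input. -/
def inputStore (d n : ℕ) : Store :=
  ⟨fun x => if x = 0 then d else if x = 1 then n else 0, fun _ _ => 0⟩

theorem within_inputStore (hX : 2 ≤ X) (hd : d ≤ V) (hn : n ≤ V) :
    (inputStore d n).Within X V where
  var x := by
    simp only [inputStore]
    split_ifs <;> omega
  var_le x := by
    simp only [inputStore]
    split_ifs <;> omega
  arr k i h := absurd rfl h
  arr_le k i := Nat.zero_le V

theorem runs_gridCom (hr : Room d n X V) :
    ∃ s', Runs X V gridCom (inputStore d n) s' (gridOverhead d n * 2 ^ gridExponent d n) ∧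
      s'.v xd = numPerfectMatchings (gridGraph d n) := by
  have h8 := hr.eight_mul_le
  have hd := hr.d_le
  have hb := hr.base_le
  have hX := hr.index
  have hn := hr.two_le_n
  have hw₀ : (inputStore d n).Within X V := within_inputStore (by omega) (by omega) (by omega)
  have r₀ := Runs.base (X := X) (V := V) (p := set xc (var xn - lit 1)) trivial hw₀
  set s₀ := (inputStore d n).set xc (n - 1) with hs₀
  have e₀ : (set xc (var xn - lit 1)).run (inputStore d n) = s₀ := rfl
  rw [e₀] at r₀
  have hws₀ : s₀.Within X V := hw₀.set (by omega) (by omega)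
  have r₁ := Runs.base (X := X) (V := V) (p := set xc (lit 0)) trivial hws₀
  set s₁ := s₀.set xc 0 with hs₁
  have e₁ : (set xc (lit 0)).run s₀ = s₁ := rfl
  rw [e₁] at r₁
  have hws₁ : s₁.Within X V := hws₀.set (by omega) (by omega)
  obtain ⟨s₂, r₂, w₂, d₂, n₂, b₂, K₂, N₂, a₂⟩ := runs_powCom hr hws₁
    (by simp [hs₁, hs₀, inputStore]) (by simp [hs₁, hs₀, inputStore]) rfl
  obtain ⟨s₃, r₃, w₃, d₃, n₃, b₃, K₃, N₃, B₃, a₃⟩ := runs_baseCom hr w₂ d₂ n₂ b₂ K₂ N₂ a₂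
  obtain ⟨s₄, r₄, c₄, a₄⟩ := runs_modCom hr w₃ d₃ n₃ b₃ K₃ N₃ B₃ a₃
  obtain ⟨s₅, r₅, c₅, cut₅, a₅⟩ := runs_cutCom hr c₄ a₄
  obtain ⟨s₆, r₆, c₆, v₆⟩ := runs_evalCom hr c₅ cut₅ (a₅ _ (by decide))
  obtain ⟨s₇, r₇, v₇⟩ := runs_digitCom hr c₆
  have rmain := Runs.seq r₁ (Runs.seq r₂ (Runs.seq r₃ (Runs.seq r₄ (Runs.seq r₅
    (Runs.seq r₆ r₇)))))
  have hne : s₀.v xc ≠ 0 := by simp [hs₀]; omega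
  have rite := Runs.ite_pos (q := set xd (lit 1 - var xn)) hws₀ hne rmain
  refine ⟨s₇, (Runs.seq r₀ rite).mono ?_, ?_⟩
  · have hP : 1 ≤ 2 ^ gridExponent d n := Nat.one_le_two_pow
    set P := 2 ^ gridExponent d n
    set R := stepCost d + (2 * n) ^ d * (entryCost d n + 1) + 4 * (d * n ^ d) + 2 * n ^ d +
      2 * d + 20 with hR
    have h1 : R ≤ R * P := Nat.le_mul_of_pos_right _ hP
    have h2 : gridOverhead d n * P =
        stepCost d * ((3 * (2 * n) ^ d + 3) * (4 * (2 * n) ^ d) * P) + R * P := by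
      rw [hR]; unfold gridOverhead; ring
    rw [h2]
    omega
  · rw [v₇, v₆, gridSum_univ_mod]

theorem numPerfectMatchings_gridGraph_of_le_one (hd : d ≠ 0) (hn : n ≤ 1) :
    numPerfectMatchings (gridGraph d n) = 1 - n := by
  have hcard : Fintype.card (Fin d → Fin n) = n := by
    rw [Fintype.card_fun, Fintype.card_fin, Fintype.card_fin]
    interval_cases n <;> simp [hd]
  rw [numPerfectMatchings_eq_card, hcard]
  interval_cases n
  · have hE : (gridGraph d 0).edgeFinset = ∅ := by
      have := card_edgeFinset_gridGraph_le (d := d) (n := 0)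
      rwa [zero_pow hd, mul_zero, Nat.le_zero, Finset.card_eq_zero] at this
    have : IsEmpty (Fin d → Fin 0) := Fintype.card_eq_zero_iff.mp hcard
    have hC : edgeCovers (gridGraph d 0) = {∅} := by
      rw [edgeCovers, hE, Finset.powerset_empty, Finset.filter_true_of_mem]
      exact fun F _ v => this.elim v
    rw [hC]
    rfl
  · rw [Finset.filter_false_of_mem fun F _ => by omega]
    rfl

theorem runs_gridCom_of_le_one (hd : d ≠ 0) (hn : n ≤ 1) (hX : 20 ≤ X) (hV : d + 1 ≤ V) :
    ∃ s', Runs X V gridCom (inputStore d n) s' 3 ∧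
      s'.v xd = numPerfectMatchings (gridGraph d n) := by
  have hw₀ : (inputStore d n).Within X V := within_inputStore (by omega) (by omega) (by omega)
  have r₀ := Runs.base (X := X) (V := V) (p := set xc (var xn - lit 1)) trivial hw₀
  set s₀ := (inputStore d n).set xc (n - 1) with hs₀
  have e₀ : (set xc (var xn - lit 1)).run (inputStore d n) = s₀ := rfl
  rw [e₀] at r₀
  have hws₀ : s₀.Within X V := hw₀.set (by omega) (by omega)
  have hz : s₀.v xc = 0 := by simp [hs₀]; omega
  have r₁ := Runs.ite_zero (p := mainCom) hws₀ hz
    (Runs.base (p := set xd (lit 1 - var xn)) trivial hws₀)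
  refine ⟨_, (Runs.seq r₀ r₁).mono (by omega), ?_⟩
  rw [numPerfectMatchings_gridGraph_of_le_one hd hn]
  simp [Com.run, hs₀, inputStore]

end

/-! ### The RAM program -/

/-- The program that moves the second input to the register `8` of its variable; register `6` is
empty, and register `1`, which holds the input, is a scratch register. -/
def moveProg : Prog := .seq (.instr (.arith .add 8 1 6)) (.instr (.const 1 0))

/-- The RAM program that counts the perfect matchings of a grid. -/
def gridProg : Prog := .seq moveProg gridCom.compile

section

variable {d n X V : ℕ}

theorem input_apply (d n a : ℕ) : (Finsupp.single 0 d + Finsupp.single 1 n : Mem) a =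
    if a = 0 then d else if a = 1 then n else 0 := by
  rw [Finsupp.add_apply, Finsupp.single_apply, Finsupp.single_apply]
  split_ifs <;> omega

theorem rep_inputStore (d n : ℕ) :
    Rep (inputStore d n) (moveProg.run (Finsupp.single 0 d + Finsupp.single 1 n)) := by
  have key : ∀ a, moveProg.run (Finsupp.single 0 d + Finsupp.single 1 n) a =
      if a = 0 then d else if a = 8 then n else 0 := by
    intro a
    simp only [moveProg, Prog.run, Instr.apply, Finsupp.update_apply, input_apply, Op.eval]
    split_ifs <;> first | omega | contradiction
  refine ⟨fun x => ?_, fun u => ?_, fun k i => ?_, fun u => ?_, fun u => ?_⟩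
  · rw [key]
    simp only [inputStore]
    split_ifs <;> omega
  · rw [key, if_neg (by omega), if_neg (by omega)]
  · have := k.2
    rw [key, if_neg (by omega), if_neg (by omega)]
    rfl
  · rw [key, if_neg (by omega), if_neg (by omega)]
  · rw [key, if_neg (by omega), if_neg (by omega)]

theorem fits_input (hX : 1 ≤ X) (hd : d ≤ V) (hn : n ≤ V) :
    Mem.Fits (Finsupp.single 0 d + Finsupp.single 1 n) (8 * X) (bits X V) := by
  constructor
  · have : (Finsupp.single 0 d + Finsupp.single 1 n : Mem).support ⊆ Finset.range 2 := by
      intro a ha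
      rw [Finsupp.mem_support_iff, input_apply] at ha
      rw [Finset.mem_range]
      split_ifs at ha <;> omega
    refine (Finset.card_le_card this).trans ?_
    rw [Finset.card_range]
    omega
  · intro a ha
    have h1 := Nat.size_le_size hd
    have h2 := Nat.size_le_size hn
    have h3 : a < 2 := by
      rw [input_apply] at ha
      split_ifs at ha <;> omega
    have h4 : a.size ≤ 1 := Nat.size_le.mpr (by omega)
    rw [input_apply]
    unfold bits
    refine ⟨by omega, ?_⟩
    split_ifs
    · omega
    · omega
    · simp

/-- The constant factor for the program. -/
def gridCst : ℕ := moveProg.cst + gridCom.compile.cst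

theorem computes_of_runs (hX : 1 ≤ X) (hd : d ≤ V) (hn : n ≤ V) {s' : Store} {k : ℕ}
    (h : Runs X V gridCom (inputStore d n) s' k) :
    ∃ t sp, gridProg.Computes d n (s'.v xd) t sp ∧ t ≤ gridCst * ((k + 1) * bits X V ^ 2) ∧
      sp ≤ gridCst * ((8 * X + 1) * bits X V) := by
  obtain ⟨t₁, sp₁, h1, h2, h3, -⟩ := moveProg.exec_run ⟨trivial, trivial⟩
    (fits_input hX hd hn) (one_le_bits X V)
  obtain ⟨t₂, sp₂, m, g1, g2, g3, g4⟩ := h _ (rep_inputStore d n)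
  refine ⟨_, _, ⟨m, Exec.seq h1 g1, g2.var 0⟩, ?_, max_le ?_ ?_⟩
  · refine (Nat.add_le_add h2 g3).trans ?_
    unfold gridCst
    calc moveProg.cst * bits X V ^ 2 + k * (gridCom.compile.cst * bits X V ^ 2)
        ≤ moveProg.cst * ((k + 1) * bits X V ^ 2) +
          gridCom.compile.cst * ((k + 1) * bits X V ^ 2) := by
          refine Nat.add_le_add (Nat.mul_le_mul_left _ (Nat.le_mul_of_pos_left _ (by omega))) ?_
          rw [mul_left_comm]
          exact Nat.mul_le_mul_left _ (Nat.mul_le_mul_right _ (by omega))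
      _ = _ := by ring
  · exact h3.trans (Nat.mul_le_mul_right _ (by unfold gridCst; omega))
  · exact g4.trans (Nat.mul_le_mul_right _ (by unfold gridCst; omega))

end

/-! ### Polynomial bounds -/

/-- A function of the dimension and the side length is bounded by a polynomial in the size of the
grid, for side lengths of at least `2`. -/
def PolyBounded (f : ℕ → ℕ → ℕ) : Prop :=
  ∃ p : Polynomial ℕ, ∀ d n, 2 ≤ d → 2 ≤ n → f d n ≤ p.eval (d + n ^ d)

namespace PolyBounded

variable {f g : ℕ → ℕ → ℕ}

theorem mono (hg : PolyBounded g) (h : ∀ d n, 2 ≤ d → 2 ≤ n → f d n ≤ g d n) : PolyBounded f := by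
  obtain ⟨p, hp⟩ := hg
  exact ⟨p, fun d n hd hn => (h d n hd hn).trans (hp d n hd hn)⟩

theorem add (hf : PolyBounded f) (hg : PolyBounded g) : PolyBounded fun d n => f d n + g d n := by
  obtain ⟨p, hp⟩ := hf
  obtain ⟨q, hq⟩ := hg
  refine ⟨p + q, fun d n hd hn => ?_⟩
  rw [Polynomial.eval_add]
  exact Nat.add_le_add (hp d n hd hn) (hq d n hd hn)

theorem mul (hf : PolyBounded f) (hg : PolyBounded g) : PolyBounded fun d n => f d n * g d n := by
  obtain ⟨p, hp⟩ := hf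
  obtain ⟨q, hq⟩ := hg
  refine ⟨p * q, fun d n hd hn => ?_⟩
  rw [Polynomial.eval_mul]
  exact Nat.mul_le_mul (hp d n hd hn) (hq d n hd hn)

theorem const (c : ℕ) : PolyBounded fun _ _ => c :=
  ⟨Polynomial.C c, fun d n _ _ => by rw [Polynomial.eval_C]⟩

theorem size_grid : PolyBounded fun d n => d + n ^ d :=
  ⟨Polynomial.X, fun d n _ _ => by rw [Polynomial.eval_X]⟩

theorem dim : PolyBounded fun d _ => d := size_grid.mono fun d n _ _ => by omega

theorem card : PolyBounded fun d n => n ^ d := size_grid.mono fun d n _ _ => by omega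

theorem side : PolyBounded fun _ n => n :=
  card.mono fun d n hd _ => Nat.le_self_pow (by omega) n

/-- This is where a side length of at least `2` is needed: `(2 * n) ^ d ≤ (n ^ 2) ^ d`. -/
theorem codes : PolyBounded fun d n => (2 * n) ^ d :=
  (card.mul card).mono fun d n _ hn => by
    rw [mul_pow]
    exact Nat.mul_le_mul_right _ (Nat.pow_le_pow_left hn d)

theorem size (hf : PolyBounded f) : PolyBounded fun d n => (f d n).size :=
  hf.mono fun _ _ _ _ => Nat.size_le.mpr Nat.lt_two_pow_self

theorem size_add (hf : PolyBounded fun d n => (f d n).size)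
    (hg : PolyBounded fun d n => (g d n).size) :
    PolyBounded fun d n => (f d n + g d n).size :=
  ((hf.add hg).add (const 1)).mono fun _ _ _ _ => size_add_le _ _

theorem size_pow (hf : PolyBounded fun d n => (f d n).size) (hg : PolyBounded g) :
    PolyBounded fun d n => (f d n ^ g d n).size :=
  ((hf.mul hg).add (const 1)).mono fun d n _ _ => by
    rw [Nat.size_le, pow_succ, pow_mul]
    have h1 := Nat.pow_le_pow_left (Nat.lt_size_self (f d n)).le (g d n)
    have h2 : 0 < (2 ^ (f d n).size) ^ g d n := by positivity
    omega

end PolyBounded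

/-- The bound for the indices of the variables and of the array entries. -/
def indexBound (d n : ℕ) : ℕ := 2 * (2 * n) ^ d + 20

/-- The bound for the values. -/
def valueBound (d n : ℕ) : ℕ :=
  gridM d n ^ (2 * n ^ d + 2) + (4 * (2 * n) ^ d * (2 * n) ^ d + d * n ^ d + 10)

theorem room_bounds {d n : ℕ} (hd : 2 ≤ d) (hn : 2 ≤ n) :
    Room d n (indexBound d n) (valueBound d n) :=
  ⟨hd, hn, le_rfl, Nat.le_add_right _ _, Nat.le_add_left _ _⟩

theorem polyBounded_indexBound : PolyBounded indexBound :=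
  ((PolyBounded.const 2).mul .codes).add (.const 20)

theorem polyBounded_bits : PolyBounded fun d n => bits (indexBound d n) (valueBound d n) := by
  have hE : PolyBounded fun d n => d * n ^ d + 1 := (PolyBounded.dim.mul .card).add (.const 1)
  have hB : PolyBounded fun d n => (gridB d n).size := ((PolyBounded.const 2).size).size_pow hE
  have hM : PolyBounded fun d n => (gridM d n).size :=
    ((PolyBounded.const 1).size.size_add hB).size_pow hE
  have h1 := hM.size_pow (((PolyBounded.const 2).mul .card).add (.const 2))
  have h2 := ((((PolyBounded.const 4).mul .codes).mul .codes).add (PolyBounded.dim.mul .card)).add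
    (.const 10)
  exact ((((PolyBounded.const 8).mul polyBounded_indexBound).size.add (h1.size_add h2.size))).add
    (.const 1)

theorem polyBounded_gridOverhead : PolyBounded gridOverhead := by
  have hs : PolyBounded fun d _ => stepCost d := ((PolyBounded.const 2).mul .dim).add (.const 12)
  have he : PolyBounded entryCost :=
    (((PolyBounded.const 2).mul .dim).add
      ((PolyBounded.const 2).mul (PolyBounded.dim.mul .side))).add (.const 9)
  have hK := PolyBounded.codes
  exact ((((((hs.mul ((((PolyBounded.const 3).mul hK).add (.const 3)).mul
    ((PolyBounded.const 4).mul hK))).add hs).add (hK.mul (he.add (.const 1)))).add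
    ((PolyBounded.const 4).mul (PolyBounded.dim.mul .card))).add
    ((PolyBounded.const 2).mul .card)).add ((PolyBounded.const 2).mul .dim)).add (.const 20)

/-- The computation for side lengths of at least `2`. -/
theorem exists_poly_computes : ∃ p : Polynomial ℕ, ∀ d n, 2 ≤ d → 2 ≤ n →
    ∃ t s, gridProg.Computes d n (numPerfectMatchings (gridGraph d n)) t s ∧
      t ≤ p.eval (d + n ^ d) * 2 ^ gridExponent d n ∧ s ≤ p.eval (d + n ^ d) := by
  have hσ := polyBounded_bits
  obtain ⟨p, hp⟩ := (PolyBounded.const gridCst).mul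
    ((polyBounded_gridOverhead.add (.const 1)).mul (hσ.mul hσ))
  obtain ⟨q, hq⟩ := (PolyBounded.const gridCst).mul
    ((((PolyBounded.const 8).mul polyBounded_indexBound).add (.const 1)).mul hσ)
  refine ⟨p + q, fun d n hd hn => ?_⟩
  have hr := room_bounds hd hn
  have h8 := hr.eight_mul_le
  have hd' := hr.d_le
  have hb := hr.base_le
  have hX := hr.index
  obtain ⟨s', r, v⟩ := runs_gridCom hr
  obtain ⟨t, s, h1, h2, h3⟩ := computes_of_runs (by omega) (by omega) (by omega) r
  rw [v] at h1
  have hp' := hp d n hd hn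
  have hq' := hq d n hd hn
  beta_reduce at hp' hq'
  rw [Polynomial.eval_add]
  refine ⟨t, s, h1, h2.trans ?_, by omega⟩
  have hP : 1 ≤ 2 ^ gridExponent d n := Nat.one_le_two_pow
  calc gridCst * ((gridOverhead d n * 2 ^ gridExponent d n + 1) *
        bits (indexBound d n) (valueBound d n) ^ 2)
      ≤ gridCst * (((gridOverhead d n + 1) * 2 ^ gridExponent d n) *
        bits (indexBound d n) (valueBound d n) ^ 2) := by
        refine Nat.mul_le_mul_left _ (Nat.mul_le_mul_right _ ?_)
        rw [add_mul, one_mul]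
        omega
    _ = gridCst * ((gridOverhead d n + 1) * (bits (indexBound d n) (valueBound d n) *
        bits (indexBound d n) (valueBound d n))) * 2 ^ gridExponent d n := by ring
    _ ≤ _ := Nat.mul_le_mul_right _ (by omega)

/-- The computation for side lengths of at most `1`. The bounds `20` and `d + 1` make room for all
variables and for the input. -/
theorem exists_poly_computes_of_le_one : ∃ p : Polynomial ℕ, ∀ d n, 2 ≤ d → n ≤ 1 →
    ∃ t s, gridProg.Computes d n (numPerfectMatchings (gridGraph d n)) t s ∧
      t ≤ p.eval (d + n ^ d) ∧ s ≤ p.eval (d + n ^ d) := by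
  refine ⟨.C (165 * gridCst) * (.X + 10) ^ 2, fun d n hd hn => ?_⟩
  obtain ⟨s', r, v⟩ := runs_gridCom_of_le_one (d := d) (n := n) (X := 20) (V := d + 1) (by omega)
    hn le_rfl le_rfl
  obtain ⟨t, s, h1, h2, h3⟩ := computes_of_runs (by omega) (by omega) (by omega) r
  rw [v] at h1
  have hbits : bits 20 (d + 1) ≤ d + n ^ d + 10 := by
    have h4 : (8 * 20).size ≤ 8 := Nat.size_le.mpr (by norm_num)
    have h5 : (d + 1).size ≤ d + 1 := Nat.size_le.mpr Nat.lt_two_pow_self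
    unfold bits
    omega
  have heval : (.C (165 * gridCst) * (.X + 10) ^ 2 : Polynomial ℕ).eval (d + n ^ d) =
      165 * gridCst * (d + n ^ d + 10) ^ 2 := by
    simp
  rw [heval]
  generalize bits 20 (d + 1) = σ at *
  generalize d + n ^ d + 10 = τ at *
  have h6 : σ ^ 2 ≤ τ ^ 2 := Nat.pow_le_pow_left hbits 2
  have h7 : τ ≤ τ ^ 2 := Nat.le_self_pow (by norm_num) τ
  refine ⟨t, s, h1, h2.trans ?_, h3.trans ?_⟩
  · calc gridCst * ((3 + 1) * σ ^ 2) = 4 * gridCst * σ ^ 2 := by ring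
      _ ≤ _ := Nat.mul_le_mul (Nat.mul_le_mul_right _ (by norm_num)) h6
  · calc gridCst * ((8 * 20 + 1) * σ) = 161 * gridCst * σ := by ring
      _ ≤ _ := Nat.mul_le_mul (Nat.mul_le_mul_right _ (by norm_num)) (hbits.trans h7)

end RAM

theorem theorem3 :
    ∃ (P : RAM.Prog) (p : Polynomial ℕ), ∀ d n : ℕ, 2 ≤ d →
      ∃ t s : ℕ, P.Computes d n (numPerfectMatchings (gridGraph d n)) t s ∧
        (t : ℝ) ≤ (p.eval (d + n ^ d) : ℕ) *
          (2 : ℝ) ^ (((2 : ℝ) ^ d - 1) / ((2 : ℝ) ^ (d - 1) - 1) * (n : ℝ) ^ (d - 1)) ∧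
        s ≤ p.eval (d + n ^ d) := by
  obtain ⟨p, hp⟩ := RAM.exists_poly_computes
  obtain ⟨q, hq⟩ := RAM.exists_poly_computes_of_le_one
  refine ⟨RAM.gridProg, p + q, fun d n hd => ?_⟩
  rw [Polynomial.eval_add]
  -- with `τ = 0` this says that the exponential factor is at least `1`
  have hexp : ∀ τ : ℕ, (2 : ℝ) ^ (∑ i ∈ Finset.range τ, cutSize d n i) ≤
      (2 : ℝ) ^ (((2 : ℝ) ^ d - 1) / ((2 : ℝ) ^ (d - 1) - 1) * (n : ℝ) ^ (d - 1)) := fun τ => by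
    rw [← Real.rpow_natCast]
    exact Real.rpow_le_rpow_of_exponent_le (by norm_num) (sum_cutSize_le hd τ)
  have hnat : ∀ {t k τ : ℕ}, t ≤ k * 2 ^ (∑ i ∈ Finset.range τ, cutSize d n i) → (t : ℝ) ≤
      k * (2 : ℝ) ^ (((2 : ℝ) ^ d - 1) / ((2 : ℝ) ^ (d - 1) - 1) * (n : ℝ) ^ (d - 1)) := by
    intro t k τ h
    calc (t : ℝ) ≤ k * (2 : ℝ) ^ (∑ i ∈ Finset.range τ, cutSize d n i) := by exact_mod_cast h
      _ ≤ _ := mul_le_mul_of_nonneg_left (hexp τ) (Nat.cast_nonneg k)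
  rcases Nat.lt_or_ge n 2 with hn | hn
  · obtain ⟨t, s, h1, h2, h3⟩ := hq d n hd (by omega)
    refine ⟨t, s, h1, hnat (τ := 0) ?_, by omega⟩
    rw [Finset.range_zero, Finset.sum_empty, pow_zero, mul_one]
    omega
  · obtain ⟨t, s, h1, h2, h3⟩ := hp d n hd hn
    exact ⟨t, s, h1, hnat (h2.trans (Nat.mul_le_mul_right _ (by omega))), by omega⟩
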